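/- Let $\mathbb{F}_q$ be a finite field with $q$ elements, $\alpha$ a primitive element of $\mathbb{F}_q$, and let $s,d\ge 0$, $n\ge 1$ be integers with $n\le\frac{q-1}{s}$. The folded Reed--Solomon code $\mathrm{FRS}_{q,s}(n,d)\subseteq(\mathbb{F}_q^s)^n$ consists of the words whose $i$-th symbol ($0\le i<n$) is $\big(P(\alpha^{is}),P(\alpha^{is+1}),\dots,P(\alpha^{is+s-1})\big)$, where $P\in\mathbb{F}_q[X]$ has degree at most $d$. For sets $S=(S_1,\dots,S_n)$ of symbols put $dist(c,S)=\frac1n|\{i: c_i\notin S_i\}|$. A code $C\subseteq\Sigma^n$ is $(\rho,\ell,L)$-list recoverable if for all $S_1,\dots,S_n\subseteq\Sigma$ of size $\ell$ at most $L$ codewords $c\in C$ satisfy $dist(c,S)\le\rho$, and it is $(\rho,L)$-list decodable if for every $w\in\Sigma^n$ at most $L$ codewords differ from $w$ in at most a $\rho$ fraction of the coordinates. Let $\delta:=1-\frac{d}{sn}$, and let $\varepsilon>0$ be real and $\ell\ge1$ an integer with $\frac{16\ell}{\varepsilon^2}\le s$. Then $\mathrm{FRS}_{q,s}(n,d)$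 is $(\delta-\varepsilon,\ell,L)$-list recoverable for some integer $$L\le\Big(\frac{\ell}{\varepsilon}\Big)^{4\ell/\varepsilon}.$$ Moreover, there is a randomized algorithm (one program for all parameters, on a random access machine with logarithmic cost) that list recovers $\mathrm{FRS}_{q,s}(n,d)$ with these parameters in time $\mathrm{poly}(\log q,s,d,n,L)$ with high probability. Precisely, there are a program and a polynomial such that for all parameters as above there is an $L$ as above for which, moreover, the following holds if $\varepsilon\le\delta$ (if $\varepsilon>\delta$ the list is empty). Write $q=p^k$ with $p$ prime. The program is given $p$, $k$, a presentation $\mathbb{F}_q=\mathbb{F}_p[X]/(f)$, the element $\alpha$, the numbers $s,d,n,\ell$, the number $\lfloor(\delta-\varepsilon)n\rfloor$ of errors, an integer $\kappa\ge0$, and sets $S_1,\dots,S_n\subseteq\mathbb{F}_q^s$ of size $\ell$, each listed in some order. It always halts within a number of steps bounded by the polynomial in $\lceil\log_2 q\rceil,s,d,n,L,\kappa$, and with probability at least $1-2^{-\kappa}$ it outputs exactly the list of all $c\in\mathrm{FRS}_{q,s}(n,d)$ with $dist(c,S)\le\delta-\varepsilon$, without repetition. In particular (the case $\ell=1$), if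 $\frac{16}{\varepsilon^2}\le s$, then $\mathrm{FRS}_{q,s}(n,d)$ is $(\delta-\varepsilon,L)$-list decodable for some integer $L\le(1/\varepsilon)^{4/\varepsilon}$. -/

import Mathlib

/-! ### Codes, list recovery and list decoding -/

/-- `dist(x, S)`: the fraction of coordinates `i` with `x i ∉ S i`. -/
noncomputable def listDist {n : ℕ} {A : Type*} (x : Fin n → A) (S : Fin n → Set A) : ℝ :=
  ({i | x i ∉ S i}.ncard : ℝ) / n

/-- `dist(x, y)`: the fraction of coordinates in which `x` and `y` differ. -/
noncomputable def relDist {n : ℕ} {A : Type*} (x y : Fin n → A) : ℝ :=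
  ({i | x i ≠ y i}.ncard : ℝ) / n

/-- The output list of list recovery: all codewords at distance at most `ρ` from `S`. -/
def recoveryList {n : ℕ} {A : Type*} (C : Set (Fin n → A)) (ρ : ℝ) (S : Fin n → Set A) :
    Set (Fin n → A) :=
  {c | c ∈ C ∧ listDist c S ≤ ρ}

/-- `C` is `(ρ, ℓ, L)`-list recoverable. -/
def IsListRecoverable {n : ℕ} {A : Type*} (C : Set (Fin n → A)) (ρ : ℝ) (ℓ L : ℕ) : Prop :=
  ∀ S : Fin n → Set A, (∀ i, (S i).encard = ℓ) → (recoveryList C ρ S).encard ≤ L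

/-- `C` is `(ρ, L)`-list decodable. -/
def IsListDecodable {n : ℕ} {A : Type*} (C : Set (Fin n → A)) (ρ : ℝ) (L : ℕ) : Prop :=
  ∀ w : Fin n → A, {c | c ∈ C ∧ relDist c w ≤ ρ}.encard ≤ L

/-- The folded Reed-Solomon code with folding parameter `s`, block length `n`, and evaluation
points the powers of `α`: column `i` of the codeword of `P`, `deg P ≤ d`, is
`(P(α^(is)), P(α^(is+1)), …, P(α^(is+s-1)))`. -/
def FRS {F : Type*} [Field F] (α : F) (s n d : ℕ) : Set (Fin n → Fin s → F) :=
  {c | ∃ P : Polynomial F, P.natDegree ≤ d ∧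
    ∀ (i : Fin n) (j : Fin s), c i j = P.eval (α ^ ((i : ℕ) * s + (j : ℕ)))}

/-! ### Probabilistic random access machines with logarithmic cost

Programs are structured programs over natural-number registers and natural-number arrays
(finitely many of each occur in a program). Evaluating an expression costs, for each of its nodes,
one plus the bit length of the value of that node; so all running times are bit complexities up
to a polynomial. A program may flip fair coins. -/

namespace RAM

/-- A memory: registers, arrays, and the number of coins flipped so far. -/
structure State where
  reg : ℕ → ℕ
  arr : ℕ → ℕ → ℕ
  used : ℕ

inductive Expr where
  | lit (v : ℕ)
  | reg (x : ℕ)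
  | get (a : ℕ) (i : Expr)
  | add (e₁ e₂ : Expr)
  | sub (e₁ e₂ : Expr)
  | mul (e₁ e₂ : Expr)
  | div (e₁ e₂ : Expr)
  | mod (e₁ e₂ : Expr)

/-- Values of expressions, with the usual conventions on `ℕ` (truncated subtraction,
`x / 0 = 0`, `x % 0 = x`). -/
def Expr.eval (σ : State) : Expr → ℕ
  | .lit v => v
  | .reg x => σ.reg x
  | .get a i => σ.arr a (i.eval σ)
  | .add e₁ e₂ => e₁.eval σ + e₂.eval σ
  | .sub e₁ e₂ => e₁.eval σ - e₂.eval σ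
  | .mul e₁ e₂ => e₁.eval σ * e₂.eval σ
  | .div e₁ e₂ => e₁.eval σ / e₂.eval σ
  | .mod e₁ e₂ => e₁.eval σ % e₂.eval σ

/-- Logarithmic cost of evaluating an expression. -/
def Expr.cost (σ : State) : Expr → ℕ
  | .lit v => 1 + v.size
  | .reg x => 1 + (σ.reg x).size
  | .get a i => i.cost σ + (1 + (σ.arr a (i.eval σ)).size)
  | .add e₁ e₂ => e₁.cost σ + e₂.cost σ + (1 + (e₁.eval σ + e₂.eval σ).size)
  | .sub e₁ e₂ => e₁.cost σ + e₂.cost σ + (1 + (e₁.eval σ - e₂.eval σ).size)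
  | .mul e₁ e₂ => e₁.cost σ + e₂.cost σ + (1 + (e₁.eval σ * e₂.eval σ).size)
  | .div e₁ e₂ => e₁.cost σ + e₂.cost σ + (1 + (e₁.eval σ / e₂.eval σ).size)
  | .mod e₁ e₂ => e₁.cost σ + e₂.cost σ + (1 + (e₁.eval σ % e₂.eval σ).size)

inductive Prog where
  | nop
  /-- `reg x := e` -/
  | assign (x : ℕ) (e : Expr)
  /-- `arr a [i] := e` -/
  | store (a : ℕ) (i e : Expr)
  /-- `reg x :=` a fresh fair coin in `{0, 1}` -/
  | flip (x : ℕ)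
  | seq (c₁ c₂ : Prog)
  /-- if `e ≠ 0` then `c₁` else `c₂` -/
  | cond (e : Expr) (c₁ c₂ : Prog)
  /-- while `e ≠ 0` do `c` -/
  | loop (e : Expr) (c : Prog)

/-- `Exec ω c σ σ' t`: with coin flips `ω 0, ω 1, …`, the program `c` started in `σ` halts in `σ'`
after `t` steps. -/
inductive Exec (ω : ℕ → Bool) : Prog → State → State → ℕ → Prop
  | nop (σ : State) : Exec ω .nop σ σ 1
  | assign (x : ℕ) (e : Expr) (σ : State) :
      Exec ω (.assign x e) σ { σ with reg := Function.update σ.reg x (e.eval σ) } (e.cost σ + 1)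
  | store (a : ℕ) (i e : Expr) (σ : State) :
      Exec ω (.store a i e) σ
        { σ with
          arr := Function.update σ.arr a (Function.update (σ.arr a) (i.eval σ) (e.eval σ)) }
        (i.cost σ + e.cost σ + 1)
  | flip (x : ℕ) (σ : State) :
      Exec ω (.flip x) σ
        { σ with reg := Function.update σ.reg x (Bool.toNat (ω σ.used)), used := σ.used + 1 } 1
  | seq {c₁ c₂ : Prog} {σ σ₁ σ₂ : State} {t₁ t₂ : ℕ} (h₁ : Exec ω c₁ σ σ₁ t₁)
      (h₂ : Exec ω c₂ σ₁ σ₂ t₂) : Exec ω (.seq c₁ c₂) σ σ₂ (t₁ + t₂)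
  | cond_true {e : Expr} {c₁ c₂ : Prog} {σ σ' : State} {t : ℕ} (he : e.eval σ ≠ 0)
      (h : Exec ω c₁ σ σ' t) : Exec ω (.cond e c₁ c₂) σ σ' (e.cost σ + 1 + t)
  | cond_false {e : Expr} {c₁ c₂ : Prog} {σ σ' : State} {t : ℕ} (he : e.eval σ = 0)
      (h : Exec ω c₂ σ σ' t) : Exec ω (.cond e c₁ c₂) σ σ' (e.cost σ + 1 + t)
  | loop_done {e : Expr} {c : Prog} {σ : State} (he : e.eval σ = 0) :
      Exec ω (.loop e c) σ σ (e.cost σ + 1)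
  | loop_step {e : Expr} {c : Prog} {σ σ₁ σ₂ : State} {t₁ t₂ : ℕ} (he : e.eval σ ≠ 0)
      (h₁ : Exec ω c σ σ₁ t₁) (h₂ : Exec ω (.loop e c) σ₁ σ₂ t₂) :
      Exec ω (.loop e c) σ σ₂ (e.cost σ + 1 + t₁ + t₂)

/-- The law of an infinite sequence of independent fair coin flips. -/
noncomputable def coins : MeasureTheory.Measure (ℕ → Bool) :=
  MeasureTheory.Measure.infinitePi fun _ => (PMF.uniformOfFintype Bool).toMeasure

end RAM

/-! ### Input and output of list recovery

A finite field `F` of characteristic `p` is presented to the machine as `(ℤ/p)[X]/(f)`, through a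
power basis `1, β, …, β^(k-1)` of `F` over `ℤ/p` and the minimal polynomial `f` of `β`. -/

section Encoding

variable {p : ℕ} [Fact p.Prime] {F : Type*} [Field F] [Algebra (ZMod p) F]

/-- The code of `c₀ + c₁ β + … + c_{k-1} β^(k-1)` is the number with base-`p` digits
`c₀, …, c_{k-1}`. It is a number below `|F|`. -/
noncomputable def fieldCode (pb : PowerBasis (ZMod p) F) (x : F) : ℕ :=
  ∑ i : Fin pb.dim, (pb.basis.repr x i).val * p ^ (i : ℕ)

/-- The number whose base-`p` digits are the coefficients of the minimal polynomial of `β`. -/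
noncomputable def modulusCode (pb : PowerBasis (ZMod p) F) : ℕ :=
  ∑ i ∈ Finset.range (pb.dim + 1), ((minpoly (ZMod p) pb.gen).coeff i).val * p ^ i

/-- The initial memory. Registers `0, …, 9` hold `p`, `k`, the modulus, `α`, `s`, `d`, `n`, `ℓ`,
the number `e` of errors and the confidence parameter `κ`. Cell `(i * ℓ + j) * s + r` of array `0`
holds the `r`-th entry of the `j`-th element of the `i`-th input list. All else is `0`. -/
noncomputable def inputState (pb : PowerBasis (ZMod p) F) (α : F) (s d n ℓ e κ : ℕ)
    (E : Fin n → Fin ℓ → Fin s → F) : RAM.State where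
  reg := fun x =>
    [p, pb.dim, modulusCode pb, fieldCode pb α, s, d, n, ℓ, e, κ].getD x 0
  arr := fun a idx =>
    if h : a = 0 ∧ idx / s / ℓ < n ∧ idx / s % ℓ < ℓ ∧ idx % s < s then
      fieldCode pb (E ⟨idx / s / ℓ, h.2.1⟩ ⟨idx / s % ℓ, h.2.2.1⟩ ⟨idx % s, h.2.2.2⟩)
    else 0
  used := 0

/-- The final memory `σ` contains the list `T` without repetition: register `0` holds the number
of words, and cell `(m * n + i) * s + r` of array `1` holds entry `r` of column `i` of the `m`-th
word. -/
def IsOutputList (pb : PowerBasis (ZMod p) F) {s n : ℕ} (T : Set (Fin n → Fin s → F))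
    (σ : RAM.State) : Prop :=
  ∃ w : Fin (σ.reg 0) → Fin n → Fin s → F, Function.Injective w ∧ Set.range w = T ∧
    ∀ (m : Fin (σ.reg 0)) (i : Fin n) (r : Fin s),
      σ.arr 1 (((m : ℕ) * n + (i : ℕ)) * s + (r : ℕ)) = fieldCode pb (w m i r)

end Encoding

/-- Started with the enumerated lists `E i` as input, the program `M` halts within `T` steps for
every outcome of its coin flips, and with probability at least `1 - 2^(-κ)` its output is the list
of all `c ∈ FRS` at distance at most `ρ` from the lists. The radius is given to the machine as the
number `⌊ρ n⌋` of errors. -/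
def RecoversWithin {p : ℕ} [Fact p.Prime] {F : Type*} [Field F] [Algebra (ZMod p) F]
    (M : RAM.Prog) (pb : PowerBasis (ZMod p) F) (α : F) (s d n ℓ : ℕ) (ρ : ℝ) (κ : ℕ)
    (E : Fin n → Fin ℓ → Fin s → F) (T : ℕ) : Prop :=
  (∀ ω : ℕ → Bool, ∃ (σ : RAM.State) (t : ℕ),
    RAM.Exec ω M (inputState pb α s d n ℓ ⌊ρ * n⌋₊ κ E) σ t ∧ t ≤ T) ∧
  1 - (1 / 2 : ℝ) ^ κ ≤ RAM.coins.real {ω | ∃ (σ : RAM.State) (t : ℕ),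
    RAM.Exec ω M (inputState pb α s d n ℓ ⌊ρ * n⌋₊ κ E) σ t ∧
    IsOutputList pb (recoveryList (FRS α s n d) ρ fun i => Set.range (E i)) σ}

/-! List recovery of folded Reed-Solomon codes by linear-algebraic interpolation, after Guruswami
and Wang, with a random choice of agreements by which the solution space is cut down to one point.

Let `a = n - e` be the number of columns in which a codeword has to agree with the lists. The
hypotheses on `ε` say that `g = a s - d` is at least `ε n s`, and that `16 ℓ n² s ≤ g²`
(`RAM.Par.Std.wide`). With `m = ⌊2 ℓ n s / g⌋`, so that `m ≤ 2 ℓ / ε`, counting unknowns gives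
polynomials `A₀, …, A_m`, not all zero, such that `A₀(x) + ∑ j, A_{j+1}(x) y_j = 0` whenever `y₀, …,
y_{m-1}` are consecutive entries of an element of a list, and `x` is the evaluation point of the
first of them (`RAM.exists_interp`). For every message polynomial `p` that is to be found, `A₀ + ∑
j, A_{j+1} p(α^j X)` has more zeros than its degree allows, and so vanishes (`RAM.IsMsg.interp`).
This is an affine condition on `p`, and the corresponding linear space `V` has dimension less than
`m` (`RAM.finrank_solSpace_lt`).

A nonzero element of `V` vanishes on at most `d / s` columns, hence not on at least `g / s` of the
columns in which the codeword of `p` agrees with the lists. Requiring agreement with one list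
element after the other, at least `(g / s)^m` of the `(n ℓ)^m` sequences of `m` list elements
consist of agreements of `p` and admit no other solution than `p` (`RAM.pow_le_card_cut`,
`RAM.exists_good`). Such sequences are different for different `p`, so the number of messages is at
most `(n ℓ s / g)^m ≤ (ℓ / ε)^(2 ℓ / ε)` (`RAM.card_msg_mul_le`, `RAM.Par.Std.le_rpow`).

The same count gives the algorithm: a random sequence of `m` list elements isolates any given
message with probability at least `1 / M₀`, where `M₀` is the bound just given plus one. After `M₀
(M₀ + κ + 1)` trials, all messages have been isolated, except with probability `2^(-κ)`. The coins
are read as the binary digits of one number, the digits of which in base `(n ℓ)^m` are the trials;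
they are only nearly uniform, which costs a factor of `2` (`RAM.coins_avoid_le`,
`RAM.coins_bad_le`). In each trial a homogeneous linear system is solved, whose unknowns are the
coefficients of a message and a common factor. The output is correct whenever every message is
isolated by some trial, since only words that pass the tests of being in the radius and of being new
are put on the list (`RAM.den_trialC`, `RAM.coins_output_ge`).

The program is written in a language of counted loops with a total semantics, for which a syntactic
condition implies polynomial running time (`RAM.Cmd.exec_of_tame`): loops are bounded by parameters,
and no assignment makes a number much longer than those already in the memory. Elements of the field
are handled through their codes (`RAM.fieldSpec`), and linear systems by an elimination without
divisions, which keeps a square matrix whose rows span the solutions (`RAM.IsKer.step`). -/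

/-! ### A language of bounded loops -/

namespace RAM

/-- The memory with register `x` set to `v`. -/
def State.set (σ : State) (x v : ℕ) : State :=
  { σ with reg := Function.update σ.reg x v }

/-- The memory with cell `i` of array `a` set to `v`. -/
def State.put (σ : State) (a i v : ℕ) : State :=
  { σ with arr := Function.update σ.arr a (Function.update (σ.arr a) i v) }

theorem State.set_reg (σ : State) (x v y : ℕ) :
    (σ.set x v).reg y = if y = x then v else σ.reg y := by
  simp [State.set, Function.update_apply]

@[simp] theorem State.set_arr (σ : State) (x v : ℕ) : (σ.set x v).arr = σ.arr := rfl

theorem State.put_arr (σ : State) (a i v b j : ℕ) :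
    (σ.put a i v).arr b j = if b = a ∧ j = i then v else σ.arr b j := by
  by_cases h : b = a
  · subst h; simp [State.put, Function.update_apply]
  · simp [State.put, h]

/-- Programs in which the only loops are counted loops: `rep i x c` runs `c` with register `i` equal
to `0, 1, …` in turn, as long as it is below register `x`. -/
inductive Cmd where
  | nop
  | assign (x : ℕ) (e : Expr)
  | store (a : ℕ) (i e : Expr)
  | flip (x : ℕ)
  | seq (c₁ c₂ : Cmd)
  | cond (e : Expr) (c₁ c₂ : Cmd)
  | rep (i x : ℕ) (c : Cmd)

infixr:60 " ;; " => Cmd.seq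

namespace Cmd

/-- The final memory. Every command terminates, so this is a total function. -/
def den (ω : ℕ → Bool) : Cmd → State → State
  | .nop, σ => σ
  | .assign x e, σ => σ.set x (e.eval σ)
  | .store a i e, σ => σ.put a (i.eval σ) (e.eval σ)
  | .flip x, σ =>
      { σ with reg := Function.update σ.reg x (Bool.toNat (ω σ.used)), used := σ.used + 1 }
  | .seq c₁ c₂, σ => den ω c₂ (den ω c₁ σ)
  | .cond e c₁ c₂, σ => if e.eval σ ≠ 0 then den ω c₁ σ else den ω c₂ σ
  | .rep i x c, σ =>
      Nat.rec (σ.set i 0) (fun j τ => (den ω c τ).set i (j + 1)) (σ.reg x)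

/-- Translation to programs of the machine. -/
def compile : Cmd → Prog
  | .nop => .nop
  | .assign x e => .assign x e
  | .store a i e => .store a i e
  | .flip x => .flip x
  | .seq c₁ c₂ => .seq c₁.compile c₂.compile
  | .cond e c₁ c₂ => .cond e c₁.compile c₂.compile
  | .rep i x c => .seq (.assign i (.lit 0))
      (.loop (.sub (.reg x) (.reg i)) (.seq c.compile (.assign i (.add (.reg i) (.lit 1)))))

/-- Whether register `y` may be written. -/
def wr (y : ℕ) : Cmd → Bool
  | .nop => false
  | .assign x _ => x == y
  | .store _ _ _ => false
  | .flip x => x == y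
  | .seq c₁ c₂ => c₁.wr y || c₂.wr y
  | .cond _ c₁ c₂ => c₁.wr y || c₂.wr y
  | .rep i _ c => i == y || c.wr y

/-- Whether array `b` may be written. -/
def wra (b : ℕ) : Cmd → Bool
  | .nop => false
  | .assign _ _ => false
  | .store a _ _ => a == b
  | .flip _ => false
  | .seq c₁ c₂ => c₁.wra b || c₂.wra b
  | .cond _ c₁ c₂ => c₁.wra b || c₂.wra b
  | .rep _ _ c => c.wra b

/-- Whether every register that may be written is at least `40`; the registers below `40` hold the
parameters of the computation. -/
def keeps : Cmd → Bool
  | .nop => true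
  | .assign x _ => Nat.ble 40 x
  | .store _ _ _ => true
  | .flip x => Nat.ble 40 x
  | .seq c₁ c₂ => c₁.keeps && c₂.keeps
  | .cond _ c₁ c₂ => c₁.keeps && c₂.keeps
  | .rep i _ c => Nat.ble 40 i && c.keeps

/-- Whether coins may be flipped. -/
def flips : Cmd → Bool
  | .flip _ => true
  | .seq c₁ c₂ => c₁.flips || c₂.flips
  | .cond _ c₁ c₂ => c₁.flips || c₂.flips
  | .rep _ _ c => c.flips
  | _ => false

/-- Without coin flips, the coins do not matter and none is used up. -/
theorem den_of_not_flips {c : Cmd} (h : c.flips = false) (ω ω' : ℕ → Bool) (σ : State) :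
    c.den ω σ = c.den ω' σ ∧ (c.den ω σ).used = σ.used := by
  induction c generalizing σ with
  | nop | assign | store => exact ⟨rfl, rfl⟩
  | flip => simp [flips] at h
  | seq c₁ c₂ h₁ h₂ =>
    simp only [flips, Bool.or_eq_false_iff] at h
    rw [den, den, (h₂ h.2 _).2, (h₁ h.1 σ).2, (h₁ h.1 σ).1]
    exact ⟨(h₂ h.2 _).1, rfl⟩
  | cond e c₁ c₂ h₁ h₂ =>
    simp only [flips, Bool.or_eq_false_iff] at h
    rw [den, den]
    split
    · exact h₁ h.1 σ
    · exact h₂ h.2 σ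
  | rep i x c ih =>
    rw [den, den]
    induction σ.reg x with
    | zero => exact ⟨rfl, rfl⟩
    | succ j hj =>
      simp only
      rw [hj.1, (ih h _).1]
      refine ⟨rfl, ?_⟩
      have := (ih h (Nat.rec (σ.set i 0) (fun j τ => (den ω' c τ).set i (j + 1)) j)).2
      rw [(ih h _).1] at this
      refine Eq.trans this ?_
      rw [← hj.1]; exact hj.2

variable {ω : ℕ → Bool}

theorem den_reg {y : ℕ} (c : Cmd) (h : c.wr y = false) (σ : State) :
    (c.den ω σ).reg y = σ.reg y := by
  induction c generalizing σ with
  | nop => rfl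
  | assign x e =>
    have : y ≠ x := by rintro rfl; simp [wr] at h
    simp [den, State.set_reg, this]
  | store => rfl
  | flip x =>
    have : y ≠ x := by rintro rfl; simp [wr] at h
    simp [den, this]
  | seq c₁ c₂ h₁ h₂ =>
    simp only [wr, Bool.or_eq_false_iff] at h
    rw [den, h₂ h.2, h₁ h.1]
  | cond e c₁ c₂ h₁ h₂ =>
    simp only [wr, Bool.or_eq_false_iff] at h
    rw [den]; split
    · exact h₁ h.1 σ
    · exact h₂ h.2 σ
  | rep i x c ih =>
    simp only [wr, Bool.or_eq_false_iff, beq_eq_false_iff_ne] at h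
    rw [den]
    induction σ.reg x with
    | zero => simp [State.set_reg, h.1.symm]
    | succ j hj => simp [State.set_reg, h.1.symm, ih h.2, hj]

theorem den_arr {b : ℕ} (c : Cmd) (h : c.wra b = false) (σ : State) :
    (c.den ω σ).arr b = σ.arr b := by
  induction c generalizing σ with
  | nop => rfl
  | assign x e => rfl
  | store a i e =>
    have : b ≠ a := by rintro rfl; simp [wra] at h
    simp [den, State.put, this]
  | flip x => rfl
  | seq c₁ c₂ h₁ h₂ =>
    simp only [wra, Bool.or_eq_false_iff] at h
    rw [den, h₂ h.2, h₁ h.1]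
  | cond e c₁ c₂ h₁ h₂ =>
    simp only [wra, Bool.or_eq_false_iff] at h
    rw [den]; split
    · exact h₁ h.1 σ
    · exact h₂ h.2 σ
  | rep i x c ih =>
    simp only [wra] at h
    rw [den]
    induction σ.reg x with
    | zero => rfl
    | succ j hj => simp [ih h, hj]

theorem wr_eq_false_of_keeps {c : Cmd} (h : c.keeps = true) {y : ℕ} (hy : y < 40) :
    c.wr y = false := by
  induction c with
  | nop | store => rfl
  | assign x e | flip x => simp only [keeps, Nat.ble_eq] at h; simp [wr]; omega
  | seq c₁ c₂ h₁ h₂ | cond e c₁ c₂ h₁ h₂ =>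
    simp only [keeps, Bool.and_eq_true] at h; simp [wr, h₁ h.1, h₂ h.2]
  | rep i x c ih =>
    simp only [keeps, Bool.and_eq_true, Nat.ble_eq] at h
    simp [wr, ih h.2]; omega

theorem den_reg_of_keeps {c : Cmd} (h : c.keeps = true) (σ : State) {y : ℕ} (hy : y < 40) :
    (c.den ω σ).reg y = σ.reg y :=
  den_reg c (wr_eq_false_of_keeps h hy) σ

/-- Induction along a counted loop. In each round, the registers and arrays not written by the body
are known to be unchanged. -/
theorem den_rep {i x : ℕ} {c : Cmd} {σ : State} (I : ℕ → State → Prop)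
    (h0 : I 0 (σ.set i 0))
    (hs : ∀ j τ, j < σ.reg x → τ.reg i = j →
      (∀ y, (Cmd.rep i x c).wr y = false → τ.reg y = σ.reg y) →
      (∀ b, c.wra b = false → τ.arr b = σ.arr b) →
      I j τ → I (j + 1) ((c.den ω τ).set i (j + 1))) :
    I (σ.reg x) ((Cmd.rep i x c).den ω σ) := by
  rw [den]
  suffices H : ∀ n ≤ σ.reg x,
      let τ : State := Nat.rec (σ.set i 0) (fun j τ => (den ω c τ).set i (j + 1)) n
      I n τ ∧ τ.reg i = n ∧ (∀ y, (Cmd.rep i x c).wr y = false → τ.reg y = σ.reg y) ∧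
        (∀ b, c.wra b = false → τ.arr b = σ.arr b) from (H _ le_rfl).1
  intro n
  induction n with
  | zero =>
    refine fun _ => ⟨h0, by simp [State.set_reg], fun y hy => ?_, fun b _ => rfl⟩
    simp only [wr, Bool.or_eq_false_iff, beq_eq_false_iff_ne] at hy
    simp [State.set_reg, hy.1.symm]
  | succ n ih =>
    intro hn
    obtain ⟨h1, h2, h3, h4⟩ := ih (by omega)
    refine ⟨hs n _ hn h2 h3 h4 h1, by simp [State.set_reg], fun y hy => ?_, fun b hb => ?_⟩
    · have hy' := hy
      simp only [wr, Bool.or_eq_false_iff, beq_eq_false_iff_ne] at hy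
      simp only [State.set_reg, hy.1.symm, if_false]
      rw [den_reg c hy.2]; exact h3 y hy'
    · simp only [State.set_arr]
      rw [den_arr c hb]; exact h4 b hb

end Cmd

/-! ### Running times -/

/-- Bounded by a polynomial. -/
def PolyBdd (f : ℕ → ℕ) : Prop :=
  ∃ C, ∀ x, f x ≤ C * (x + 1) ^ C

namespace PolyBdd

theorem of_le {f g : ℕ → ℕ} (hg : PolyBdd g) (h : ∀ x, f x ≤ g x) : PolyBdd f := by
  obtain ⟨C, hC⟩ := hg
  exact ⟨C, fun x => (h x).trans (hC x)⟩

theorem const (c : ℕ) : PolyBdd fun _ => c :=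
  ⟨c, fun x => Nat.le_mul_of_pos_right _ (by positivity)⟩

theorem id : PolyBdd fun x => x :=
  ⟨1, fun x => by simp⟩

theorem add {f g : ℕ → ℕ} (hf : PolyBdd f) (hg : PolyBdd g) : PolyBdd fun x => f x + g x := by
  obtain ⟨C, hC⟩ := hf
  obtain ⟨D, hD⟩ := hg
  refine ⟨C + D, fun x => (Nat.add_le_add (hC x) (hD x)).trans ?_⟩
  rw [Nat.add_mul]
  exact Nat.add_le_add (Nat.mul_le_mul_left _ (Nat.pow_le_pow_right (by omega) (by omega)))
    (Nat.mul_le_mul_left _ (Nat.pow_le_pow_right (by omega) (by omega)))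

theorem mul {f g : ℕ → ℕ} (hf : PolyBdd f) (hg : PolyBdd g) : PolyBdd fun x => f x * g x := by
  obtain ⟨C, hC⟩ := hf
  obtain ⟨D, hD⟩ := hg
  refine ⟨C * D + C + D, fun x => (Nat.mul_le_mul (hC x) (hD x)).trans ?_⟩
  calc C * (x + 1) ^ C * (D * (x + 1) ^ D) = (C * D) * (x + 1) ^ (C + D) := by ring
    _ ≤ _ := Nat.mul_le_mul (by omega) (Nat.pow_le_pow_right (by omega) (by omega))

theorem pow {f : ℕ → ℕ} (hf : PolyBdd f) (k : ℕ) : PolyBdd fun x => f x ^ k := by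
  induction k with
  | zero => simpa using const 1
  | succ k ih => simpa [pow_succ] using ih.mul hf

theorem comp {f g : ℕ → ℕ} (hf : PolyBdd f) (hg : PolyBdd g) : PolyBdd fun x => f (g x) := by
  obtain ⟨C, hC⟩ := hf
  exact ((const C).mul ((hg.add (const 1)).pow C)).of_le fun x => hC (g x)

end PolyBdd

/-- All numbers in the memory have at most `b` bits. -/
def Small (σ : State) (b : ℕ) : Prop :=
  (∀ x, (σ.reg x).size ≤ b) ∧ ∀ a i, (σ.arr a i).size ≤ b

theorem Small.mono {σ : State} {b b' : ℕ} (h : Small σ b) (hb : b ≤ b') : Small σ b' :=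
  ⟨fun x => (h.1 x).trans hb, fun a i => (h.2 a i).trans hb⟩

theorem Small.set {σ : State} {b : ℕ} (h : Small σ b) {x v : ℕ} (hv : v.size ≤ b) :
    Small (σ.set x v) b := by
  refine ⟨fun y => ?_, h.2⟩
  rw [State.set_reg]; split
  · exact hv
  · exact h.1 y

theorem Small.put {σ : State} {b : ℕ} (h : Small σ b) {a i v : ℕ} (hv : v.size ≤ b) :
    Small (σ.put a i v) b := by
  refine ⟨h.1, fun a' i' => ?_⟩
  rw [State.put_arr]; split
  · exact hv
  · exact h.2 a' i'

theorem size_add_le (a b : ℕ) : (a + b).size ≤ max a.size b.size + 1 := by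
  rw [Nat.size_le, pow_succ]
  have h1 := (Nat.lt_size_self a).trans_le
    (Nat.pow_le_pow_right two_pos (le_max_left a.size b.size))
  have h2 := (Nat.lt_size_self b).trans_le
    (Nat.pow_le_pow_right two_pos (le_max_right a.size b.size))
  omega

theorem size_mul_le (a b : ℕ) : (a * b).size ≤ a.size + b.size := by
  rw [Nat.size_le, pow_add]
  exact Nat.mul_lt_mul'' (Nat.lt_size_self a) (Nat.lt_size_self b)

theorem size_le_self (a : ℕ) : a.size ≤ a := by
  rw [Nat.size_le]; exact Nat.lt_two_pow_self

namespace Expr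

/-- Sizes of values and costs of an expression are linear in the size of the memory. -/
theorem size_cost_le (e : Expr) : ∃ C, ∀ σ b, Small σ b →
    (e.eval σ).size ≤ C * (b + 1) ∧ e.cost σ ≤ C * (b + 1) := by
  induction e with
  | lit v =>
    refine ⟨v.size + 1, fun σ b _ => ?_⟩
    simp only [eval, cost]
    constructor <;> nlinarith
  | reg x =>
    refine ⟨1, fun σ b h => ?_⟩
    have := h.1 x
    simp only [eval, cost]; omega
  | get a i ih =>
    obtain ⟨C, hC⟩ := ih
    refine ⟨C + 1, fun σ b h => ?_⟩
    have := h.2 a (i.eval σ)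
    have := hC σ b h
    simp only [eval, cost, Nat.add_mul]
    generalize C * (b + 1) = z at *
    omega
  | add e₁ e₂ h₁ h₂ =>
    obtain ⟨C, hC⟩ := h₁
    obtain ⟨D, hD⟩ := h₂
    refine ⟨2 * C + 2 * D + 2, fun σ b h => ?_⟩
    obtain ⟨a1, a2⟩ := hC σ b h
    obtain ⟨b1, b2⟩ := hD σ b h
    have := size_add_le (e₁.eval σ) (e₂.eval σ)
    simp only [eval, cost]
    have e : (2 * C + 2 * D + 2) * (b + 1) = 2 * (C * (b + 1)) + 2 * (D * (b + 1)) + 2 * b + 2 := by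
      ring
    rw [e]
    generalize C * (b + 1) = z at *
    generalize D * (b + 1) = w at *
    omega
  | mul e₁ e₂ h₁ h₂ =>
    obtain ⟨C, hC⟩ := h₁
    obtain ⟨D, hD⟩ := h₂
    refine ⟨2 * C + 2 * D + 2, fun σ b h => ?_⟩
    obtain ⟨a1, a2⟩ := hC σ b h
    obtain ⟨b1, b2⟩ := hD σ b h
    have := size_mul_le (e₁.eval σ) (e₂.eval σ)
    simp only [eval, cost]
    have e : (2 * C + 2 * D + 2) * (b + 1) = 2 * (C * (b + 1)) + 2 * (D * (b + 1)) + 2 * b + 2 := by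
      ring
    rw [e]
    generalize C * (b + 1) = z at *
    generalize D * (b + 1) = w at *
    omega
  | sub e₁ e₂ h₁ h₂ =>
    obtain ⟨C, hC⟩ := h₁
    obtain ⟨D, hD⟩ := h₂
    refine ⟨2 * C + D + 2, fun σ b h => ?_⟩
    obtain ⟨a1, a2⟩ := hC σ b h
    obtain ⟨b1, b2⟩ := hD σ b h
    have := Nat.size_le_size (Nat.sub_le (e₁.eval σ) (e₂.eval σ))
    simp only [eval, cost]
    have e : (2 * C + D + 2) * (b + 1) = 2 * (C * (b + 1)) + D * (b + 1) + 2 * b + 2 := by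
      ring
    rw [e]
    generalize C * (b + 1) = z at *
    generalize D * (b + 1) = w at *
    omega
  | div e₁ e₂ h₁ h₂ =>
    obtain ⟨C, hC⟩ := h₁
    obtain ⟨D, hD⟩ := h₂
    refine ⟨2 * C + D + 2, fun σ b h => ?_⟩
    obtain ⟨a1, a2⟩ := hC σ b h
    obtain ⟨b1, b2⟩ := hD σ b h
    have := Nat.size_le_size (Nat.div_le_self (e₁.eval σ) (e₂.eval σ))
    simp only [eval, cost]
    have e : (2 * C + D + 2) * (b + 1) = 2 * (C * (b + 1)) + D * (b + 1) + 2 * b + 2 := by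
      ring
    rw [e]
    generalize C * (b + 1) = z at *
    generalize D * (b + 1) = w at *
    omega
  | mod e₁ e₂ h₁ h₂ =>
    obtain ⟨C, hC⟩ := h₁
    obtain ⟨D, hD⟩ := h₂
    refine ⟨2 * C + D + 2, fun σ b h => ?_⟩
    obtain ⟨a1, a2⟩ := hC σ b h
    obtain ⟨b1, b2⟩ := hD σ b h
    have := Nat.size_le_size (Nat.mod_le (e₁.eval σ) (e₂.eval σ))
    simp only [eval, cost]
    have e : (2 * C + D + 2) * (b + 1) = 2 * (C * (b + 1)) + D * (b + 1) + 2 * b + 2 := by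
      ring
    rw [e]
    generalize C * (b + 1) = z at *
    generalize D * (b + 1) = w at *
    omega

/-- Expressions whose value is no longer than a parameter. -/
def flat : Expr → Bool
  | .lit _ => true
  | .reg x => Nat.blt x 40
  | .mod _ (.reg x) => x == 0
  | _ => false

/-- Expressions whose value is longer than the longest number in the memory by at most a constant
multiple of the length of the parameters. -/
def lin : Expr → Bool
  | .lit _ => true
  | .reg _ => true
  | .get _ _ => true
  | .add e₁ e₂ => e₁.lin && e₂.lin
  | .sub e₁ _ => e₁.lin
  | .mul e₁ e₂ => e₁.lin && e₂.flat
  | .div e₁ _ => e₁.lin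
  | .mod e₁ _ => e₁.lin

end Expr

/-- The parameters have at most `G` bits, those bounding loops are at most `G`, and the modulus in
register `0` is positive. -/
structure Params (σ : State) (G : ℕ) : Prop where
  size : ∀ x < 40, (σ.reg x).size ≤ G
  val : ∀ x, 4 ≤ x → x < 30 → σ.reg x ≤ G
  pos : 0 < σ.reg 0

namespace Expr

theorem flat_size {e : Expr} (h : e.flat = true) : ∃ C, ∀ σ G, Params σ G →
    (e.eval σ).size ≤ C + G := by
  cases e with
  | lit v => exact ⟨v.size, fun σ G _ => by simp [eval]⟩
  | reg x =>
    refine ⟨0, fun σ G hG => ?_⟩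
    have hx : x < 40 := by simpa [flat, Nat.blt_eq] using h
    simpa [eval] using hG.size x hx
  | mod e₁ e₂ =>
    cases e₂ with
    | reg x =>
      have hx : x = 0 := by simpa [flat] using h
      subst hx
      refine ⟨0, fun σ G hG => ?_⟩
      have := Nat.size_le_size (Nat.mod_lt (e₁.eval σ) hG.pos).le
      simpa [eval] using this.trans (hG.size 0 (by omega))
    | _ => simp [flat] at h
  | _ => simp [flat] at h

/-- The increase in length is bounded in terms of the parameters alone. This is what makes repeated
assignments harmless. -/
theorem lin_size {e : Expr} (h : e.lin = true) : ∃ C, ∀ σ b G, Small σ b → Params σ G →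
    (e.eval σ).size ≤ b + C * (G + 1) := by
  induction e with
  | lit v => exact ⟨v.size, fun σ b G _ _ => by simp only [eval]; nlinarith⟩
  | reg x => exact ⟨0, fun σ b G hb _ => by simpa [eval] using hb.1 x⟩
  | get a i => exact ⟨0, fun σ b G hb _ => by simpa [eval] using hb.2 a _⟩
  | add e₁ e₂ h₁ h₂ =>
    simp only [lin, Bool.and_eq_true] at h
    obtain ⟨C, hC⟩ := h₁ h.1
    obtain ⟨D, hD⟩ := h₂ h.2
    refine ⟨C + D + 1, fun σ b G hb hG => (size_add_le _ _).trans ?_⟩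
    have := hC σ b G hb hG
    have := hD σ b G hb hG
    simp only [Nat.add_mul]
    generalize C * (G + 1) = z at *
    generalize D * (G + 1) = w at *
    omega
  | mul e₁ e₂ h₁ h₂ =>
    simp only [lin, Bool.and_eq_true] at h
    obtain ⟨C, hC⟩ := h₁ h.1
    obtain ⟨D, hD⟩ := flat_size h.2
    refine ⟨C + D + 1, fun σ b G hb hG => (size_mul_le _ _).trans ?_⟩
    have := hC σ b G hb hG
    have := hD σ G hG
    have : D ≤ D * (G + 1) := Nat.le_mul_of_pos_right _ (by omega)
    simp only [Nat.add_mul (_ + _), Nat.add_mul C]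
    generalize C * (G + 1) = z at *
    generalize D * (G + 1) = w at *
    omega
  | sub e₁ e₂ h₁ h₂ =>
    obtain ⟨C, hC⟩ := h₁ h
    exact ⟨C, fun σ b G hb hG => (Nat.size_le_size (Nat.sub_le _ _)).trans (hC σ b G hb hG)⟩
  | div e₁ e₂ h₁ h₂ =>
    obtain ⟨C, hC⟩ := h₁ h
    exact ⟨C, fun σ b G hb hG => (Nat.size_le_size (Nat.div_le_self _ _)).trans (hC σ b G hb hG)⟩
  | mod e₁ e₂ h₁ h₂ =>
    obtain ⟨C, hC⟩ := h₁ h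
    exact ⟨C, fun σ b G hb hG => (Nat.size_le_size (Nat.mod_le _ _)).trans (hC σ b G hb hG)⟩

end Expr

namespace Cmd

/-- A syntactic condition for polynomial running time: only registers that are not parameters are
written, loops are bounded by parameters, and assigned and stored values grow slowly. -/
def tame : Cmd → Bool
  | .nop => true
  | .assign x e => Nat.ble 40 x && e.lin
  | .store _ _ e => e.lin
  | .flip x => Nat.ble 40 x
  | .seq c₁ c₂ => c₁.tame && c₂.tame
  | .cond _ c₁ c₂ => c₁.tame && c₂.tame
  | .rep i x c => Nat.ble 40 i && (Nat.ble 4 x && Nat.blt x 30) && c.tame && !c.wr i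

theorem keeps_of_tame {c : Cmd} (h : c.tame = true) : c.keeps = true := by
  induction c with
  | nop | store => rfl
  | assign x e => simp only [tame, Bool.and_eq_true] at h; exact h.1
  | flip x => exact h
  | seq c₁ c₂ h₁ h₂ | cond e c₁ c₂ h₁ h₂ =>
    simp only [tame, Bool.and_eq_true] at h; simp [keeps, h₁ h.1, h₂ h.2]
  | rep i x c ih =>
    simp only [tame, Bool.and_eq_true] at h
    simp [keeps, ih h.1.2, -Nat.ble_eq, h.1.1.1]

theorem Params.den {c : Cmd} (h : c.tame = true) {ω : ℕ → Bool} {σ : State} {G : ℕ}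
    (hG : Params σ G) : Params (c.den ω σ) G := by
  have H : ∀ x < 40, (c.den ω σ).reg x = σ.reg x :=
    fun x hx => den_reg_of_keeps (keeps_of_tame h) σ hx
  refine ⟨fun x hx => ?_, fun x h1 h2 => ?_, ?_⟩
  · rw [H x hx]; exact hG.size x hx
  · rw [H x (by omega)]; exact hG.val x h1 h2
  · rw [H 0 (by omega)]; exact hG.pos

theorem exec_assign {ω : ℕ → Bool} (x : ℕ) (e : Expr) (σ : State) :
    Exec ω (.assign x e) σ (σ.set x (e.eval σ)) (e.cost σ + 1) :=
  .assign x e σ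

/-- Execution of a counted loop, as an iteration. -/
theorem exec_rep {ω : ℕ → Bool} {i x X : ℕ} {c : Cmd} (τ : ℕ → State) (t s : ℕ)
    (hi : ∀ j ≤ X, (τ j).reg i = j) (hx : ∀ j ≤ X, (τ j).reg x = X)
    (hs : ∀ j < X, ∃ t' ≤ t, Exec ω c.compile (τ j) (c.den ω (τ j)) t')
    (hc : ∀ j < X, (c.den ω (τ j)).reg i = j)
    (hτ : ∀ j < X, τ (j + 1) = (c.den ω (τ j)).set i (j + 1)) (hX : X.size ≤ s) :
    ∀ r j, r + j = X → ∃ t' ≤ (r + 1) * (t + 10 * s + 20),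
      Exec ω (.loop (.sub (.reg x) (.reg i)) (.seq c.compile (.assign i (.add (.reg i) (.lit 1)))))
        (τ j) (τ X) t' := by
  have hsz : ∀ j ≤ X, j.size ≤ s := fun j hj => (Nat.size_le_size hj).trans hX
  intro r
  induction r with
  | zero =>
    intro j hj
    obtain rfl : j = X := by omega
    refine ⟨_, ?_, .loop_done (by simp [Expr.eval, hi, hx])⟩
    simp only [Expr.cost, Expr.eval, hi _ le_rfl, hx _ le_rfl]
    simp
    omega
  | succ r ih =>
    intro j hj
    obtain ⟨t₂, ht₂, h₂⟩ := ih (j + 1) (by omega)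
    obtain ⟨t₁, ht₁, h₁⟩ := hs j (by omega)
    have h3' := exec_assign (ω := ω) i (.add (.reg i) (.lit 1)) (c.den ω (τ j))
    have e : (c.den ω (τ j)).set i ((Expr.add (.reg i) (.lit 1)).eval (c.den ω (τ j))) =
        τ (j + 1) := by
      rw [hτ j (by omega)]; simp [Expr.eval, hc j (by omega)]
    rw [e] at h3'
    refine ⟨_, ?_, .loop_step ?_ (.seq h₁ h3') h₂⟩
    · simp only [Expr.cost, Expr.eval, hi j (by omega), hx j (by omega), hc j (by omega)]
      have a1 := hsz j (by omega)
      have a2 := hsz (j + 1) (by omega)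
      have a3 := hsz (X - j) (by omega)
      have a4 : Nat.size 1 ≤ 1 := Nat.size_one.le
      have a5 : (r + 1 + 1) * (t + 10 * s + 20) =
          (r + 1) * (t + 10 * s + 20) + t + 10 * s + 20 := by
        ring
      have key : ∀ s1 s2 s3 s4 s5 z1 z2 : ℕ, s1 ≤ s → s2 ≤ s → s3 ≤ s → s4 ≤ s → s5 ≤ 1 →
          z1 = z2 + t + 10 * s + 20 → t₂ ≤ z2 →
          1 + s4 + (1 + s2) + (1 + s1) + 1 + (t₁ + (1 + s2 + (1 + s5) + (1 + s3) + 1)) + t₂ ≤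
            z1 := by
        intros; omega
      exact key _ _ _ _ _ _ _ a3 a1 a2 hX a4 a5 ht₂
    · simp [Expr.eval, hi j (by omega), hx j (by omega)]; omega

/-- Tame commands run in polynomial time, and lengthen the numbers in the memory by at most a
polynomial in the parameters. -/
theorem exec_of_tame {c : Cmd} (h : c.tame = true) : ∃ f, PolyBdd f ∧ ∀ ω σ b G,
    Small σ b → Params σ G → (∃ t ≤ (b + 1) * f G, Exec ω c.compile σ (c.den ω σ) t) ∧
      Small (c.den ω σ) (b + f G) := by
  induction c with
  | nop =>
    refine ⟨fun _ => 1, .const 1, fun ω σ b G hb hG =>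
      ⟨⟨1, by beta_reduce; omega, .nop σ⟩, hb.mono (by beta_reduce; omega)⟩⟩
  | assign x e =>
    simp only [tame, Bool.and_eq_true] at h
    obtain ⟨C, hC⟩ := Expr.lin_size h.2
    obtain ⟨D, hD⟩ := Expr.size_cost_le e
    refine ⟨fun G => C * (G + 1) + (D + 1), .add (.mul (.const C) (.add .id (.const 1))) (.const _),
      fun ω σ b G hb hG => ⟨⟨_, ?_, .assign x e σ⟩, ?_⟩⟩
    · have := (hD σ b hb).2
      beta_reduce
      rw [Nat.mul_add]
      nlinarith [Nat.zero_le ((b + 1) * (C * (G + 1)))]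
    · have := hC σ b G hb hG
      beta_reduce
      exact (hb.mono (by omega)).set (by omega)
  | store a i e =>
    obtain ⟨C, hC⟩ := Expr.lin_size h
    obtain ⟨D, hD⟩ := Expr.size_cost_le e
    obtain ⟨D', hD'⟩ := Expr.size_cost_le i
    refine ⟨fun G => C * (G + 1) + (D + D' + 1),
      .add (.mul (.const C) (.add .id (.const 1))) (.const _),
      fun ω σ b G hb hG => ⟨⟨_, ?_, .store a i e σ⟩, ?_⟩⟩
    · have := (hD σ b hb).2
      beta_reduce
      have := (hD' σ b hb).2
      rw [Nat.mul_add]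
      nlinarith [Nat.zero_le ((b + 1) * (C * (G + 1)))]
    · have := hC σ b G hb hG
      beta_reduce
      exact (hb.mono (by omega)).put (by omega)
  | flip x =>
    refine ⟨fun _ => 1, .const 1, fun ω σ b G hb hG => ⟨⟨1, by beta_reduce; omega, .flip x σ⟩, ?_⟩⟩
    refine Small.set (σ := { σ with used := σ.used + 1 }) (hb.mono (by beta_reduce; omega)) ?_
    cases ω σ.used <;> simp
  | seq c₁ c₂ h₁ h₂ =>
    simp only [tame, Bool.and_eq_true] at h
    obtain ⟨f, pf, hf⟩ := h₁ h.1
    obtain ⟨g, pg, hg⟩ := h₂ h.2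
    refine ⟨fun G => f G + (f G + 1) * g G, pf.add ((pf.add (.const 1)).mul pg),
      fun ω σ b G hb hG => ?_⟩
    obtain ⟨⟨t₁, ht₁, e₁⟩, s₁⟩ := hf ω σ b G hb hG
    obtain ⟨⟨t₂, ht₂, e₂⟩, s₂⟩ := hg ω _ _ G s₁ (Params.den h.1 hG)
    refine ⟨⟨_, ?_, .seq e₁ e₂⟩, s₂.mono ?_⟩
    · beta_reduce; nlinarith [Nat.zero_le (b * f G * g G)]
    · beta_reduce; nlinarith [Nat.zero_le (f G * g G)]
  | cond e c₁ c₂ h₁ h₂ =>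
    simp only [tame, Bool.and_eq_true] at h
    obtain ⟨f, pf, hf⟩ := h₁ h.1
    obtain ⟨g, pg, hg⟩ := h₂ h.2
    obtain ⟨D, hD⟩ := Expr.size_cost_le e
    refine ⟨fun G => f G + g G + (D + 1), (pf.add pg).add (.const _), fun ω σ b G hb hG => ?_⟩
    have := (hD σ b hb).2
    by_cases he : e.eval σ = 0
    · obtain ⟨⟨t₂, ht₂, e₂⟩, s₂⟩ := hg ω σ b G hb hG
      have ed : (Cmd.cond e c₁ c₂).den ω σ = c₂.den ω σ := by simp [Cmd.den, he]
      rw [ed]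
      refine ⟨⟨_, ?_, .cond_false he e₂⟩, s₂.mono (by beta_reduce; omega)⟩
      beta_reduce; nlinarith [Nat.zero_le ((b + 1) * f G)]
    · obtain ⟨⟨t₁, ht₁, e₁⟩, s₁⟩ := hf ω σ b G hb hG
      have ed : (Cmd.cond e c₁ c₂).den ω σ = c₁.den ω σ := by simp [Cmd.den, he]
      rw [ed]
      refine ⟨⟨_, ?_, .cond_true he e₁⟩, s₁.mono (by beta_reduce; omega)⟩
      beta_reduce; nlinarith [Nat.zero_le ((b + 1) * g G)]
  | rep i x c ih =>
    simp only [tame, Bool.and_eq_true, Bool.not_eq_true', Nat.ble_eq, Nat.blt_eq] at h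
    obtain ⟨⟨⟨hi40, hx4, hx30⟩, hct⟩, hci⟩ := h
    obtain ⟨f, pf, hf⟩ := ih hct
    refine ⟨fun G => G * f G + (G + 1) * ((1 + (G * f G + G)) * f G + 10 * G + 20) + G + 10,
      by
        have hG := PolyBdd.id
        exact ((hG.mul pf).add ((hG.add (.const 1)).mul (((((PolyBdd.const 1).add
          ((hG.mul pf).add hG)).mul pf).add ((PolyBdd.const 10).mul hG)).add (.const 20)))).add hG
            |>.add (.const 10),
      fun ω σ b G hb hG => ?_⟩
    set τ : ℕ → State := fun n => Nat.rec (σ.set i 0) (fun j τ => (c.den ω τ).set i (j + 1)) n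
      with hτ
    set X := σ.reg x with hX
    have hXG : X ≤ G := hG.val x hx4 hx30
    have hτs : ∀ j, τ (j + 1) = (c.den ω (τ j)).set i (j + 1) := fun j => rfl
    have hτp : ∀ j, ∀ y < 40, (τ j).reg y = σ.reg y := by
      intro j y hy
      have hyi : y ≠ i := by omega
      induction j with
      | zero => simp [hτ, State.set_reg, hyi]
      | succ j ihj =>
        rw [hτs, State.set_reg, if_neg hyi, den_reg_of_keeps (keeps_of_tame hct) _ hy, ihj]
    have hτG : ∀ j, Params (τ j) G := fun j =>
      ⟨fun y hy => by rw [hτp j y hy]; exact hG.size y hy,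
        fun y h1 h2 => by rw [hτp j y (by omega)]; exact hG.val y h1 h2,
        by rw [hτp j 0 (by omega)]; exact hG.pos⟩
    have hτi : ∀ j, (τ j).reg i = j := by
      intro j; cases j <;> simp [hτ, State.set_reg]
    -- The growth `f G` per round depends on the parameters only, so that it adds up to at most
    -- `G * f G` over all rounds; a bound multiplying the length in each round would be useless.
    have hτb : ∀ j ≤ X, Small (τ j) (b + j * f G + G) := by
      intro j
      induction j with
      | zero => intro _; exact (hb.mono (by omega)).set (by simp)
      | succ j ihj =>
        intro hj
        have := (hf ω _ _ G (ihj (by omega)) (hτG j)).2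
        rw [hτs]
        refine (this.mono (by nlinarith)).set ?_
        have := size_le_self (j + 1)
        omega
    have hS : X.size ≤ G := (size_le_self X).trans hXG
    obtain ⟨t, ht, he⟩ := exec_rep (ω := ω) (c := c) (i := i) (x := x) (X := X) τ
      ((b + (G * f G + G) + 1) * f G) G (fun j _ => hτi j) (fun j _ => hτp j x (by omega))
      (fun j hj => by
        obtain ⟨t, ht, he⟩ := (hf ω _ _ G (hτb j hj.le) (hτG j)).1
        refine ⟨t, ht.trans (Nat.mul_le_mul_right _ ?_), he⟩
        have := Nat.mul_le_mul_right (f G) (hj.le.trans hXG)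
        omega)
      (fun j _ => by rw [den_reg c hci, hτi]) (fun j _ => hτs j) hS X 0 (by omega)
    have hden : (Cmd.rep i x c).den ω σ = τ X := rfl
    rw [hden]
    refine ⟨⟨_, ?_, .seq (.assign i (.lit 0) σ) he⟩, (hτb X le_rfl).mono ?_⟩
    · have hc1 : (Expr.lit 0).cost σ + 1 = 2 := by simp [Expr.cost]
      rw [hc1]
      have h1 : t ≤ (G + 1) * ((b + (G * f G + G) + 1) * f G + 10 * G + 20) :=
        ht.trans (Nat.mul_le_mul_right _ (by omega))
      have h2 : (b + (G * f G + G) + 1) * f G + 10 * G + 20 ≤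
          (b + 1) * ((1 + (G * f G + G)) * f G + 10 * G + 20) := by
        generalize G * f G + G = A
        nlinarith [Nat.zero_le (b * A * f G), Nat.zero_le (b * G)]
      have h3 := Nat.mul_le_mul_left (G + 1) h2
      beta_reduce
      generalize (1 + (G * f G + G)) * f G + 10 * G + 20 = B at *
      generalize (b + (G * f G + G) + 1) * f G + 10 * G + 20 = B' at *
      nlinarith [Nat.zero_le ((b + 1) * (G * f G)), Nat.zero_le (b * G)]
    · have := Nat.mul_le_mul_right (f G) hXG
      beta_reduce
      generalize (G + 1) * ((1 + (G * f G + G)) * f G + 10 * G + 20) = B at *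
      omega

/-- Commands without loops. -/
def straight : Cmd → Bool
  | .nop => true
  | .assign _ _ => true
  | .seq c₁ c₂ => c₁.straight && c₂.straight
  | _ => false

/-- Straight-line code takes polynomial time, without any condition on the growth of numbers. -/
theorem exec_of_straight {c : Cmd} (h : c.straight = true) : ∃ f, PolyBdd f ∧ ∀ ω σ b,
    Small σ b → (∃ t ≤ f b, Exec ω c.compile σ (c.den ω σ) t) ∧ Small (c.den ω σ) (f b) := by
  induction c with
  | nop =>
    exact ⟨fun b => b + 1, .add .id (.const 1), fun ω σ b hb =>
      ⟨⟨1, by beta_reduce; omega, .nop σ⟩, hb.mono (by beta_reduce; omega)⟩⟩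
  | assign x e =>
    obtain ⟨D, hD⟩ := Expr.size_cost_le e
    refine ⟨fun b => (D + 1) * (b + 1), .mul (.const _) (.add .id (.const 1)),
      fun ω σ b hb => ⟨⟨_, ?_, .assign x e σ⟩, ?_⟩⟩
    · have := (hD σ b hb).2; beta_reduce; nlinarith
    · have := (hD σ b hb).1
      exact (hb.mono (by nlinarith)).set (by nlinarith)
  | seq c₁ c₂ h₁ h₂ =>
    simp only [straight, Bool.and_eq_true] at h
    obtain ⟨f, pf, hf⟩ := h₁ h.1
    obtain ⟨g, pg, hg⟩ := h₂ h.2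
    refine ⟨fun b => f b + g (f b), pf.add (pg.comp pf), fun ω σ b hb => ?_⟩
    obtain ⟨⟨t₁, ht₁, e₁⟩, s₁⟩ := hf ω σ b hb
    obtain ⟨⟨t₂, ht₂, e₂⟩, s₂⟩ := hg ω _ _ s₁
    exact ⟨⟨_, by beta_reduce; omega, .seq e₁ e₂⟩, s₂.mono (by beta_reduce; omega)⟩
  | _ => simp [straight] at h

end Cmd

end RAM

open RAM.Expr (reg)

/-! ### The program

Registers below `40` are parameters, registers from `40` on are used for the computation. Array `0`
is the input and array `1` the output. The other arrays are: `2`, the powers of `α`; `3`, the square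
matrix undergoing elimination; `4`, the coefficients of the current constraint; `5`, the scalar
products of the constraint with the rows of the matrix; `7`, a copy of the pivot row; `8`, the
coefficients of the interpolation polynomial; `9`, the solution found in a trial; `10`, the
coefficients of the message computed from it; `6`, its codeword. Names of commands end in `C`.
-/

namespace RAM

instance : Add Expr := ⟨Expr.add⟩
instance : Sub Expr := ⟨Expr.sub⟩
instance : Mul Expr := ⟨Expr.mul⟩
instance : Div Expr := ⟨Expr.div⟩
instance : Mod Expr := ⟨Expr.mod⟩
instance (v : ℕ) : OfNat Expr v := ⟨Expr.lit v⟩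

namespace Expr

variable (σ : State) (e₁ e₂ : Expr)

@[simp] theorem eval_zero : (0 : Expr).eval σ = 0 := rfl
@[simp] theorem eval_one : (1 : Expr).eval σ = 1 := rfl
@[simp] theorem eval_two : (2 : Expr).eval σ = 2 := rfl
@[simp] theorem eval_reg (x : ℕ) : (reg x).eval σ = σ.reg x := rfl
@[simp] theorem eval_get (a : ℕ) (i : Expr) : (get a i).eval σ = σ.arr a (i.eval σ) := rfl
@[simp] theorem eval_add : (e₁ + e₂).eval σ = e₁.eval σ + e₂.eval σ := rfl
@[simp] theorem eval_sub : (e₁ - e₂).eval σ = e₁.eval σ - e₂.eval σ := rfl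
@[simp] theorem eval_mul : (e₁ * e₂).eval σ = e₁.eval σ * e₂.eval σ := rfl
@[simp] theorem eval_div : (e₁ / e₂).eval σ = e₁.eval σ / e₂.eval σ := rfl
@[simp] theorem eval_mod : (e₁ % e₂).eval σ = e₁.eval σ % e₂.eval σ := rfl

end Expr

infix:62 " ≔ " => Cmd.assign

/-- The cell of array `a` with index `i`. -/
abbrev cell (a : ℕ) (i : Expr) : Expr := Expr.get a i

/-- The distance `|x - y|`, which is `0` if and only if `x = y`. -/
abbrev diff (x y : Expr) : Expr := x - y + (y - x)

/-- `x < y` if and only if this is `0`. -/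
abbrev notLt (x y : Expr) : Expr := x + 1 - y

/-- The parameters of the computation, kept in the registers below `40`. With
`Q = A₀ + ∑_{j<m} A_{j+1} Y_j` the interpolation polynomial, `D1` is the number of coefficients of
each `A_{j+1}`, `H` that of `A₀`, `U` the number of all of them, and `sm = s - m + 1` the number
of points per column; `g = a s - d`, where `a = n - e` is the number of agreements. `K = n ℓ` is the
number of all pairs of a column and an element of its list, `N` the number of trials, `J` that of
coins, and `lg` the bit length of `f`. -/
structure Par where
  (p k f α s d n ℓ e κ a g m D1 U K E lg N J sm H ns q M0 : ℕ)

/-- The register file holding the parameters. -/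
def Par.glob (P : Par) (x : ℕ) : ℕ :=
  [P.p, P.k, P.f, P.α, P.s, P.d, P.n, P.ℓ, P.e, P.κ, P.a, P.g, P.m, P.D1, P.U, P.K, P.E, P.lg,
    P.N, P.J, P.sm, P.H, P.ns, P.k + 1, P.d + 1, 0, 0, 0, 0, P.k, P.q, P.q - 2, P.p - 1,
    P.m * P.D1, P.d + 2, P.M0].getD x 0

/-- The registers below `40` hold the parameters. -/
def Ctx (P : Par) (σ : State) : Prop :=
  ∀ x < 40, σ.reg x = P.glob x

/-- Digitwise `43 := 40 + 41 * 42`, modulo `p`, on `k + 1` digits in base `p`. -/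
def linC : Cmd :=
  43 ≔ 0 ;; 45 ≔ 1 ;; .rep 44 23
    (43 ≔ reg 43 + reg 45 * ((reg 40 / reg 45 + reg 41 * (reg 42 / reg 45)) % reg 0) ;;
      45 ≔ reg 45 * reg 0)

/-- Field multiplication `52 := 52 + 53 * (50 * 51)`, where `53` is an integer: the digits of
`50` are used one after the other, and `51` is multiplied by the generator of the power basis in
each round. -/
def fmaC : Cmd :=
  54 ≔ 0 ;;
  .rep 55 29
    (40 ≔ reg 54 ;; 41 ≔ reg 50 ;; 42 ≔ reg 51 ;; linC ;; 54 ≔ reg 43 ;;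
      50 ≔ reg 50 / reg 0 ;;
      40 ≔ reg 51 * reg 0 ;; 41 ≔ reg 0 - reg 51 * reg 0 / reg 30 ;; 42 ≔ reg 2 ;; linC ;;
      51 ≔ reg 43) ;;
  40 ≔ reg 52 ;; 41 ≔ reg 53 ;; 42 ≔ reg 54 ;; linC ;; 52 ≔ reg 43

/-- `52 := a + c * (x * y)`. -/
def fma (c x y a : Expr) : Cmd :=
  50 ≔ x ;; 51 ≔ y ;; 52 ≔ a ;; 53 ≔ c ;; fmaC

/-- The powers of `α`, in array `2`. -/
def powC : Cmd :=
  .store 2 0 1 ;;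
  .rep 60 16 (fma 1 (cell 2 (reg 60)) (reg 3) 0 ;; .store 2 (reg 60 + 1) (reg 52))

/-- The matrix in array `3` becomes the diagonal matrix with `1` in the first `reg 70` places. -/
def initC : Cmd :=
  .rep 60 14 (.rep 62 14
    (.store 3 (reg 60 * reg 14 + reg 62)
      (1 - (diff (reg 60) (reg 62) + notLt (reg 60) (reg 70)))))

/-- Scalar products of the rows of array `3` with the vector in array `4`, in array `5`. -/
def dotC : Cmd :=
  .rep 60 14
    (61 ≔ 0 ;;
      .rep 62 14
        (fma 1 (cell 4 (reg 62)) (cell 3 (reg 60 * reg 14 + reg 62)) (reg 61) ;; 61 ≔ reg 52) ;;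
      .store 5 (reg 60) (reg 61))

/-- The index `64` of a nonzero entry of array `5`, and its value `63`; the latter is `1` if there
is none. -/
def pivotC : Cmd :=
  63 ≔ 1 ;; 64 ≔ 0 ;;
  .rep 60 14 (.cond (cell 5 (reg 60)) (63 ≔ cell 5 (reg 60) ;; 64 ≔ reg 60) .nop)

/-- The pivot row is copied to array `7`. -/
def copyC : Cmd :=
  .rep 62 14 (.store 7 (reg 62) (cell 3 (reg 64 * reg 14 + reg 62)))

/-- Elimination of the pivot row. -/
def elimC : Cmd :=
  .rep 60 14 (.rep 62 14
    (fma 1 (reg 63) (cell 3 (reg 60 * reg 14 + reg 62)) 0 ;;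
      fma (reg 32) (cell 5 (reg 60)) (cell 7 (reg 62)) (reg 52) ;;
      .store 3 (reg 60 * reg 14 + reg 62) (reg 52)))

/-- The rows of array `3` are replaced by rows spanning the vectors in their span orthogonal to
array `4`. -/
def stepC : Cmd :=
  dotC ;; pivotC ;; copyC ;; elimC

/-- A nonzero row of array `3`, if there is one, is copied to array `a`. -/
def pickC (a : ℕ) : Cmd :=
  74 ≔ 0 ;;
  .rep 60 14 (.rep 62 14 (.cond (cell 3 (reg 60 * reg 14 + reg 62)) (74 ≔ reg 60) .nop)) ;;
  .rep 62 14 (.store a (reg 62) (cell 3 (reg 74 * reg 14 + reg 62)))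

/-- The interpolation constraint for input word `71` and shift `73`. -/
def interpRowC : Cmd :=
  .rep 62 14
    (.cond (reg 33 - reg 62)
      (fma 1 (cell 2 ((reg 71 / reg 7 * reg 4 + reg 73) * (reg 62 % reg 13)))
          (cell 0 (reg 71 * reg 4 + reg 73 + reg 62 / reg 13)) 0 ;;
        .store 4 (reg 62) (reg 52))
      (.store 4 (reg 62)
        (cell 2 ((reg 71 / reg 7 * reg 4 + reg 73) * (reg 62 - reg 33)))))

/-- Interpolation; the coefficients are stored in array `8`. -/
def interpC : Cmd :=
  70 ≔ reg 14 ;; initC ;; .rep 71 15 (.rep 73 20 (interpRowC ;; stepC)) ;; pickC 8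

/-- The constraint saying that the coefficient `71` of `A₀ + ∑_j A_{j+1} P(α^j X)` vanishes. -/
def identityRowC : Cmd :=
  .rep 62 14
    (76 ≔ 0 ;;
      .cond (reg 62 - reg 5 + (reg 62 - reg 71) + notLt (reg 71) (reg 62 + reg 13)) .nop
        (.rep 78 12
          (fma 1 (cell 8 (reg 78 * reg 13 + (reg 71 - reg 62))) (cell 2 (reg 78 * reg 62))
              (reg 76) ;;
            76 ≔ reg 52)) ;;
      .store 4 (reg 62) (reg 76)) ;;
  .store 4 (reg 24) (cell 8 (reg 33 + reg 71))

/-- The constraint saying that entry `73` of the column belonging to the input word `75` has the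
value prescribed by this word. -/
def agreeRowC : Cmd :=
  .rep 62 14
    (.store 4 (reg 62) (cell 2 ((reg 75 / reg 7 * reg 4 + reg 73) * reg 62))) ;;
  fma (reg 32) 1 (cell 0 (reg 75 * reg 4 + reg 73)) 0 ;;
  .store 4 (reg 24) (reg 52)

/-- The constraints for the message polynomials agreeing with `m` input words, which are chosen by
the digits in base `K` of register `90`. -/
def systemC : Cmd :=
  70 ≔ reg 34 ;; initC ;;
  .rep 71 21 (identityRowC ;; stepC) ;;
  .rep 72 12
    (75 ≔ reg 90 % reg 15 ;; 90 ≔ reg 90 / reg 15 ;; .rep 73 4 (agreeRowC ;; stepC)) ;;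
  pickC 9

/-- `77` becomes the inverse of entry `d + 1` of array `9`, by fast exponentiation. -/
def invC : Cmd :=
  77 ≔ 1 ;; 78 ≔ cell 9 (reg 24) ;; 79 ≔ reg 31 ;;
  .rep 80 17
    (.cond (reg 79 % 2) (fma 1 (reg 77) (reg 78) 0 ;; 77 ≔ reg 52) .nop ;;
      fma 1 (reg 78) (reg 78) 0 ;; 78 ≔ reg 52 ;; 79 ≔ reg 79 / 2)

/-- The codeword, in array `6`, of the polynomial with the coefficients in array `9`, divided by
the entry `d + 1` of this array. -/
def wordC : Cmd :=
  invC ;;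
  .rep 62 24 (fma 1 (reg 77) (cell 9 (reg 62)) 0 ;; .store 10 (reg 62) (reg 52)) ;;
  .rep 60 22
    (61 ≔ 0 ;;
      .rep 62 24 (fma 1 (cell 10 (reg 62)) (cell 2 (reg 60 * reg 62)) (reg 61) ;; 61 ≔ reg 52) ;;
      .store 6 (reg 60) (reg 61))

/-- `81` becomes the number of agreements of array `6` with the input lists. -/
def agreeC : Cmd :=
  81 ≔ 0 ;;
  .rep 60 6
    (82 ≔ 0 ;;
      .rep 62 7
        (83 ≔ 0 ;;
          .rep 84 4
            (83 ≔ reg 83 + diff (cell 6 (reg 60 * reg 4 + reg 84))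
              (cell 0 ((reg 60 * reg 7 + reg 62) * reg 4 + reg 84))) ;;
          .cond (reg 83) .nop (82 ≔ 1)) ;;
      81 ≔ reg 81 + reg 82)

/-- `85` becomes `1` or `0`, according to whether array `6` is one of the words in array
`1`, whose number is in register `91`. -/
def dupC : Cmd :=
  85 ≔ 0 ;;
  .rep 60 18
    (.cond (notLt (reg 60) (reg 91)) .nop
      (83 ≔ 0 ;;
        .rep 84 22
          (83 ≔ reg 83 + diff (cell 6 (reg 84)) (cell 1 (reg 60 * reg 22 + reg 84))) ;;
        .cond (reg 83) .nop (85 ≔ 1)))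

/-- One trial. -/
def trialC : Cmd :=
  systemC ;; wordC ;; agreeC ;; dupC ;;
  .cond (reg 10 - reg 81 + reg 85) .nop
    (.rep 84 22 (.store 1 (reg 91 * reg 22 + reg 84) (cell 6 (reg 84))) ;; 91 ≔ reg 91 + 1)

/-- The deterministic part of the algorithm: interpolation. -/
def prepC : Cmd := powC ;; interpC

/-- The randomized part of the algorithm: the coins make up the number `90`, whose base `K` digits
are used up by the trials. -/
def searchC : Cmd :=
  90 ≔ 0 ;; .rep 92 19 (.flip 93 ;; 90 ≔ reg 90 + reg 90 + reg 93) ;;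
  91 ≔ 0 ;; .rep 94 18 trialC

/-- The list recovery algorithm, once the parameters have been computed. -/
def mainC : Cmd := prepC ;; searchC

/-- Parameters computed without loops. -/
def deriveC : Cmd :=
  29 ≔ reg 1 ;; 23 ≔ reg 1 + 1 ;; 24 ≔ reg 5 + 1 ;; 34 ≔ reg 5 + 2 ;; 32 ≔ reg 0 - 1 ;;
  22 ≔ reg 6 * reg 4 ;; 15 ≔ reg 6 * reg 7 ;;
  10 ≔ reg 6 - reg 8 ;; 11 ≔ reg 10 * reg 4 - reg 5 ;;
  12 ≔ 2 * reg 7 * reg 22 / reg 11 ;; 20 ≔ reg 4 + 1 - reg 12 ;;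
  13 ≔ reg 15 * reg 20 / (reg 12 + 1) + 1 ;; 21 ≔ reg 13 + reg 5 ;; 33 ≔ reg 12 * reg 13 ;;
  14 ≔ reg 33 + reg 21 ;; 16 ≔ reg 22 * reg 14 ;; 36 ≔ reg 7 * reg 22

/-- The powers `q = p^k` and `(n s ℓ)^m`, `g^m`. -/
def powersC : Cmd :=
  42 ≔ 1 ;; .rep 43 29 (42 ≔ reg 42 * reg 0) ;;
  44 ≔ 1 ;; 45 ≔ 1 ;; .rep 43 12 (44 ≔ reg 44 * reg 36 ;; 45 ≔ reg 45 * reg 11)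

/-- The parameters depending on these powers and on the bit length of `f`, found in register
`41`. -/
def budgetC : Cmd :=
  17 ≔ reg 41 ;; 30 ≔ reg 42 ;; 31 ≔ reg 30 - 2 ;; 35 ≔ reg 44 / reg 45 + 1 ;;
  18 ≔ reg 35 * (reg 35 + reg 9 + 1) ;; 19 ≔ reg 15 * reg 12 * reg 18 ;; 36 ≔ 0

/-- `41` becomes the bit length of `f`. -/
def bitlenP : Prog :=
  .seq (.assign 40 (reg 2)) (.seq (.assign 41 0)
    (.loop (reg 40) (.seq (.assign 40 (reg 40 / 2)) (.assign 41 (reg 41 + 1)))))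

/-- The whole algorithm. -/
def recoverP : Prog :=
  .seq deriveC.compile (.seq bitlenP (.seq powersC.compile (.seq budgetC.compile
    (.seq mainC.compile (.assign 0 (reg 91))))))

theorem mainC_tame : mainC.tame = true := by rfl
theorem powersC_tame : powersC.tame = true := by rfl
theorem deriveC_straight : deriveC.straight = true := by rfl
theorem budgetC_straight : budgetC.straight = true := by rfl
end RAM

/-! ### Arithmetic of the field on codes -/

section FieldCode

variable {p : ℕ} [Fact p.Prime] {F : Type*} [Field F] [Algebra (ZMod p) F]

open Finset

theorem sum_digits_lt {c : ℕ → ℕ} {p : ℕ} (hc : ∀ j, c j < p) (K : ℕ) :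
    ∑ j ∈ range K, c j * p ^ j < p ^ K := by
  induction K with
  | zero => simp
  | succ K ih =>
    rw [sum_range_succ, pow_succ]
    have := Nat.mul_le_mul_right (p ^ K) (Nat.succ_le_of_lt (hc K))
    rw [Nat.succ_mul] at this
    nlinarith

theorem sum_digits_div_mod {c : ℕ → ℕ} {p : ℕ} (hp : 0 < p) (hc : ∀ j, c j < p) {K i : ℕ}
    (hi : i < K) : (∑ j ∈ range K, c j * p ^ j) / p ^ i % p = c i := by
  obtain ⟨r, rfl⟩ : ∃ r, K = i + (r + 1) := ⟨K - i - 1, by omega⟩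
  rw [sum_range_add]
  have h : ∑ x ∈ range (r + 1), c (i + x) * p ^ (i + x) =
      p ^ i * (p * (∑ x ∈ range r, c (i + (x + 1)) * p ^ x) + c i) := by
    rw [sum_range_succ', mul_add, mul_sum, mul_sum]
    congr 1
    · refine sum_congr rfl fun x _ => ?_
      ring
    · simp [mul_comm]
  rw [h, Nat.add_mul_div_left _ _ (by positivity),
    Nat.div_eq_of_lt (sum_digits_lt hc i), zero_add, Nat.mul_add_mod, Nat.mod_eq_of_lt (hc i)]

theorem sum_digits_eq {p : ℕ} (N K : ℕ) (hN : N < p ^ K) :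
    ∑ j ∈ range K, N / p ^ j % p * p ^ j = N := by
  induction K generalizing N with
  | zero => simp at hN; simp [hN]
  | succ K ih =>
    rw [sum_range_succ']
    have h1 : N / p < p ^ K := Nat.div_lt_of_lt_mul (by rwa [pow_succ'] at hN)
    have h2 : ∀ j, N / p ^ (j + 1) % p * p ^ (j + 1) = p * (N / p / p ^ j % p * p ^ j) := by
      intro j
      rw [pow_succ', Nat.div_div_eq_div_mul]; ring
    simp only [h2, ← mul_sum, ih _ h1]
    simp [Nat.div_add_mod]

variable (pb : PowerBasis (ZMod p) F)

/-- The field element whose coordinates are the last `K` digits of `N` in base `p`, as a polynomial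
in the generator. -/
noncomputable def digitVal (K N : ℕ) : F :=
  ∑ j ∈ range K, ((N / p ^ j : ℕ) : F) * pb.gen ^ j

theorem algebraMap_val_eq (x : ZMod p) : ((x.val : ℕ) : F) = algebraMap (ZMod p) F x := by
  rw [← map_natCast (algebraMap (ZMod p) F), ZMod.natCast_zmod_val]

theorem cast_mod (N : ℕ) : ((N % p : ℕ) : F) = N := by
  rw [← map_natCast (algebraMap (ZMod p) F), ← map_natCast (algebraMap (ZMod p) F),
    ZMod.natCast_mod]

theorem cast_char : ((p : ℕ) : F) = 0 := by
  have := cast_mod (p := p) (F := F) p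
  simpa using this.symm

theorem digitVal_sum {c : ℕ → ℕ} (hc : ∀ j, c j < p) (K : ℕ) :
    digitVal pb K (∑ j ∈ range K, c j * p ^ j) = ∑ j ∈ range K, (c j : F) * pb.gen ^ j := by
  refine sum_congr rfl fun j hj => ?_
  rw [← cast_mod (p := p), sum_digits_div_mod (Nat.Prime.pos Fact.out) hc (mem_range.1 hj)]

theorem fieldCode_eq_sum_range (x : F) : ∃ c : ℕ → ℕ, (∀ j, c j < p) ∧
    fieldCode pb x = ∑ j ∈ range pb.dim, c j * p ^ j ∧
    ∀ i : Fin pb.dim, c i = (pb.basis.repr x i).val := by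
  refine ⟨fun j => if h : j < pb.dim then (pb.basis.repr x ⟨j, h⟩).val else 0, fun j => ?_, ?_,
    fun i => by simp⟩
  · beta_reduce
    split
    · exact ZMod.val_lt _
    · exact Nat.Prime.pos Fact.out
  · rw [fieldCode, ← Fin.sum_univ_eq_sum_range (fun j => (if h : j < pb.dim then
      (pb.basis.repr x ⟨j, h⟩).val else 0) * p ^ j)]
    exact sum_congr rfl fun i _ => by simp

theorem fieldCode_lt (x : F) : fieldCode pb x < p ^ pb.dim := by
  obtain ⟨c, hc, h, -⟩ := fieldCode_eq_sum_range pb x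
  rw [h]
  exact sum_digits_lt hc _

theorem digitVal_fieldCode (x : F) : digitVal pb pb.dim (fieldCode pb x) = x := by
  obtain ⟨c, hc, h, h'⟩ := fieldCode_eq_sum_range pb x
  rw [h, digitVal_sum pb hc, ← Fin.sum_univ_eq_sum_range (fun j => (c j : F) * pb.gen ^ j)]
  conv_rhs => rw [← pb.basis.sum_repr x]
  refine sum_congr rfl fun i _ => ?_
  rw [h', algebraMap_val_eq, pb.basis_eq_pow, Algebra.smul_def]

theorem fieldCode_digitVal {N : ℕ} (hN : N < p ^ pb.dim) :
    fieldCode pb (digitVal pb pb.dim N) = N := by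
  have h : digitVal pb pb.dim N =
      ∑ i : Fin pb.dim, ((N / p ^ (i : ℕ) : ℕ) : ZMod p) • pb.basis i := by
    rw [digitVal, ← Fin.sum_univ_eq_sum_range (fun j => ((N / p ^ j : ℕ) : F) * pb.gen ^ j)]
    refine sum_congr rfl fun i _ => ?_
    rw [pb.basis_eq_pow, Algebra.smul_def, map_natCast]
  rw [fieldCode, h]
  simp only [pb.basis.repr_sum_self, ZMod.val_natCast]
  rw [Fin.sum_univ_eq_sum_range (fun i => N / p ^ i % p * p ^ i), sum_digits_eq N _ hN]

theorem fieldCode_injective : Function.Injective (fieldCode pb) :=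
  Function.LeftInverse.injective (digitVal_fieldCode pb)

theorem fieldCode_natCast {c : ℕ} (hc : c < p) : fieldCode pb (c : F) = c := by
  have h : digitVal pb pb.dim c = c := by
    rw [digitVal]
    have hd : 0 < pb.dim := pb.dim_pos
    rw [sum_eq_single 0]
    · simp
    · intro j _ hj
      rw [Nat.div_eq_of_lt (hc.trans_le (Nat.le_self_pow hj p))]; simp
    · simp; omega
  rw [← h, fieldCode_digitVal]
  exact hc.trans_le (Nat.le_self_pow pb.dim_pos.ne' p)

/-- The digitwise combination `u + c v` is the code of the corresponding field element, provided
that the digit of weight `p ^ dim` vanishes. -/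
theorem sum_lin_eq {u v c : ℕ} (htop : (u / p ^ pb.dim + c * (v / p ^ pb.dim)) % p = 0) :
    ∑ j ∈ range (pb.dim + 1), (u / p ^ j + c * (v / p ^ j)) % p * p ^ j =
      fieldCode pb (digitVal pb (pb.dim + 1) u + c * digitVal pb (pb.dim + 1) v) := by
  have hp : 0 < p := Nat.Prime.pos Fact.out
  have hlt : ∀ j, (u / p ^ j + c * (v / p ^ j)) % p < p := fun j => Nat.mod_lt _ hp
  have e : digitVal pb (pb.dim + 1) u + c * digitVal pb (pb.dim + 1) v =
      ∑ j ∈ range (pb.dim + 1), (((u / p ^ j + c * (v / p ^ j)) % p : ℕ) : F) * pb.gen ^ j := by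
    rw [digitVal, digitVal, mul_sum, ← sum_add_distrib]
    refine sum_congr rfl fun j _ => ?_
    rw [cast_mod (p := p)]; push_cast; ring
  rw [e, sum_range_succ, sum_range_succ, htop, ← digitVal_sum pb hlt, Nat.cast_zero, zero_mul,
    zero_mul, add_zero, add_zero, fieldCode_digitVal]
  exact sum_digits_lt hlt _

theorem digitVal_succ_fieldCode (x : F) : digitVal pb (pb.dim + 1) (fieldCode pb x) = x := by
  have := digitVal_fieldCode pb x
  rw [digitVal] at this ⊢
  rw [sum_range_succ, this, Nat.div_eq_of_lt (fieldCode_lt pb x)]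
  simp

/-- Shifting the digits by one place is multiplication by the generator, once the digit of weight
`p ^ dim` is taken into account. -/
theorem digitVal_shift (x : F) :
    digitVal pb (pb.dim + 1) (fieldCode pb x * p) = pb.gen * x := by
  have hp : 0 < p := Nat.Prime.pos Fact.out
  conv_rhs => rw [← digitVal_fieldCode pb x]
  rw [digitVal, digitVal, sum_range_succ', mul_sum]
  have h0 : ((fieldCode pb x * p / p ^ 0 : ℕ) : F) = 0 := by
    simp [cast_char]
  rw [h0, zero_mul, add_zero]
  refine sum_congr rfl fun j _ => ?_
  rw [pow_succ' p, ← Nat.div_div_eq_div_mul, Nat.mul_div_cancel _ hp]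
  ring

theorem modulusCode_eq : modulusCode pb =
    ∑ i ∈ range pb.dim, ((minpoly (ZMod p) pb.gen).coeff i).val * p ^ i + p ^ pb.dim := by
  rw [modulusCode, sum_range_succ]
  have h1 : (minpoly (ZMod p) pb.gen).coeff pb.dim = 1 := by
    have := (minpoly.monic pb.isIntegral_gen).coeff_natDegree
    rwa [pb.natDegree_minpoly] at this
  rw [h1, ZMod.val_one'' (Nat.Prime.one_lt Fact.out).ne', one_mul]

theorem modulusCode_lt : modulusCode pb < 2 * p ^ pb.dim := by
  rw [modulusCode_eq, two_mul]
  exact Nat.add_lt_add_right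
    (sum_digits_lt (fun j => ZMod.val_lt _) _) _

theorem modulusCode_div : modulusCode pb / p ^ pb.dim = 1 := by
  have h1 := modulusCode_lt pb
  have h2 : p ^ pb.dim ≤ modulusCode pb := by rw [modulusCode_eq]; omega
  have hp : 0 < p ^ pb.dim := pow_pos (Nat.Prime.pos Fact.out) _
  rw [Nat.div_eq_iff hp]
  omega

/-- The digits of the modulus represent zero, as they are the coefficients of the minimal polynomial
of the generator. -/
theorem digitVal_modulusCode : digitVal pb (pb.dim + 1) (modulusCode pb) = 0 := by
  rw [modulusCode, digitVal_sum pb (fun j => ZMod.val_lt _)]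
  simp only [algebraMap_val_eq]
  have := minpoly.aeval (ZMod p) pb.gen
  rw [Polynomial.aeval_eq_sum_range, pb.natDegree_minpoly] at this
  simpa only [Algebra.smul_def] using this

end FieldCode

namespace RAM

open Finset

theorem Ctx.of_keeps {P : Par} {ω : ℕ → Bool} {σ : State} {c : Cmd} (h : Ctx P σ)
    (hc : c.keeps = true) : Ctx P (c.den ω σ) :=
  fun x hx => (Cmd.den_reg_of_keeps hc σ hx).trans (h x hx)

theorem Ctx.congr {P : Par} {σ τ : State} (h : Ctx P σ) (hc : ∀ x < 40, τ.reg x = σ.reg x) :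
    Ctx P τ :=
  fun x hx => (hc x hx).trans (h x hx)

theorem Ctx.set {P : Par} {σ : State} (h : Ctx P σ) {x : ℕ} (hx : 40 ≤ x) (v : ℕ) :
    Ctx P (σ.set x v) := by
  refine h.congr fun y hy => ?_
  rw [State.set_reg, if_neg (by omega)]

variable {P : Par} {ω : ℕ → Bool} {σ : State}

/-- `43` becomes `40 + 41 * 42`, computed digit by digit, without carries. -/
theorem den_linC (hσ : Ctx P σ) : (linC.den ω σ).reg 43 =
    ∑ j ∈ range (P.k + 1),
      (σ.reg 40 / P.p ^ j + σ.reg 41 * (σ.reg 42 / P.p ^ j)) % P.p * P.p ^ j := by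
  have h23 : ((σ.set 43 0).set 45 1).reg 23 = P.k + 1 := hσ 23 (by omega)
  have H := Cmd.den_rep (ω := ω) (i := 44) (x := 23) (σ := (σ.set 43 0).set 45 1)
    (c := 43 ≔ reg 43 + reg 45 * ((reg 40 / reg 45 + reg 41 * (reg 42 / reg 45)) % reg 0) ;;
      45 ≔ reg 45 * reg 0)
    (fun j τ => τ.reg 43 = (∑ j ∈ range j,
      (σ.reg 40 / P.p ^ j + σ.reg 41 * (σ.reg 42 / P.p ^ j)) % P.p * P.p ^ j) ∧
      τ.reg 45 = P.p ^ j)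
    (by simp [State.set_reg])
    (by
      rintro j τ hj - hw - ⟨h1, h2⟩
      have e0 : τ.reg 0 = P.p := (hw 0 rfl).trans (hσ 0 (by omega))
      have e40 : τ.reg 40 = σ.reg 40 := hw 40 rfl
      have e41 : τ.reg 41 = σ.reg 41 := hw 41 rfl
      have e42 : τ.reg 42 = σ.reg 42 := hw 42 rfl
      simp [Cmd.den, State.set_reg, h1, h2, e0, e40, e41, e42, sum_range_succ, pow_succ, mul_comm])
  rw [h23] at H
  exact H.1

/-- The interface between the program and the field: `enc` is the code of field elements used by the
machine, and `fmaC` computes with it. -/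
structure FieldSpec (P : Par) {F : Type*} [Field F] (enc : F → ℕ) : Prop where
  inj : Function.Injective enc
  zero : enc 0 = 0
  one : enc 1 = 1
  neg : (((P.p - 1 : ℕ) : F)) = -1
  fmaC : ∀ (ω : ℕ → Bool) (σ : State) (x y a : F), Ctx P σ → σ.reg 50 = enc x →
    σ.reg 51 = enc y → σ.reg 52 = enc a →
    (fmaC.den ω σ).reg 52 = enc (a + (σ.reg 53 : F) * (x * y))

section

variable {p : ℕ} [Fact p.Prime] {F : Type*} [Field F] [Algebra (ZMod p) F]
  (pb : PowerBasis (ZMod p) F)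

theorem den_linC_fieldCode (hp : P.p = p) (hk : P.k = pb.dim) (hσ : Ctx P σ) {a b : F}
    (ha : σ.reg 40 = fieldCode pb a) (hb : σ.reg 42 = fieldCode pb b) :
    (linC.den ω σ).reg 43 = fieldCode pb (a + (σ.reg 41 : F) * b) := by
  rw [den_linC hσ, hp, hk, sum_lin_eq, ha, hb, digitVal_succ_fieldCode, digitVal_succ_fieldCode]
  rw [ha, hb, Nat.div_eq_of_lt (fieldCode_lt pb a), Nat.div_eq_of_lt (fieldCode_lt pb b)]
  simp

/-- Multiplication by the generator: the digits are shifted, and the multiple of the modulus that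
clears the digit of weight `p ^ dim` is added. -/
theorem den_linC_shift (hp : P.p = p) (hk : P.k = pb.dim) (hσ : Ctx P σ) {b : F}
    (h40 : σ.reg 40 = fieldCode pb b * p) (h41 : σ.reg 41 = p - fieldCode pb b * p / p ^ pb.dim)
    (h42 : σ.reg 42 = modulusCode pb) :
    (linC.den ω σ).reg 43 = fieldCode pb (pb.gen * b) := by
  have hp0 : 0 < p := Nat.Prime.pos Fact.out
  have hlt : fieldCode pb b * p / p ^ pb.dim < p := by
    rw [Nat.div_lt_iff_lt_mul (by positivity), mul_comm p]
    exact Nat.mul_lt_mul_of_pos_right (fieldCode_lt pb b) hp0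
  rw [den_linC hσ, hp, hk, sum_lin_eq, h40, h42, digitVal_shift, digitVal_modulusCode, mul_zero,
    add_zero]
  rw [h40, h41, h42, modulusCode_div, mul_one, Nat.add_sub_cancel' hlt.le, Nat.mod_self]

/-- In the loop of `fmaC`, after `j` rounds register `51` holds `β^j y`, where `β` is the generator,
and register `54` holds the product of `y` with the part of `x` given by its last `j` digits. -/
theorem fieldSpec (hp : P.p = p) (hk : P.k = pb.dim) (hf : P.f = modulusCode pb)
    (hq : P.q = p ^ pb.dim) : FieldSpec P (fieldCode pb) where
  inj := fieldCode_injective pb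
  zero := by simpa using fieldCode_natCast pb (c := 0) (Nat.Prime.pos Fact.out)
  one := by simpa using fieldCode_natCast pb (c := 1) (Nat.Prime.one_lt Fact.out)
  neg := by
    rw [hp, Nat.cast_sub (Nat.Prime.pos Fact.out), cast_char]; simp
  fmaC := by
    intro ω σ x y a hσ hx hy ha
    set body : Cmd := 40 ≔ reg 54 ;; 41 ≔ reg 50 ;; 42 ≔ reg 51 ;; linC ;; 54 ≔ reg 43 ;;
      50 ≔ reg 50 / reg 0 ;;
      40 ≔ reg 51 * reg 0 ;; 41 ≔ reg 0 - reg 51 * reg 0 / reg 30 ;; 42 ≔ reg 2 ;; linC ;;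
      51 ≔ reg 43 with hbody
    have h29 : (σ.set 54 0).reg 29 = pb.dim := (hσ 29 (by omega)).trans hk
    have H := Cmd.den_rep (ω := ω) (i := 55) (x := 29) (σ := σ.set 54 0) (c := body)
      (fun j τ => τ.reg 50 = fieldCode pb x / p ^ j ∧ τ.reg 51 = fieldCode pb (pb.gen ^ j * y) ∧
        τ.reg 54 = fieldCode pb (digitVal pb j (fieldCode pb x) * y))
      (by
        have := fieldCode_natCast pb (c := 0) (Nat.Prime.pos Fact.out)
        simp [State.set_reg, digitVal, hx, hy] at this ⊢
        exact this.symm)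
      (by
        rintro j τ hj - hw - ⟨h1, h2, h3⟩
        have cτ : Ctx P τ := hσ.congr fun y hy => by
          rw [hw y (Cmd.wr_eq_false_of_keeps (c := .rep 55 29 body) rfl hy), State.set_reg,
            if_neg (by omega)]
        set τ₁ := ((τ.set 40 (τ.reg 54)).set 41 (τ.reg 50)).set 42 (τ.reg 51) with hτ₁
        have c₁ : Ctx P τ₁ := ((cτ.set (by omega) _).set (by omega) _).set (by omega) _
        set τ₂ := linC.den ω τ₁ with hτ₂
        have c₂ : Ctx P τ₂ := c₁.of_keeps rfl
        have a1 : τ₂.reg 43 = _ := den_linC_fieldCode pb hp hk c₁ h3 h2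
        have a2 : τ₂.reg 50 = τ.reg 50 := Cmd.den_reg linC rfl τ₁
        have a3 : τ₂.reg 51 = τ.reg 51 := Cmd.den_reg linC rfl τ₁
        have a4 : τ₂.reg 0 = p := (c₂ 0 (by omega)).trans hp
        have a5 : τ₂.reg 30 = p ^ pb.dim := (c₂ 30 (by omega)).trans hq
        have a6 : τ₂.reg 2 = modulusCode pb := (c₂ 2 (by omega)).trans hf
        set τ₃ := ((((τ₂.set 54 (τ₂.reg 43)).set 50 (τ₂.reg 50 / τ₂.reg 0)).set 40
          (τ₂.reg 51 * τ₂.reg 0)).set 41 (τ₂.reg 0 - τ₂.reg 51 * τ₂.reg 0 / τ₂.reg 30)).set 42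
            (τ₂.reg 2) with hτ₃
        have c₃ : Ctx P τ₃ := ((((c₂.set (by omega) _).set (by omega) _).set (by omega) _).set
          (by omega) _).set (by omega) _
        set τ₄ := linC.den ω τ₃ with hτ₄
        have b1 : τ₄.reg 43 = fieldCode pb (pb.gen * (pb.gen ^ j * y)) :=
          den_linC_shift pb hp hk c₃
            (by simp [hτ₃, State.set_reg, a3, a4, h2])
            (by simp [hτ₃, State.set_reg, a3, a4, a5, h2])
            (by simp [hτ₃, State.set_reg, a6])
        have b2 : τ₄.reg 50 = τ₂.reg 50 / τ₂.reg 0 := Cmd.den_reg linC rfl τ₃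
        have b3 : τ₄.reg 54 = τ₂.reg 43 := Cmd.den_reg linC rfl τ₃
        have e : body.den ω τ = τ₄.set 51 (τ₄.reg 43) := rfl
        rw [e]
        refine ⟨?_, ?_, ?_⟩
        · simp [State.set_reg, b2, a2, a4, h1, pow_succ, Nat.div_div_eq_div_mul]
        · simp [State.set_reg, b1, pow_succ', mul_assoc]
        · simp only [State.set_reg]
          simp only [Nat.reduceEqDiff, if_false, b3, a1]
          congr 1
          have : τ₁.reg 41 = fieldCode pb x / p ^ j := h1
          rw [this, digitVal, digitVal, sum_range_succ]
          ring)
    rw [h29] at H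
    set τ := (Cmd.rep 55 29 body).den ω (σ.set 54 0) with hτ
    have cτ : Ctx P τ := (hσ.set (by omega) 0).of_keeps rfl
    have t52 : τ.reg 52 = σ.reg 52 := Cmd.den_reg (.rep 55 29 body) rfl (σ.set 54 0)
    have t53 : τ.reg 53 = σ.reg 53 := Cmd.den_reg (.rep 55 29 body) rfl (σ.set 54 0)
    have h54 := H.2.2
    rw [digitVal_fieldCode] at h54
    have := den_linC_fieldCode (ω := ω) pb hp hk (a := a) (b := x * y)
      (((cτ.set (x := 40) (by omega) (τ.reg 52)).set (x := 41) (by omega) (τ.reg 53)).set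
        (x := 42) (by omega) (τ.reg 54)) (t52.trans ha) h54
    refine Eq.trans this ?_
    have : (((τ.set 40 (τ.reg 52)).set 41 (τ.reg 53)).set 42 (τ.reg 54)).reg 41 = σ.reg 53 := t53
    rw [this]

end

theorem fma_keeps (c x y a : Expr) : (fma c x y a).keeps = true := rfl

theorem den_fma {F : Type*} [Field F] {enc : F → ℕ} (hF : FieldSpec P enc) (hσ : Ctx P σ)
    {ec ex ey ea : Expr} {c : ℕ} {x y a : F} (hx : ex.eval σ = enc x)
    (hy : ∀ u, ey.eval (σ.set 50 u) = enc y)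
    (ha : ∀ u v, ea.eval ((σ.set 50 u).set 51 v) = enc a)
    (hc : ∀ u v w, ec.eval (((σ.set 50 u).set 51 v).set 52 w) = c) :
    ((fma ec ex ey ea).den ω σ).reg 52 = enc (a + c * (x * y)) := by
  have := hF.fmaC ω ((((σ.set 50 (enc x)).set 51 (enc y)).set 52 (enc a)).set 53 c) x y a
    ((((hσ.set (by omega) _).set (by omega) _).set (by omega) _).set (by omega) _) rfl rfl rfl
  simp only [fma, Cmd.den, hx, hy, ha, hc]
  exact this

end RAM

/-! ### Kernels of matrices -/

namespace RAM

open Finset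

section Kernel

variable {F : Type*} [Field F]

/-- The scalar product of the first `U` coordinates. -/
def dot (U : ℕ) (w v : ℕ → F) : F := ∑ u ∈ range U, w u * v u

/-- `v` is supported in the first `t` of the coordinates below `U`, and orthogonal to all
vectors in `W`. -/
def IsSol (U t : ℕ) (W : Set (ℕ → F)) (v : ℕ → F) : Prop :=
  (∀ u < U, t ≤ u → v u = 0) ∧ ∀ w ∈ W, dot U w v = 0

/-- The rows of `B` span the space of solutions. They need not be linearly independent. -/
structure IsKer (U t : ℕ) (B : ℕ → ℕ → F) (W : Set (ℕ → F)) : Prop where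
  sol : ∀ b < U, IsSol U t W (B b)
  span : ∀ v, IsSol U t W v → ∃ c : ℕ → F, ∀ u < U, v u = ∑ b ∈ range U, c b * B b u

theorem dot_congr {U : ℕ} {w v v' : ℕ → F} (h : ∀ u < U, v u = v' u) :
    dot U w v = dot U w v' :=
  sum_congr rfl fun u hu => by rw [h u (mem_range.1 hu)]

theorem dot_sub (U : ℕ) (w v v' : ℕ → F) (c y : F) :
    dot U w (fun u => c * v u - y * v' u) = c * dot U w v - y * dot U w v' := by
  simp only [dot, mul_sum, ← sum_sub_distrib]
  exact sum_congr rfl fun u _ => by ring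

theorem dot_sum (U : ℕ) (w : ℕ → F) (c : ℕ → F) (B : ℕ → ℕ → F) :
    dot U w (fun u => ∑ b ∈ range U, c b * B b u) = ∑ b ∈ range U, c b * dot U w (B b) := by
  simp only [dot, mul_sum]
  rw [sum_comm]
  exact sum_congr rfl fun u _ => sum_congr rfl fun b _ => by ring

/-- Before any constraint is imposed, the first `t` unit vectors span; the other rows are zero. -/
theorem isKer_init {U t : ℕ} :
    IsKer U t (fun b u => if b = u ∧ b < t then (1 : F) else 0) ∅ := by
  refine ⟨fun b _ => ⟨fun u _ hu => ?_, fun w hw => hw.elim⟩, fun v hv => ⟨v, fun u hu => ?_⟩⟩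
  · exact if_neg (by omega)
  · rw [sum_eq_single u]
    · by_cases h : u < t
      · simp [h]
      · simp [h, hv.1 u hu (by omega)]
    · intro b _ hb; simp [hb]
    · simp [hu]

/-- One step of elimination, where `B i` is the pivot row, and `c` its scalar product with the new
constraint `w`. All rows, including the pivot row, are treated alike; the pivot row becomes zero. If
all rows are orthogonal to `w`, then `c` can be any nonzero scalar. -/
theorem IsKer.step {U t : ℕ} {B : ℕ → ℕ → F} {W : Set (ℕ → F)} (h : IsKer U t B W) {w : ℕ → F}
    {c : F} {i : ℕ} (hc : c ≠ 0) (hi : i < U)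
    (hi' : c = dot U w (B i) ∨ ∀ b < U, dot U w (B b) = 0) :
    IsKer U t (fun b u => c * B b u - dot U w (B b) * B i u) (insert w W) := by
  refine ⟨fun b hb => ⟨fun u hu htu => ?_, ?_⟩, fun v hv => ?_⟩
  · beta_reduce
    rw [(h.sol b hb).1 u hu htu, (h.sol i hi).1 u hu htu]; ring
  · rintro w' (rfl | hw')
    · rw [dot_sub]
      rcases hi' with rfl | h0
      · ring
      · rw [h0 b hb]; ring
    · rw [dot_sub, (h.sol b hb).2 w' hw', (h.sol i hi).2 w' hw']; ring
  · obtain ⟨a, ha⟩ := h.span v ⟨hv.1, fun w' hw' => hv.2 w' (Set.mem_insert_of_mem _ hw')⟩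
    have h0 : ∑ b ∈ range U, a b * dot U w (B b) = 0 := by
      rw [← dot_sum, ← dot_congr ha]
      exact hv.2 w (Set.mem_insert _ _)
    refine ⟨fun b => c⁻¹ * a b, fun u hu => ?_⟩
    rw [ha u hu]
    -- The contributions of the pivot row cancel, because the combination with coefficients `a` is
    -- orthogonal to `w`.
    have e : ∑ b ∈ range U, c⁻¹ * a b * (c * B b u - dot U w (B b) * B i u) =
        ∑ b ∈ range U, a b * B b u - c⁻¹ * (∑ b ∈ range U, a b * dot U w (B b)) * B i u := by
      rw [mul_sum, sum_mul, ← sum_sub_distrib]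
      refine sum_congr rfl fun b _ => ?_
      field_simp
    rw [e, h0]; ring

theorem IsKer.exists_row_ne {U t : ℕ} {B : ℕ → ℕ → F} {W : Set (ℕ → F)} (h : IsKer U t B W)
    {v : ℕ → F} (hv : IsSol U t W v) {u : ℕ} (hu : u < U) (hvu : v u ≠ 0) :
    ∃ b < U, ∃ u < U, B b u ≠ 0 := by
  obtain ⟨c, hc⟩ := h.span v hv
  rw [hc u hu] at hvu
  obtain ⟨b, hb, hb'⟩ := exists_ne_zero_of_sum_ne_zero hvu
  exact ⟨b, mem_range.1 hb, u, hu, right_ne_zero_of_mul hb'⟩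

end Kernel

/-! ### Elimination by the program -/

variable {P : Par} {ω : ℕ → Bool} {σ : State}

theorem Ctx.of_frame {τ : State} {c : Cmd} (h : Ctx P σ) (hk : c.keeps = true)
    (hw : ∀ y, c.wr y = false → τ.reg y = σ.reg y) : Ctx P τ :=
  h.congr fun y hy => hw y (Cmd.wr_eq_false_of_keeps hk hy)

/-- A loop filling an array. -/
theorem den_fill {i x a : ℕ} {c : Cmd} (T : ℕ → ℕ)
    (h : ∀ j τ, j < σ.reg x → τ.reg i = j →
      (∀ y, (Cmd.rep i x c).wr y = false → τ.reg y = σ.reg y) →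
      (∀ b, c.wra b = false → τ.arr b = σ.arr b) →
      (∀ l < j, τ.arr a l = T l) →
      ∀ l, (c.den ω τ).arr a l = if l = j then T j else τ.arr a l) :
    ∀ l < σ.reg x, ((Cmd.rep i x c).den ω σ).arr a l = T l := by
  refine Cmd.den_rep (fun j τ => ∀ l < j, τ.arr a l = T l) (by simp) ?_
  intro j τ hj hi hw ha hI l hl
  rw [State.set_arr, h j τ hj hi hw ha hI l]
  split
  · rename_i e; rw [e]
  · exact hI l (by omega)

/-- A double loop filling a matrix in place. -/
theorem den_fill₂ (hσ : Ctx P σ) {c : Cmd} (hk : c.keeps = true) (h60 : c.wr 60 = false)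
    (T : ℕ → ℕ)
    (h : ∀ b u τ, b < P.U → u < P.U → τ.reg 60 = b → τ.reg 62 = u →
      (∀ y, (Cmd.rep 60 14 (.rep 62 14 c)).wr y = false → τ.reg y = σ.reg y) →
      (∀ b, c.wra b = false → τ.arr b = σ.arr b) →
      τ.arr 3 (b * P.U + u) = σ.arr 3 (b * P.U + u) →
      ∀ l, (c.den ω τ).arr 3 l = if l = b * P.U + u then T l else τ.arr 3 l) :
    ∀ l < P.U * P.U, ((Cmd.rep 60 14 (.rep 62 14 c)).den ω σ).arr 3 l = T l := by
  have h14 : σ.reg 14 = P.U := hσ 14 (by omega)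
  have H := Cmd.den_rep (ω := ω) (i := 60) (x := 14) (c := .rep 62 14 c) (σ := σ)
    (fun j τ => ∀ l, τ.arr 3 l = if l < j * P.U then T l else σ.arr 3 l) (by simp) (by
      intro b τ hb hτ60 hw ha hI
      have c₁ : Ctx P τ := hσ.of_frame (c := .rep 60 14 (.rep 62 14 c)) (by simpa [Cmd.keeps]) hw
      have h14' : τ.reg 14 = P.U := c₁ 14 (by omega)
      have H' := Cmd.den_rep (ω := ω) (i := 62) (x := 14) (c := c) (σ := τ)
        (fun u τ' => ∀ l, τ'.arr 3 l = if l < b * P.U + u then T l else σ.arr 3 l)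
        (by simpa using hI) (by
          intro u τ' hu hτ62 hw' ha' hI' l
          have hw62 : ∀ y, (Cmd.rep 60 14 (.rep 62 14 c)).wr y = false →
              (Cmd.rep 62 14 c).wr y = false := fun y hy => by
            simp only [Cmd.wr, Bool.or_eq_false_iff] at hy ⊢; exact hy.2
          rw [State.set_arr, h b u τ' (by omega) (by omega) ?_ hτ62 ?_ ?_ ?_ l]
          · split
            · rename_i e; rw [if_pos (by omega)]
            · rename_i e; rw [hI' l]
              by_cases hl : l < b * P.U + u
              · rw [if_pos hl, if_pos (by omega)]
              · rw [if_neg hl, if_neg (by omega)]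
          · rw [hw' 60 (by simp [Cmd.wr, h60]), hτ60]
          · exact fun y hy => (hw' y (hw62 y hy)).trans (hw y hy)
          · exact fun a ha₁ => (ha' a ha₁).trans (ha a ha₁)
          · rw [hI', if_neg (by omega)])
      rw [h14'] at H'
      intro l
      rw [State.set_arr, H' l, Nat.succ_mul])
  rw [h14] at H
  intro l hl
  rw [H l, if_pos hl]

section

variable {F : Type*} [Field F] {enc : F → ℕ}

theorem FieldSpec.eq_zero_iff (hF : FieldSpec P enc) (x : F) : enc x = 0 ↔ x = 0 :=
  ⟨fun h => hF.inj (h.trans hF.zero.symm), fun h => h ▸ hF.zero⟩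

/-- The `U` by `U` matrix `B` is stored in array `3`. -/
def HasMat (enc : F → ℕ) (σ : State) (U : ℕ) (B : ℕ → ℕ → F) : Prop :=
  ∀ b < U, ∀ u < U, σ.arr 3 (b * U + u) = enc (B b u)

/-- The vector `v` of length `U` is stored in array `a`. -/
def HasVec (enc : F → ℕ) (σ : State) (a U : ℕ) (v : ℕ → F) : Prop :=
  ∀ u < U, σ.arr a u = enc (v u)

theorem idx_div {b u U : ℕ} (hu : u < U) : (b * U + u) / U = b := by
  rw [mul_comm, Nat.mul_add_div (by omega), Nat.div_eq_of_lt hu, add_zero]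

theorem idx_mod {b u U : ℕ} (hu : u < U) : (b * U + u) % U = u := by
  rw [mul_comm, Nat.mul_add_mod, Nat.mod_eq_of_lt hu]

theorem idx_lt {b u U V : ℕ} (hb : b < V) (hu : u < U) : b * U + u < V * U := by
  have := Nat.mul_le_mul_right U (Nat.succ_le_of_lt hb)
  rw [Nat.succ_mul] at this; omega

/-- A loop accumulating a scalar product. -/
theorem den_sum (hF : FieldSpec P enc) (hσ : Ctx P σ) {i x acc : ℕ} {ex ey : Expr} (hi : 60 ≤ i)
    (hacc : 60 ≤ acc) (hia : i ≠ acc) {a : F} (ha : σ.reg acc = enc a) (f g : ℕ → F)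
    (h : ∀ j τ, j < σ.reg x → τ.reg i = j →
      (∀ y, (Cmd.rep i x (fma 1 ex ey (reg acc) ;; acc ≔ reg 52)).wr y = false →
        τ.reg y = σ.reg y) → τ.arr = σ.arr →
      ex.eval τ = enc (f j) ∧ ∀ u, ey.eval (τ.set 50 u) = enc (g j)) :
    ((Cmd.rep i x (fma 1 ex ey (reg acc) ;; acc ≔ reg 52)).den ω σ).reg acc =
      enc (a + ∑ j ∈ range (σ.reg x), f j * g j) := by
  refine Cmd.den_rep (fun j τ => τ.reg acc = enc (a + ∑ j ∈ range j, f j * g j)) ?_ ?_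
  · simp [State.set_reg, hia.symm, ha]
  · intro j τ hj hτi hw hwa hI
    obtain ⟨h1, h2⟩ := h j τ hj hτi hw (funext fun b => hwa b rfl)
    have cτ : Ctx P τ := hσ.of_frame (by simp [Cmd.keeps, fma_keeps, -Nat.ble_eq]
                                         simp only [Nat.ble_eq]; omega) hw
    have := den_fma (ω := ω) (ec := 1) (ea := reg acc) (c := 1) hF cτ h1 h2
      (a := a + ∑ j ∈ range j, f j * g j)
      (fun u v => by
        rw [Expr.eval_reg, State.set_reg, State.set_reg, if_neg (by omega), if_neg (by omega), hI])
      (fun u v w => rfl)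
    rw [State.set_reg, if_neg hia.symm]
    simp only [Cmd.den, State.set_reg, Expr.eval_reg, if_true, this]
    rw [sum_range_succ]; push_cast; congr 1; ring

theorem den_initC (hF : FieldSpec P enc) (hσ : Ctx P σ) :
    HasMat enc (initC.den ω σ) P.U (fun b u => if b = u ∧ b < σ.reg 70 then (1 : F) else 0) := by
  have H := den_fill₂ (ω := ω) hσ (c := .store 3 (reg 60 * reg 14 + reg 62)
      (1 - (diff (reg 60) (reg 62) + notLt (reg 60) (reg 70)))) rfl rfl
    (fun l => enc (if l / P.U = l % P.U ∧ l / P.U < σ.reg 70 then (1 : F) else 0)) (by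
      intro b u τ hb hu h60 h62 hw _ _ l
      have h14 : τ.reg 14 = P.U := (hw 14 rfl).trans (hσ 14 (by omega))
      have h70 : τ.reg 70 = σ.reg 70 := hw 70 rfl
      rw [Cmd.den, State.put_arr]
      simp only [Expr.eval_add, Expr.eval_sub, Expr.eval_mul, Expr.eval_reg, Expr.eval_one, h14,
        h60, h62, h70, true_and]
      split
      · rename_i e
        rw [e, idx_div hu, idx_mod hu]
        split
        · rw [hF.one]; omega
        · rw [hF.zero]; omega
      · rfl)
  intro b hb u hu
  have := H (b * P.U + u) (idx_lt hb hu)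
  rw [idx_div hu, idx_mod hu] at this
  exact this

theorem den_dotC (hF : FieldSpec P enc) (hσ : Ctx P σ) {B : ℕ → ℕ → F} {w : ℕ → F}
    (hB : HasMat enc σ P.U B) (hw : HasVec enc σ 4 P.U w) :
    HasVec enc (dotC.den ω σ) 5 P.U (fun b => dot P.U w (B b)) := by
  have h14 : σ.reg 14 = P.U := hσ 14 (by omega)
  rw [HasVec, ← h14]
  refine den_fill (fun b => enc (dot (σ.reg 14) w (B b))) ?_
  rw [h14]
  intro b τ hb hτ hwr ha _ l
  have cτ : Ctx P τ := hσ.of_frame rfl hwr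
  have h14' : τ.reg 14 = P.U := cτ 14 (by omega)
  have := den_sum (ω := ω) hF (cτ.set (x := 61) (by omega) 0) (i := 62) (x := 14) (acc := 61)
    (ex := cell 4 (reg 62)) (ey := cell 3 (reg 60 * reg 14 + reg 62)) (by omega) (by omega)
    (by omega) (a := (0 : F)) hF.zero.symm (fun u => w u) (fun u => B b u) (by
      intro u τ' hu hτ' hwr' ha'
      rw [State.set_reg, if_neg (by omega), h14'] at hu
      have e60 : τ'.reg 60 = b := (hwr' 60 rfl).trans hτ
      have e14 : τ'.reg 14 = P.U := (hwr' 14 rfl).trans h14'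
      refine ⟨?_, fun _ => ?_⟩
      · simp only [Expr.eval_get, Expr.eval_reg, ha', State.set_arr, hτ', ha 4 rfl]
        exact hw u hu
      · simp [Expr.eval_get, Expr.eval_reg, ha', State.set_arr, State.set_reg, hτ', e60, e14,
          ha 3 rfl]
        exact hB b hb u hu)
  have e14 : (τ.set 61 0).reg 14 = P.U := h14'
  rw [zero_add, e14] at this
  set τ₁ := (Cmd.rep 62 14 (fma 1 (cell 4 (reg 62)) (cell 3 (reg 60 * reg 14 + reg 62)) (reg 61) ;;
    61 ≔ reg 52)).den ω (τ.set 61 0) with hτ₁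
  have e60 : τ₁.reg 60 = b := (Cmd.den_reg (.rep 62 14 (fma 1 (cell 4 (reg 62))
    (cell 3 (reg 60 * reg 14 + reg 62)) (reg 61) ;; 61 ≔ reg 52)) rfl (τ.set 61 0)).trans hτ
  have e5 : τ₁.arr 5 = τ.arr 5 := Cmd.den_arr (.rep 62 14 (fma 1 (cell 4 (reg 62))
    (cell 3 (reg 60 * reg 14 + reg 62)) (reg 61) ;; 61 ≔ reg 52)) rfl (τ.set 61 0)
  change (τ₁.put 5 (τ₁.reg 60) (τ₁.reg 61)).arr 5 l = _
  rw [State.put_arr, e60, this, e5]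
  simp [dot]

/-- The value `1` of `c` covers the case that all entries vanish, so that no case distinction is
needed in the elimination. -/
theorem den_pivotC (hF : FieldSpec P enc) (hσ : Ctx P σ) (hU : 0 < P.U) {y : ℕ → F}
    (hy : HasVec enc σ 5 P.U y) : ∃ c : F, c ≠ 0 ∧ (pivotC.den ω σ).reg 63 = enc c ∧
      (pivotC.den ω σ).reg 64 < P.U ∧
      (c = y ((pivotC.den ω σ).reg 64) ∨ ∀ b < P.U, y b = 0) := by
  have h14 : ((σ.set 63 1).set 64 0).reg 14 = P.U := hσ 14 (by omega)
  have H := Cmd.den_rep (ω := ω) (i := 60) (x := 14) (σ := (σ.set 63 1).set 64 0)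
    (c := .cond (cell 5 (reg 60)) (63 ≔ cell 5 (reg 60) ;; 64 ≔ reg 60) .nop)
    (fun j τ => ∃ c : F, c ≠ 0 ∧ τ.reg 63 = enc c ∧ τ.reg 64 < P.U ∧
      (c = y (τ.reg 64) ∨ ∀ b < j, y b = 0))
    ⟨1, one_ne_zero, hF.one.symm, hU, Or.inr (by simp)⟩ (by
      rintro j τ hj h60 hw ha ⟨c, hc, h63, h64, hcy⟩
      rw [h14] at hj
      have e5 : τ.arr 5 j = enc (y j) := by rw [ha 5 rfl]; exact hy j hj
      by_cases h0 : y j = 0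
      · refine ⟨c, hc, ?_⟩
        have : (Cmd.cond (cell 5 (reg 60)) (63 ≔ cell 5 (reg 60) ;; 64 ≔ reg 60) .nop).den ω τ =
            τ := by
          simp [Cmd.den, h60, e5, h0, hF.zero]
        rw [this]
        refine ⟨h63, h64, hcy.imp id fun h b hb => ?_⟩
        obtain hb | rfl : b < j ∨ b = j := by omega
        · exact h b hb
        · exact h0
      · have : (Cmd.cond (cell 5 (reg 60)) (63 ≔ cell 5 (reg 60) ;; 64 ≔ reg 60) .nop).den ω τ =
            (τ.set 63 (τ.arr 5 (τ.reg 60))).set 64 (τ.reg 60) := by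
          rw [Cmd.den, if_pos]
          · rfl
          · simp [h60, e5, hF.eq_zero_iff, h0]
        rw [this, h60, e5]
        exact ⟨y j, h0, by simp [State.set_reg], by simp [State.set_reg, hj],
          Or.inl (by simp [State.set_reg])⟩)
  rw [h14] at H
  exact H

theorem den_elimC (hF : FieldSpec P enc) (hσ : Ctx P σ) {B : ℕ → ℕ → F} {y v : ℕ → F} {c : F}
    (hB : HasMat enc σ P.U B) (hy : HasVec enc σ 5 P.U y) (hv : HasVec enc σ 7 P.U v)
    (hc : σ.reg 63 = enc c) :
    HasMat enc (elimC.den ω σ) P.U (fun b u => c * B b u - y b * v u) := by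
  have H := den_fill₂ (ω := ω) hσ (c := fma 1 (reg 63) (cell 3 (reg 60 * reg 14 + reg 62)) 0 ;;
      fma (reg 32) (cell 5 (reg 60)) (cell 7 (reg 62)) (reg 52) ;;
      .store 3 (reg 60 * reg 14 + reg 62) (reg 52)) rfl rfl
    (fun l => enc (c * B (l / P.U) (l % P.U) - y (l / P.U) * v (l % P.U))) (by
      intro b u τ hb hu h60 h62 hw ha h3 l
      have cτ : Ctx P τ := hσ.of_frame (c := .rep 60 14 (.rep 62 14
        (fma 1 (reg 63) (cell 3 (reg 60 * reg 14 + reg 62)) 0 ;;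
        fma (reg 32) (cell 5 (reg 60)) (cell 7 (reg 62)) (reg 52) ;;
        .store 3 (reg 60 * reg 14 + reg 62) (reg 52)))) rfl hw
      have h14 : τ.reg 14 = P.U := cτ 14 (by omega)
      have e63 : τ.reg 63 = enc c := (hw 63 rfl).trans hc
      have e1 := den_fma (ω := ω) (ec := 1) (ex := reg 63)
        (ey := cell 3 (reg 60 * reg 14 + reg 62)) (ea := 0) (c := 1) (x := c) (y := B b u)
        (a := (0 : F)) hF cτ e63
        (fun _ => by
          simp [State.set_reg, h14, h60, h62, h3]
          exact hB b hb u hu)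
        (fun _ _ => hF.zero.symm) (fun _ _ _ => rfl)
      set τ₁ := (fma 1 (reg 63) (cell 3 (reg 60 * reg 14 + reg 62)) 0).den ω τ with hτ₁
      have c₁ : Ctx P τ₁ := cτ.of_keeps rfl
      have fr : ∀ z, (fma 1 (reg 63) (cell 3 (reg 60 * reg 14 + reg 62)) 0).wr z = false →
        τ₁.reg z = τ.reg z := fun z hz => Cmd.den_reg _ hz τ
      have e60 : τ₁.reg 60 = b := (fr 60 rfl).trans h60
      have e62 : τ₁.reg 62 = u := (fr 62 rfl).trans h62
      have a₁ : τ₁.arr = τ.arr := funext fun z =>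
        Cmd.den_arr (fma 1 (reg 63) (cell 3 (reg 60 * reg 14 + reg 62)) 0) rfl τ
      have e2 := den_fma (ω := ω) (ec := reg 32) (ex := cell 5 (reg 60))
        (ey := cell 7 (reg 62)) (ea := reg 52) (c := P.p - 1) (x := y b) (y := v u)
        (a := 0 + ((1 : ℕ) : F) * (c * B b u)) hF c₁
        (by simp [e60, a₁, ha 5 rfl]; exact hy b hb)
        (fun _ => by simp [State.set_reg, e62, a₁, ha 7 rfl]; exact hv u hu)
        (fun _ _ => by simp [State.set_reg]; simpa using e1)
        (fun _ _ _ => by simp [State.set_reg]; exact c₁ 32 (by omega))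
      set τ₂ := (fma (reg 32) (cell 5 (reg 60)) (cell 7 (reg 62)) (reg 52)).den ω τ₁ with hτ₂
      have fr₂ : ∀ z, (fma (reg 32) (cell 5 (reg 60)) (cell 7 (reg 62)) (reg 52)).wr z = false →
        τ₂.reg z = τ₁.reg z := fun z hz => Cmd.den_reg _ hz τ₁
      have a₂ : τ₂.arr 3 = τ₁.arr 3 :=
        Cmd.den_arr (fma (reg 32) (cell 5 (reg 60)) (cell 7 (reg 62)) (reg 52)) rfl τ₁
      change (τ₂.put 3 (τ₂.reg 60 * τ₂.reg 14 + τ₂.reg 62) (τ₂.reg 52)).arr 3 l = _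
      rw [State.put_arr, fr₂ 60 rfl, fr₂ 14 rfl, fr₂ 62 rfl, e60, e62, c₁ 14 (by omega), e2, a₂, a₁]
      change (if 3 = 3 ∧ l = b * P.U + u then _ else _) = _
      simp only [true_and]
      split
      · rename_i e
        rw [e, idx_div hu, idx_mod hu, hF.neg]
        congr 1; push_cast; ring
      · rfl)
  intro b hb u hu
  have := H (b * P.U + u) (idx_lt hb hu)
  rw [idx_div hu, idx_mod hu] at this
  exact this

/-- The matrix in array `3` spans the solutions of the constraints `W`. -/
def HasKer (enc : F → ℕ) (P : Par) (σ : State) (t : ℕ) (W : Set (ℕ → F)) : Prop :=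
  ∃ B, HasMat enc σ P.U B ∧ IsKer P.U t B W

theorem HasKer.congr {t : ℕ} {W : Set (ℕ → F)} {τ : State} (h : HasKer enc P σ t W)
    (hτ : τ.arr 3 = σ.arr 3) : HasKer enc P τ t W := by
  obtain ⟨B, hB, h⟩ := h
  exact ⟨B, fun b hb u hu => by rw [hτ]; exact hB b hb u hu, h⟩

theorem hasKer_initC (hF : FieldSpec P enc) (hσ : Ctx P σ) :
    HasKer enc P (initC.den ω σ) (σ.reg 70) ∅ :=
  ⟨_, den_initC hF hσ, isKer_init⟩

/-- The constraint in array `4` is added to those already imposed. -/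
theorem hasKer_stepC (hF : FieldSpec P enc) (hσ : Ctx P σ) (hU : 0 < P.U) {t : ℕ}
    {W : Set (ℕ → F)} {w : ℕ → F} (hW : HasKer enc P σ t W) (hw : HasVec enc σ 4 P.U w) :
    HasKer enc P (stepC.den ω σ) t (insert w W) := by
  obtain ⟨B, hB, hK⟩ := hW
  have h1 := den_dotC (ω := ω) hF hσ hB hw
  set σ₁ := dotC.den ω σ with hσ₁
  have c₁ : Ctx P σ₁ := hσ.of_keeps rfl
  obtain ⟨c, hc, h63, h64, hcy⟩ := den_pivotC (ω := ω) hF c₁ hU h1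
  set σ₂ := pivotC.den ω σ₁ with hσ₂
  have c₂ : Ctx P σ₂ := c₁.of_keeps rfl
  have a3 : σ₂.arr 3 = σ.arr 3 := (Cmd.den_arr pivotC rfl σ₁).trans (Cmd.den_arr dotC rfl σ)
  have h14 : σ₂.reg 14 = P.U := c₂ 14 (by omega)
  have h3 : HasVec enc (copyC.den ω σ₂) 7 P.U (B (σ₂.reg 64)) := by
    rw [HasVec, ← h14]
    refine den_fill (fun u => enc (B (σ₂.reg 64) u)) ?_
    intro u τ hu hτ hwr ha _ l
    rw [Cmd.den, State.put_arr]
    simp only [Expr.eval_get, Expr.eval_add, Expr.eval_mul, Expr.eval_reg, hτ, hwr 64 rfl,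
      hwr 14 rfl, h14, ha 3 rfl, true_and, a3]
    rw [hB _ h64 u (by omega)]
  set σ₃ := copyC.den ω σ₂ with hσ₃
  have c₃ : Ctx P σ₃ := c₂.of_keeps rfl
  have b3 : σ₃.arr 3 = σ.arr 3 := (Cmd.den_arr copyC rfl σ₂).trans a3
  have b5 : σ₃.arr 5 = σ₁.arr 5 := (Cmd.den_arr copyC rfl σ₂).trans (Cmd.den_arr pivotC rfl σ₁)
  have b63 : σ₃.reg 63 = enc c := (Cmd.den_reg copyC rfl σ₂).trans h63
  have h4 := den_elimC (ω := ω) hF c₃ (B := B) (y := fun b => dot P.U w (B b))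
    (fun b hb u hu => by rw [b3]; exact hB b hb u hu) (fun u hu => by rw [b5]; exact h1 u hu)
    h3 b63
  exact ⟨_, h4, hK.step hc h64 hcy⟩

/-- A solution is read off, nonzero if there is one. -/
theorem den_pickC (hF : FieldSpec P enc) (hσ : Ctx P σ) (hU : 0 < P.U) {t : ℕ} (a : ℕ)
    (ha3 : a ≠ 3) {W : Set (ℕ → F)} (hW : HasKer enc P σ t W) :
    ∃ z : ℕ → F, HasVec enc ((pickC a).den ω σ) a P.U z ∧ IsSol P.U t W z ∧
      ((∃ v, IsSol P.U t W v ∧ ∃ u < P.U, v u ≠ 0) → ∃ u < P.U, z u ≠ 0) := by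
  obtain ⟨B, hB, hK⟩ := hW
  have h14 : (σ.set 74 0).reg 14 = P.U := hσ 14 (by omega)
  have H := Cmd.den_rep (ω := ω) (i := 60) (x := 14) (σ := σ.set 74 0)
    (c := .rep 62 14 (.cond (cell 3 (reg 60 * reg 14 + reg 62)) (74 ≔ reg 60) .nop))
    (fun j τ => τ.reg 74 < P.U ∧
      ((∃ u < P.U, B (τ.reg 74) u ≠ 0) ∨ ∀ b < j, ∀ u < P.U, B b u = 0))
    ⟨hU, Or.inr (by simp)⟩ (by
      rintro b τ hb h60 hw ha ⟨h74, hI⟩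
      rw [h14] at hb
      have h14' : τ.reg 14 = P.U := (hw 14 rfl).trans h14
      have H' := Cmd.den_rep (ω := ω) (i := 62) (x := 14) (σ := τ)
        (c := .cond (cell 3 (reg 60 * reg 14 + reg 62)) (74 ≔ reg 60) .nop)
        (fun j' τ' => τ'.reg 74 < P.U ∧
          ((∃ u < P.U, B (τ'.reg 74) u ≠ 0) ∨
            (∀ b' < b, ∀ u < P.U, B b' u = 0) ∧ ∀ u < j', B b u = 0))
        ⟨h74, hI.imp id fun h => ⟨h, by simp⟩⟩ (by
          rintro u τ' hu h62 hw' ha' ⟨h74', hI'⟩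
          rw [h14'] at hu
          have e60 : τ'.reg 60 = b := (hw' 60 rfl).trans h60
          have e14 : τ'.reg 14 = P.U := (hw' 14 rfl).trans h14'
          have e3 : τ'.arr 3 (τ'.reg 60 * τ'.reg 14 + τ'.reg 62) = enc (B b u) := by
            rw [e60, e14, h62, ha' 3 rfl, ha 3 rfl]; exact hB b hb u hu
          by_cases h0 : B b u = 0
          · have : (Cmd.cond (cell 3 (reg 60 * reg 14 + reg 62)) (74 ≔ reg 60) .nop).den ω τ' =
                τ' := by
              simp [Cmd.den, e3, h0, hF.zero]
            rw [this]
            refine ⟨h74', hI'.imp id fun h => ⟨h.1, fun v hv => ?_⟩⟩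
            obtain hv | rfl : v < u ∨ v = u := by omega
            · exact h.2 v hv
            · exact h0
          · have : (Cmd.cond (cell 3 (reg 60 * reg 14 + reg 62)) (74 ≔ reg 60) .nop).den ω τ' =
                τ'.set 74 (τ'.reg 60) := by
              rw [Cmd.den, if_pos]
              · rfl
              · simp only [Expr.eval_get, Expr.eval_add, Expr.eval_mul, Expr.eval_reg, e3]
                rwa [Ne, hF.eq_zero_iff]
            rw [this, e60]
            exact ⟨by simp [State.set_reg, hb], Or.inl ⟨u, hu, by simpa [State.set_reg] using h0⟩⟩)
      rw [h14'] at H'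
      refine ⟨H'.1, H'.2.imp id fun h b' hb' => ?_⟩
      obtain hb' | rfl : b' < b ∨ b' = b := by omega
      · exact h.1 b' hb'
      · exact h.2)
  rw [h14] at H
  set σ₁ := (Cmd.rep 60 14 (.rep 62 14 (.cond (cell 3 (reg 60 * reg 14 + reg 62))
    (74 ≔ reg 60) .nop))).den ω (σ.set 74 0) with hσ₁
  have a3 : σ₁.arr 3 = σ.arr 3 := Cmd.den_arr (.rep 60 14 (.rep 62 14 (.cond (cell 3
    (reg 60 * reg 14 + reg 62)) (74 ≔ reg 60) .nop))) rfl (σ.set 74 0)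
  have e14 : σ₁.reg 14 = P.U := (Cmd.den_reg (.rep 60 14 (.rep 62 14 (.cond (cell 3
    (reg 60 * reg 14 + reg 62)) (74 ≔ reg 60) .nop))) rfl (σ.set 74 0)).trans h14
  refine ⟨B (σ₁.reg 74), ?_, hK.sol _ H.1, ?_⟩
  · rw [HasVec, ← e14]
    refine den_fill (fun u => enc (B (σ₁.reg 74) u)) ?_
    intro u τ hu hτ hwr ha _ l
    have hw3 : (Cmd.store a (reg 62) (cell 3 (reg 74 * reg 14 + reg 62))).wra 3 = false := by
      simp [Cmd.wra, ha3]
    rw [Cmd.den, State.put_arr]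
    simp only [Expr.eval_get, Expr.eval_add, Expr.eval_mul, Expr.eval_reg, hτ, hwr 74 rfl,
      hwr 14 rfl, e14, ha 3 hw3, true_and, a3]
    rw [hB _ H.1 u (by omega)]
  · rintro ⟨v, hv, u, hu, hvu⟩
    obtain ⟨b, hb, u', hu', hbu⟩ := hK.exists_row_ne hv hu hvu
    rcases H.2 with h | h
    · exact h
    · exact (hbu (h b hb u' hu')).elim

end

end RAM

/-! ### The linear systems -/

namespace RAM

open Finset

/-- The relations between the parameters on which the index computations depend. -/
structure Par.Ok (P : Par) : Prop where
  hn : 0 < P.n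
  hm : 0 < P.m
  hms : P.m ≤ P.s
  hℓ : 0 < P.ℓ
  hD1 : 0 < P.D1
  hsm : P.sm = P.s + 1 - P.m
  hK : P.K = P.n * P.ℓ
  hns : P.ns = P.n * P.s
  hH : P.H = P.D1 + P.d
  hU : P.U = P.m * P.D1 + P.H
  hE : P.E = P.ns * P.U

theorem Par.Ok.mD1 {P : Par} (h : P.Ok) : P.D1 ≤ P.m * P.D1 :=
  Nat.le_mul_of_pos_left _ h.hm

theorem Par.Ok.d2 {P : Par} (h : P.Ok) : P.d + 2 ≤ P.U := by
  have := h.mD1; have := h.hD1; have := h.hU; have := h.hH; omega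

theorem Par.Ok.upos {P : Par} (h : P.Ok) : 0 < P.U := by
  have := h.d2; omega

theorem Par.Ok.pt {P : Par} (h : P.Ok) {y t : ℕ} (hy : y < P.K) (ht : t < P.s) :
    y / P.ℓ * P.s + t < P.ns := by
  rw [h.hns]
  refine idx_lt ?_ ht
  rw [Nat.div_lt_iff_lt_mul h.hℓ, ← h.hK]; exact hy

theorem Par.Ok.exp {P : Par} (h : P.Ok) {i u : ℕ} (hi : i < P.ns) (hu : u < P.U) :
    i * u ≤ P.E := by
  rw [h.hE]; exact Nat.mul_le_mul hi.le hu.le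

variable {P : Par} {ω : ℕ → Bool} {σ : State} {F : Type*} [Field F] {enc : F → ℕ}

/-- The parameters, the powers of `α` and the input words, with entries `e`, are in memory. -/
structure HasData (enc : F → ℕ) (P : Par) (α : F) (e : ℕ → F) (σ : State) : Prop where
  ctx : Ctx P σ
  pow : ∀ j ≤ P.E, σ.arr 2 j = enc (α ^ j)
  inp : ∀ j < P.K * P.s, σ.arr 0 j = enc (e j)

variable {α : F} {e : ℕ → F}

theorem HasData.congr {τ : State} (h : HasData enc P α e σ) (hr : ∀ x < 40, τ.reg x = σ.reg x)
    (h2 : τ.arr 2 = σ.arr 2) (h0 : τ.arr 0 = σ.arr 0) : HasData enc P α e τ :=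
  ⟨h.ctx.congr hr, fun j hj => by rw [h2]; exact h.pow j hj,
    fun j hj => by rw [h0]; exact h.inp j hj⟩

theorem HasData.of_frame {τ : State} {c : Cmd} (h : HasData enc P α e σ) (hk : c.keeps = true)
    (hw : ∀ y, c.wr y = false → τ.reg y = σ.reg y) (h2 : τ.arr 2 = σ.arr 2)
    (h0 : τ.arr 0 = σ.arr 0) : HasData enc P α e τ :=
  h.congr (fun y hy => hw y (Cmd.wr_eq_false_of_keeps hk hy)) h2 h0

theorem HasData.set (h : HasData enc P α e σ) {x : ℕ} (hx : 40 ≤ x) (v : ℕ) :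
    HasData enc P α e (σ.set x v) :=
  ⟨h.ctx.set hx v, h.pow, h.inp⟩

theorem HasData.den {c : Cmd} (h : HasData enc P α e σ) (hk : c.keeps = true)
    (h2 : c.wra 2 = false) (h0 : c.wra 0 = false) : HasData enc P α e (c.den ω σ) :=
  h.congr (fun _ hy => Cmd.den_reg_of_keeps hk σ hy) (Cmd.den_arr c h2 σ) (Cmd.den_arr c h0 σ)

/-- The interpolation constraint for the input word `y` and the shift `t`. -/
def interpRow (P : Par) (α : F) (e : ℕ → F) (y t u : ℕ) : F :=
  if u < P.m * P.D1 then α ^ ((y / P.ℓ * P.s + t) * (u % P.D1)) * e (y * P.s + t + u / P.D1)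
  else α ^ ((y / P.ℓ * P.s + t) * (u - P.m * P.D1))

/-- The vanishing of the coefficient `h` of `A₀ + ∑ j, A_{j+1} P(α^j X)`. The unknowns are the
coefficients of `P`, and in place `d + 1` a factor of `A₀`. -/
def identityRow (P : Par) (α : F) (Q : ℕ → F) (h c : ℕ) : F :=
  if c = P.d + 1 then Q (P.m * P.D1 + h)
  else if c ≤ P.d ∧ c ≤ h ∧ h - c < P.D1 then
    ∑ j ∈ range P.m, Q (j * P.D1 + (h - c)) * α ^ (j * c)
  else 0

/-- Agreement in entry `w` of the column with the input word `y`. -/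
def agreeRow (P : Par) (α : F) (e : ℕ → F) (y w c : ℕ) : F :=
  if c = P.d + 1 then -e (y * P.s + w) else α ^ ((y / P.ℓ * P.s + w) * c)

theorem den_interpRowC (hF : FieldSpec P enc) (hP : P.Ok) (hσ : HasData enc P α e σ) {y t : ℕ}
    (hy : y < P.K) (ht : t < P.sm) (h71 : σ.reg 71 = y) (h73 : σ.reg 73 = t) :
    HasVec enc (interpRowC.den ω σ) 4 P.U (interpRow P α e y t) := by
  have h14 : σ.reg 14 = P.U := hσ.ctx 14 (by omega)
  have hms := hP.hms
  have hm := hP.hm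
  have hts : t < P.s := by have := hP.hsm; omega
  have hpt := hP.pt hy hts
  rw [HasVec, ← h14]
  refine den_fill (fun u => enc (interpRow P α e y t u)) ?_
  intro u τ hu hτ hwr ha _ l
  rw [h14] at hu
  have dτ : HasData enc P α e τ := hσ.of_frame rfl hwr (ha 2 rfl) (ha 0 rfl)
  have e71 : τ.reg 71 = y := (hwr 71 rfl).trans h71
  have e73 : τ.reg 73 = t := (hwr 73 rfl).trans h73
  have e7 : τ.reg 7 = P.ℓ := dτ.ctx 7 (by omega)
  have e4 : τ.reg 4 = P.s := dτ.ctx 4 (by omega)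
  have e13 : τ.reg 13 = P.D1 := dτ.ctx 13 (by omega)
  have e33 : τ.reg 33 = P.m * P.D1 := dτ.ctx 33 (by omega)
  by_cases h : u < P.m * P.D1
  · have hx := den_fma (ω := ω) (ec := 1) (ex := cell 2 ((reg 71 / reg 7 * reg 4 + reg 73) *
        (reg 62 % reg 13))) (ey := cell 0 (reg 71 * reg 4 + reg 73 + reg 62 / reg 13)) (ea := 0)
      (c := 1) (x := α ^ ((y / P.ℓ * P.s + t) * (u % P.D1)))
      (y := e (y * P.s + t + u / P.D1)) (a := (0 : F)) hF dτ.ctx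
      (by
        simp only [Expr.eval_get, Expr.eval_mul, Expr.eval_add, Expr.eval_div, Expr.eval_mod,
          Expr.eval_reg, e71, e73, e7, e4, e13, hτ]
        exact dτ.pow _ (hP.exp hpt ((Nat.mod_le _ _).trans_lt hu)))
      (fun v => by
        have : (cell 0 (reg 71 * reg 4 + reg 73 + reg 62 / reg 13)).eval (τ.set 50 v) =
          (cell 0 (reg 71 * reg 4 + reg 73 + reg 62 / reg 13)).eval τ := rfl
        rw [this]
        simp only [Expr.eval_get, Expr.eval_mul, Expr.eval_add, Expr.eval_div,
          Expr.eval_reg, e71, e73, e4, e13, hτ]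
        refine dτ.inp _ ?_
        have h1 : u / P.D1 < P.m := by rw [Nat.div_lt_iff_lt_mul hP.hD1]; exact h
        have h2 : t + u / P.D1 < P.s := by have := hP.hsm; omega
        rw [add_assoc]
        exact idx_lt hy h2)
      (fun _ _ => hF.zero.symm) (fun _ _ _ => rfl)
    rw [Cmd.den, if_pos (by simp [e33, hτ]; omega)]
    set f := fma 1 (cell 2 ((reg 71 / reg 7 * reg 4 + reg 73) *
        (reg 62 % reg 13))) (cell 0 (reg 71 * reg 4 + reg 73 + reg 62 / reg 13)) 0 with hf
    have f62 : (f.den ω τ).reg 62 = u := (Cmd.den_reg f rfl τ).trans hτ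
    have f4 : (f.den ω τ).arr 4 = τ.arr 4 := Cmd.den_arr f rfl τ
    simp only [Cmd.den, State.put_arr, Expr.eval_reg, f62, f4, hx, true_and]
    congr 1
    rw [interpRow, if_pos h]; push_cast; congr 1; ring
  · rw [Cmd.den, if_neg (by simp [e33, hτ]; omega)]
    simp only [Cmd.den, State.put_arr, Expr.eval_get, Expr.eval_mul, Expr.eval_add, Expr.eval_div,
      Expr.eval_sub, Expr.eval_reg, e71, e73, e7, e4, e33, hτ, true_and]
    rw [dτ.pow _ (hP.exp hpt ((Nat.sub_le _ _).trans_lt hu)), interpRow, if_neg h]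

/-- The interpolation constraints. -/
def interpCons (P : Par) (α : F) (e : ℕ → F) : Set (ℕ → F) :=
  (fun yt : ℕ × ℕ => interpRow P α e yt.1 yt.2) '' {yt | yt.1 < P.K ∧ yt.2 < P.sm}

/-- The constraints are imposed one by one; a solution is then picked. -/
theorem den_interpC (hF : FieldSpec P enc) (hP : P.Ok) (hσ : HasData enc P α e σ) :
    ∃ Q : ℕ → F, HasVec enc (interpC.den ω σ) 8 P.U Q ∧ IsSol P.U P.U (interpCons P α e) Q ∧
      ((∃ v, IsSol P.U P.U (interpCons P α e) v ∧ ∃ u < P.U, v u ≠ 0) → ∃ u < P.U, Q u ≠ 0) := by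
  set σ₀ := initC.den ω (σ.set 70 (σ.reg 14)) with hσ₀
  have e14 : σ.reg 14 = P.U := hσ.ctx 14 (by omega)
  have d₀ : HasData enc P α e σ₀ := (hσ.set (x := 70) (by omega) (σ.reg 14)).den rfl rfl rfl
  have k₀ : HasKer enc P σ₀ P.U ∅ := by
    have := hasKer_initC (ω := ω) hF (hσ.ctx.set (x := 70) (by omega) (σ.reg 14))
    have e70 : (σ.set 70 (σ.reg 14)).reg 70 = P.U := e14
    rwa [e70] at this
  have h15 : σ₀.reg 15 = P.K := d₀.ctx 15 (by omega)
  have H := Cmd.den_rep (ω := ω) (i := 71) (x := 15)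
    (c := .rep 73 20 (interpRowC ;; stepC)) (σ := σ₀)
    (fun j τ => HasKer enc P τ P.U ((fun yt : ℕ × ℕ => interpRow P α e yt.1 yt.2) ''
      {yt | yt.1 < j ∧ yt.2 < P.sm})) (by simpa using k₀.congr (τ := σ₀.set 71 0) rfl) (by
        intro y τ hy h71 hw ha hI
        rw [h15] at hy
        have dτ : HasData enc P α e τ := d₀.of_frame
          (c := .rep 71 15 (.rep 73 20 (interpRowC ;; stepC)))
          rfl hw (ha 2 rfl) (ha 0 rfl)
        have h20 : τ.reg 20 = P.sm := dτ.ctx 20 (by omega)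
        have H' := Cmd.den_rep (ω := ω) (i := 73) (x := 20) (c := interpRowC ;; stepC) (σ := τ)
          (fun j τ => HasKer enc P τ P.U ((fun yt : ℕ × ℕ => interpRow P α e yt.1 yt.2) ''
            {yt | yt.1 < y ∧ yt.2 < P.sm ∨ yt.1 = y ∧ yt.2 < j}))
          (by
            have : {yt : ℕ × ℕ | yt.1 < y ∧ yt.2 < P.sm ∨ yt.1 = y ∧ yt.2 < 0} =
              {yt | yt.1 < y ∧ yt.2 < P.sm} := by ext; simp
            rw [this]; exact hI) (by
            intro t τ' ht h73 hw' ha' hI'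
            rw [h20] at ht
            have dτ' : HasData enc P α e τ' := dτ.of_frame (c := .rep 73 20 (interpRowC ;; stepC))
              rfl hw' (ha' 2 rfl) (ha' 0 rfl)
            have h71' : τ'.reg 71 = y := (hw' 71 rfl).trans h71
            have r := den_interpRowC (ω := ω) hF hP dτ' hy ht h71' h73
            have K := hasKer_stepC (ω := ω) hF
              (dτ'.ctx.of_keeps (ω := ω) (c := interpRowC) rfl) hP.upos
              (hI'.congr (Cmd.den_arr interpRowC rfl τ')) r
            have : {yt : ℕ × ℕ | yt.1 < y ∧ yt.2 < P.sm ∨ yt.1 = y ∧ yt.2 < t + 1} =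
              insert (y, t) {yt | yt.1 < y ∧ yt.2 < P.sm ∨ yt.1 = y ∧ yt.2 < t} := by
              ext ⟨a, b⟩; simp; omega
            rw [this, Set.image_insert_eq]
            exact K.congr rfl)
        rw [h20] at H'
        have : {yt : ℕ × ℕ | yt.1 < y ∧ yt.2 < P.sm ∨ yt.1 = y ∧ yt.2 < P.sm} =
          {yt | yt.1 < y + 1 ∧ yt.2 < P.sm} := by
          ext ⟨a, b⟩; simp; omega
        rw [this] at H'
        exact H'.congr rfl)
  rw [h15] at H
  have d₁ : HasData enc P α e ((Cmd.rep 71 15 (.rep 73 20 (interpRowC ;; stepC))).den ω σ₀) :=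
    d₀.den rfl rfl rfl
  exact den_pickC hF d₁.ctx hP.upos 8 (by omega) H

theorem den_identityRowC (hF : FieldSpec P enc) (hP : P.Ok) (hσ : HasData enc P α e σ) {Q : ℕ → F}
    (hQ : HasVec enc σ 8 P.U Q) {h : ℕ} (hh : h < P.H) (h71 : σ.reg 71 = h) :
    HasVec enc (identityRowC.den ω σ) 4 P.U (identityRow P α Q h) := by
  have h14 : σ.reg 14 = P.U := hσ.ctx 14 (by omega)
  have hUH := hP.hU
  have key := den_fill (ω := ω) (σ := σ) (i := 62) (x := 14) (a := 4)
    (c := 76 ≔ 0 ;;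
      .cond (reg 62 - reg 5 + (reg 62 - reg 71) + notLt (reg 71) (reg 62 + reg 13)) .nop
        (.rep 78 12
          (fma 1 (cell 8 (reg 78 * reg 13 + (reg 71 - reg 62))) (cell 2 (reg 78 * reg 62))
              (reg 76) ;;
            76 ≔ reg 52)) ;;
      .store 4 (reg 62) (reg 76))
    (fun c => enc (if c ≤ P.d ∧ c ≤ h ∧ h - c < P.D1 then
      ∑ j ∈ range P.m, Q (j * P.D1 + (h - c)) * α ^ (j * c) else 0)) (by
    intro c τ hc hτ hwr ha _ l
    rw [h14] at hc
    have dτ : HasData enc P α e τ := hσ.of_frame rfl hwr (ha 2 rfl) (ha 0 rfl)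
    have e71 : τ.reg 71 = h := (hwr 71 rfl).trans h71
    have e5 : τ.reg 5 = P.d := dτ.ctx 5 (by omega)
    have e12 : τ.reg 12 = P.m := dτ.ctx 12 (by omega)
    have e13 : τ.reg 13 = P.D1 := dτ.ctx 13 (by omega)
    set L : Cmd := .rep 78 12
          (fma 1 (cell 8 (reg 78 * reg 13 + (reg 71 - reg 62))) (cell 2 (reg 78 * reg 62))
              (reg 76) ;; 76 ≔ reg 52) with hL
    set C : Cmd := .cond (reg 62 - reg 5 + (reg 62 - reg 71) + notLt (reg 71) (reg 62 + reg 13))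
      .nop L with hC
    have r76 : (C.den ω (τ.set 76 0)).reg 76 = enc (if c ≤ P.d ∧ c ≤ h ∧ h - c < P.D1 then
        ∑ j ∈ range P.m, Q (j * P.D1 + (h - c)) * α ^ (j * c) else 0) := by
      have ev : (reg 62 - reg 5 + (reg 62 - reg 71) + notLt (reg 71) (reg 62 + reg 13)).eval
          (τ.set 76 0) = c - P.d + (c - h) + (h + 1 - (c + P.D1)) := by
        rw [← hτ, ← e71, ← e5, ← e13]; rfl
      rw [hC, Cmd.den, ev]
      by_cases hcond : c ≤ P.d ∧ c ≤ h ∧ h - c < P.D1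
      · rw [if_neg (by omega), if_pos hcond]
        have := den_sum (ω := ω) hF (dτ.ctx.set (x := 76) (by omega) 0) (i := 78) (x := 12)
          (acc := 76) (ex := cell 8 (reg 78 * reg 13 + (reg 71 - reg 62)))
          (ey := cell 2 (reg 78 * reg 62)) (by omega) (by omega) (by omega) (a := (0 : F))
          hF.zero.symm (fun j => Q (j * P.D1 + (h - c))) (fun j => α ^ (j * c)) (by
            intro j τ' hj hτ' hwr' ha'
            have hj' : j < P.m := by rw [← e12]; exact hj
            have f13 : τ'.reg 13 = P.D1 := (hwr' 13 rfl).trans e13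
            have f71 : τ'.reg 71 = h := (hwr' 71 rfl).trans e71
            have f62 : τ'.reg 62 = c := (hwr' 62 rfl).trans hτ
            refine ⟨?_, fun v => ?_⟩
            · simp only [Expr.eval_get, Expr.eval_add, Expr.eval_sub, Expr.eval_mul, Expr.eval_reg,
                ha', State.set_arr, hτ', f13, f71, f62, ha 8 rfl]
              refine hQ _ ?_
              have := idx_lt hj' hcond.2.2
              omega
            · have : (cell 2 (reg 78 * reg 62)).eval (τ'.set 50 v) =
                (cell 2 (reg 78 * reg 62)).eval τ' := rfl
              rw [this]
              simp only [Expr.eval_get, Expr.eval_mul, Expr.eval_reg, ha', State.set_arr, hτ', f62]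
              refine dτ.pow _ (hP.exp ?_ hc)
              have h1 := hP.hms
              have h3 := Nat.le_mul_of_pos_left P.s hP.hn
              rw [hP.hns]; omega)
        have e12' : (τ.set 76 0).reg 12 = P.m := e12
        rw [e12', zero_add] at this
        exact this
      · rw [if_pos (by omega), if_neg hcond]
        exact hF.zero.symm
    have C62 : (C.den ω (τ.set 76 0)).reg 62 = c := (Cmd.den_reg C rfl (τ.set 76 0)).trans hτ
    have C4 : (C.den ω (τ.set 76 0)).arr 4 = τ.arr 4 := Cmd.den_arr C rfl (τ.set 76 0)
    change ((C.den ω (τ.set 76 0)).put 4 ((C.den ω (τ.set 76 0)).reg 62)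
      ((C.den ω (τ.set 76 0)).reg 76)).arr 4 l = _
    rw [State.put_arr, C62, r76, C4]
    simp only [true_and])
  rw [h14] at key
  intro c hc
  set L : Cmd := .rep 62 14 (76 ≔ 0 ;;
      .cond (reg 62 - reg 5 + (reg 62 - reg 71) + notLt (reg 71) (reg 62 + reg 13)) .nop
        (.rep 78 12
          (fma 1 (cell 8 (reg 78 * reg 13 + (reg 71 - reg 62))) (cell 2 (reg 78 * reg 62))
              (reg 76) ;;
            76 ≔ reg 52)) ;;
      .store 4 (reg 62) (reg 76)) with hL
  have L24 : (L.den ω σ).reg 24 = P.d + 1 := (Cmd.den_reg L rfl σ).trans (hσ.ctx 24 (by omega))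
  have L33 : (L.den ω σ).reg 33 = P.m * P.D1 :=
    (Cmd.den_reg L rfl σ).trans (hσ.ctx 33 (by omega))
  have L71 : (L.den ω σ).reg 71 = h := (Cmd.den_reg L rfl σ).trans h71
  have L8 : (L.den ω σ).arr 8 = σ.arr 8 := Cmd.den_arr L rfl σ
  change ((L.den ω σ).put 4 ((L.den ω σ).reg 24)
    ((L.den ω σ).arr 8 ((L.den ω σ).reg 33 + (L.den ω σ).reg 71))).arr 4 c = _
  rw [State.put_arr, L24, L33, L71, L8, identityRow]
  simp only [true_and]
  split
  · exact hQ _ (by omega)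
  · exact key c hc

theorem den_agreeRowC (hF : FieldSpec P enc) (hP : P.Ok) (hσ : HasData enc P α e σ) {y w : ℕ}
    (hy : y < P.K) (hw : w < P.s) (h75 : σ.reg 75 = y) (h73 : σ.reg 73 = w) :
    HasVec enc (agreeRowC.den ω σ) 4 P.U (agreeRow P α e y w) := by
  have h14 : σ.reg 14 = P.U := hσ.ctx 14 (by omega)
  have hpt := hP.pt hy hw
  have key := den_fill (ω := ω) (σ := σ) (i := 62) (x := 14) (a := 4)
    (c := .store 4 (reg 62) (cell 2 ((reg 75 / reg 7 * reg 4 + reg 73) * reg 62)))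
    (fun c => enc (α ^ ((y / P.ℓ * P.s + w) * c))) (by
      intro c τ hc hτ hwr ha _ l
      rw [h14] at hc
      have dτ : HasData enc P α e τ := hσ.of_frame rfl hwr (ha 2 rfl) (ha 0 rfl)
      have e75 : τ.reg 75 = y := (hwr 75 rfl).trans h75
      have e73 : τ.reg 73 = w := (hwr 73 rfl).trans h73
      have e7 : τ.reg 7 = P.ℓ := dτ.ctx 7 (by omega)
      have e4 : τ.reg 4 = P.s := dτ.ctx 4 (by omega)
      simp only [Cmd.den, State.put_arr, Expr.eval_get, Expr.eval_mul, Expr.eval_add,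
        Expr.eval_div, Expr.eval_reg, e75, e73, e7, e4, hτ, true_and]
      rw [dτ.pow _ (hP.exp hpt hc)])
  rw [h14] at key
  set L : Cmd := .rep 62 14 (.store 4 (reg 62)
    (cell 2 ((reg 75 / reg 7 * reg 4 + reg 73) * reg 62))) with hL
  set τ := L.den ω σ with hτ
  have dτ : HasData enc P α e τ := hσ.den rfl rfl rfl
  have e75 : τ.reg 75 = y := (Cmd.den_reg L rfl σ).trans h75
  have e73 : τ.reg 73 = w := (Cmd.den_reg L rfl σ).trans h73
  have e4 : τ.reg 4 = P.s := dτ.ctx 4 (by omega)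
  have hx := den_fma (ω := ω) (ec := reg 32) (ex := 1) (ey := cell 0 (reg 75 * reg 4 + reg 73))
    (ea := 0) (c := P.p - 1) (x := (1 : F)) (y := e (y * P.s + w)) (a := (0 : F)) hF dτ.ctx
    hF.one.symm
    (fun v => by
      have : (cell 0 (reg 75 * reg 4 + reg 73)).eval (τ.set 50 v) =
        (cell 0 (reg 75 * reg 4 + reg 73)).eval τ := rfl
      rw [this]
      simp only [Expr.eval_get, Expr.eval_mul, Expr.eval_add, Expr.eval_reg, e75, e73, e4]
      exact dτ.inp _ (idx_lt hy hw))
    (fun _ _ => hF.zero.symm) (fun _ _ _ => dτ.ctx 32 (by omega))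
  set f := fma (reg 32) 1 (cell 0 (reg 75 * reg 4 + reg 73)) 0 with hf
  have f24 : (f.den ω τ).reg 24 = P.d + 1 := (Cmd.den_reg f rfl τ).trans (dτ.ctx 24 (by omega))
  have f4 : (f.den ω τ).arr 4 = τ.arr 4 := Cmd.den_arr f rfl τ
  intro c hc
  change ((f.den ω τ).put 4 ((f.den ω τ).reg 24) ((f.den ω τ).reg 52)).arr 4 c = _
  rw [State.put_arr, f24, f4, hx, agreeRow, hF.neg]
  simp only [true_and]
  split
  · congr 1; ring
  · exact key c hc

/-- The constraints of the trial for the `m` input words that are the base `K` digits of `x`. -/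
def trialCons (P : Par) (α : F) (e : ℕ → F) (Q : ℕ → F) (x : ℕ) : Set (ℕ → F) :=
  identityRow P α Q '' {h | h < P.H} ∪
    (fun iw : ℕ × ℕ => agreeRow P α e (x / P.K ^ iw.1 % P.K) iw.2) '' {iw | iw.1 < P.m ∧ iw.2 < P.s}

/-- The constraints of a trial are imposed one by one; a solution is then picked. The digits used by
the trial are removed from register `90`. -/
theorem den_systemC (hF : FieldSpec P enc) (hP : P.Ok) (hσ : HasData enc P α e σ) {Q : ℕ → F}
    (hQ : HasVec enc σ 8 P.U Q) :
    (systemC.den ω σ).reg 90 = σ.reg 90 / P.K ^ P.m ∧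
    ∃ z : ℕ → F, HasVec enc (systemC.den ω σ) 9 P.U z ∧
      IsSol P.U (P.d + 2) (trialCons P α e Q (σ.reg 90)) z ∧
      ((∃ v, IsSol P.U (P.d + 2) (trialCons P α e Q (σ.reg 90)) v ∧ ∃ u < P.U, v u ≠ 0) →
        ∃ u < P.U, z u ≠ 0) := by
  have hKpos : 0 < P.K := by rw [hP.hK]; exact Nat.mul_pos hP.hn hP.hℓ
  set x := σ.reg 90 with hx
  set σ₀ := initC.den ω (σ.set 70 (σ.reg 34)) with hσ₀
  have e34 : σ.reg 34 = P.d + 2 := hσ.ctx 34 (by omega)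
  have d₀ : HasData enc P α e σ₀ := (hσ.set (x := 70) (by omega) (σ.reg 34)).den rfl rfl rfl
  have k₀ : HasKer enc P σ₀ (P.d + 2) ∅ := by
    have := hasKer_initC (ω := ω) hF (hσ.ctx.set (x := 70) (by omega) (σ.reg 34))
    have e70 : (σ.set 70 (σ.reg 34)).reg 70 = P.d + 2 := e34
    rwa [e70] at this
  have q₀ : σ₀.arr 8 = σ.arr 8 := Cmd.den_arr initC rfl (σ.set 70 (σ.reg 34))
  have x₀ : σ₀.reg 90 = x := Cmd.den_reg initC rfl (σ.set 70 (σ.reg 34))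
  have h21 : σ₀.reg 21 = P.H := d₀.ctx 21 (by omega)
  have H₁ := Cmd.den_rep (ω := ω) (i := 71) (x := 21) (c := identityRowC ;; stepC) (σ := σ₀)
    (fun j τ => HasKer enc P τ (P.d + 2) (identityRow P α Q '' {h | h < j}))
    (by simpa using k₀.congr (τ := σ₀.set 71 0) rfl) (by
      intro h τ hh h71 hw ha hI
      rw [h21] at hh
      have dτ : HasData enc P α e τ := d₀.of_frame (c := .rep 71 21 (identityRowC ;; stepC))
        rfl hw (ha 2 rfl) (ha 0 rfl)
      have r := den_identityRowC (ω := ω) hF hP dτ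
        (Q := Q) (fun u hu => by rw [ha 8 rfl, q₀]; exact hQ u hu) hh h71
      have K := hasKer_stepC (ω := ω) hF (dτ.ctx.of_keeps (ω := ω) (c := identityRowC) rfl) hP.upos
        (hI.congr (Cmd.den_arr identityRowC rfl τ)) r
      have : {l : ℕ | l < h + 1} = insert h {l | l < h} := by ext; simp; omega
      rw [this, Set.image_insert_eq]
      exact K.congr rfl)
  rw [h21] at H₁
  set σ₁ := (Cmd.rep 71 21 (identityRowC ;; stepC)).den ω σ₀ with hσ₁
  have d₁ : HasData enc P α e σ₁ := d₀.den rfl rfl rfl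
  have x₁ : σ₁.reg 90 = x := (Cmd.den_reg (.rep 71 21 (identityRowC ;; stepC)) rfl σ₀).trans x₀
  have h12 : σ₁.reg 12 = P.m := d₁.ctx 12 (by omega)
  set A := identityRow P α Q '' {h | h < P.H} with hA
  set f := fun iw : ℕ × ℕ => agreeRow P α e (x / P.K ^ iw.1 % P.K) iw.2 with hf
  set body : Cmd := 75 ≔ reg 90 % reg 15 ;; 90 ≔ reg 90 / reg 15 ;; .rep 73 4 (agreeRowC ;; stepC)
    with hbody
  have H₂ := Cmd.den_rep (ω := ω) (i := 72) (x := 12) (c := body) (σ := σ₁)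
    (fun j τ => τ.reg 90 = x / P.K ^ j ∧
      HasKer enc P τ (P.d + 2) (A ∪ f '' {iw | iw.1 < j ∧ iw.2 < P.s}))
    (by
      refine ⟨?_, ?_⟩
      · simp [State.set_reg, x₁]
      · simpa using H₁.congr (τ := σ₁.set 72 0) rfl) (by
      rintro i τ hi h72 hw ha ⟨h90, hI⟩
      rw [h12] at hi
      have dτ : HasData enc P α e τ := d₁.of_frame (c := .rep 72 12 body)
        rfl hw (ha 2 rfl) (ha 0 rfl)
      have h15 : τ.reg 15 = P.K := dτ.ctx 15 (by omega)
      set τ₁ := (τ.set 75 (x / P.K ^ i % P.K)).set 90 (x / P.K ^ (i + 1)) with hτ₁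
      have e₁ : body.den ω τ = (Cmd.rep 73 4 (agreeRowC ;; stepC)).den ω τ₁ := by
        simp only [hbody, Cmd.den, Expr.eval_mod, Expr.eval_div, Expr.eval_reg, State.set_reg,
          if_neg (show (90 : ℕ) ≠ 75 by omega), if_neg (show (15 : ℕ) ≠ 75 by omega), h90, h15,
          Nat.div_div_eq_div_mul, ← pow_succ]
        rfl
      have dτ₁ : HasData enc P α e τ₁ := (dτ.set (by omega) _).set (by omega) _
      have h4 : τ₁.reg 4 = P.s := dτ₁.ctx 4 (by omega)
      have H' := Cmd.den_rep (ω := ω) (i := 73) (x := 4) (c := agreeRowC ;; stepC) (σ := τ₁)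
        (fun j τ => HasKer enc P τ (P.d + 2)
          (A ∪ f '' {iw | iw.1 < i ∧ iw.2 < P.s ∨ iw.1 = i ∧ iw.2 < j}))
        (by
          have : {iw : ℕ × ℕ | iw.1 < i ∧ iw.2 < P.s ∨ iw.1 = i ∧ iw.2 < 0} =
            {iw | iw.1 < i ∧ iw.2 < P.s} := by ext; simp
          rw [this]; exact hI.congr rfl) (by
          intro w τ' hw₁ h73 hw' ha' hI'
          rw [h4] at hw₁
          have dτ' : HasData enc P α e τ' := dτ₁.of_frame (c := .rep 73 4 (agreeRowC ;; stepC))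
            rfl hw' (ha' 2 rfl) (ha' 0 rfl)
          have h75' : τ'.reg 75 = x / P.K ^ i % P.K := hw' 75 rfl
          have r := den_agreeRowC (ω := ω) hF hP dτ' (Nat.mod_lt _ hKpos) hw₁ h75' h73
          have K := hasKer_stepC (ω := ω) hF
            (dτ'.ctx.of_keeps (ω := ω) (c := agreeRowC) rfl) hP.upos
            (hI'.congr (Cmd.den_arr agreeRowC rfl τ')) r
          have : {iw : ℕ × ℕ | iw.1 < i ∧ iw.2 < P.s ∨ iw.1 = i ∧ iw.2 < w + 1} =
            insert (i, w) {iw | iw.1 < i ∧ iw.2 < P.s ∨ iw.1 = i ∧ iw.2 < w} := by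
            ext ⟨a, b⟩; simp; omega
          rw [this, Set.image_insert_eq, Set.union_insert]
          exact K.congr rfl)
      rw [h4] at H'
      have : {iw : ℕ × ℕ | iw.1 < i ∧ iw.2 < P.s ∨ iw.1 = i ∧ iw.2 < P.s} =
        {iw | iw.1 < i + 1 ∧ iw.2 < P.s} := by
        ext ⟨a, b⟩; simp; omega
      rw [this] at H'
      rw [e₁]
      exact ⟨Cmd.den_reg (.rep 73 4 (agreeRowC ;; stepC)) rfl τ₁, H'.congr rfl⟩)
  rw [h12] at H₂
  set σ₂ := (Cmd.rep 72 12 body).den ω σ₁ with hσ₂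
  have d₂ : HasData enc P α e σ₂ := d₁.den rfl rfl rfl
  exact ⟨(Cmd.den_reg (pickC 9) rfl σ₂).trans H₂.1,
    den_pickC hF d₂.ctx hP.upos 9 (by omega) H₂.2⟩

end RAM

/-! ### Words, trials and the output list -/

namespace RAM

open Finset

variable {P : Par} {ω : ℕ → Bool} {σ : State} {F : Type*} [Field F] {enc : F → ℕ}
  {α : F} {e : ℕ → F}

/-- The word computed from a solution `z` of the constraints of a trial, whose factor `z_{d+1}` is
inverted by raising it to the power `q - 2`. -/
def wordVal (P : Par) (α : F) (z : ℕ → F) (l : ℕ) : F :=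
  ∑ c ∈ range (P.d + 1), z (P.d + 1) ^ (P.q - 2) * z c * α ^ (l * c)

theorem den_powC (hF : FieldSpec P enc) (hσ : Ctx P σ) (hα : P.α = enc α) :
    ∀ j ≤ P.E, (powC.den ω σ).arr 2 j = enc (α ^ j) := by
  have h16 : (σ.put 2 0 1).reg 16 = P.E := hσ 16 (by omega)
  have H := Cmd.den_rep (ω := ω) (i := 60) (x := 16) (σ := σ.put 2 0 1)
    (c := fma 1 (cell 2 (reg 60)) (reg 3) 0 ;; .store 2 (reg 60 + 1) (reg 52))
    (fun j τ => ∀ l ≤ j, τ.arr 2 l = enc (α ^ l))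
    (by simp [State.put_arr, hF.one]) (by
      intro j τ hj h60 hw ha hI l hl
      have cτ : Ctx P τ := hσ.of_frame (c := .rep 60 16
        (fma 1 (cell 2 (reg 60)) (reg 3) 0 ;; .store 2 (reg 60 + 1) (reg 52))) rfl hw
      have hx := den_fma (ω := ω) (ec := 1) (ex := cell 2 (reg 60)) (ey := reg 3) (ea := 0) (c := 1)
        (x := α ^ j) (y := α) (a := (0 : F)) hF cτ
        (by simp only [Expr.eval_get, Expr.eval_reg, h60]; exact hI j le_rfl)
        (fun v => (cτ 3 (by omega)).trans hα) (fun _ _ => hF.zero.symm) (fun _ _ _ => rfl)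
      set f := fma 1 (cell 2 (reg 60)) (reg 3) 0 with hf
      have f60 : (f.den ω τ).reg 60 = j := (Cmd.den_reg f rfl τ).trans h60
      have f2 : (f.den ω τ).arr 2 = τ.arr 2 := Cmd.den_arr f rfl τ
      change ((f.den ω τ).put 2 ((f.den ω τ).reg 60 + 1) ((f.den ω τ).reg 52)).arr 2 l = _
      rw [State.put_arr, f60, f2, hx]
      simp only [true_and]
      split
      · rename_i hl'
        rw [hl']; congr 1; push_cast; ring
      · exact hI l (by omega))
  rw [h16] at H
  exact H

theorem den_invC (hF : FieldSpec P enc) (hσ : Ctx P σ) (hlg : P.q - 2 < 2 ^ P.lg) {t : F}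
    (ht : σ.arr 9 (P.d + 1) = enc t) : (invC.den ω σ).reg 77 = enc (t ^ (P.q - 2)) := by
  set σ₀ := ((σ.set 77 1).set 78 (σ.arr 9 (σ.reg 24))).set 79 (σ.reg 31) with hσ₀
  have h17 : σ₀.reg 17 = P.lg := hσ 17 (by omega)
  set sq : Cmd := fma 1 (reg 78) (reg 78) 0 ;; 78 ≔ reg 52 ;; 79 ≔ reg 79 / 2 with hsq
  set ml : Cmd := .cond (reg 79 % 2) (fma 1 (reg 77) (reg 78) 0 ;; 77 ≔ reg 52) .nop with hml
  -- Fast exponentiation: the product `77 * 78 ^ 79` keeps the value `t ^ (q - 2)`; the exponents of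
  -- `t` in registers `77` and `78` are `A` and `2 ^ j`.
  have H := Cmd.den_rep (ω := ω) (i := 80) (x := 17) (σ := σ₀) (c := ml ;; sq)
    (fun j τ => ∃ A, τ.reg 77 = enc (t ^ A) ∧ τ.reg 78 = enc (t ^ 2 ^ j) ∧
      τ.reg 79 = (P.q - 2) / 2 ^ j ∧ A + 2 ^ j * ((P.q - 2) / 2 ^ j) = P.q - 2)
    (by
      refine ⟨0, ?_, ?_, ?_, by simp⟩
      · rw [pow_zero, hF.one]; rfl
      · change σ.arr 9 (σ.reg 24) = _
        rw [hσ 24 (by omega), pow_zero, pow_one]; exact ht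
      · rw [pow_zero, Nat.div_one]; exact hσ 31 (by omega)) (by
      rintro j τ hj - hw - ⟨A, h77, h78, h79, hA⟩
      have c₀ : Ctx P σ₀ := ((hσ.set (by omega) _).set (by omega) _).set (by omega) _
      have cτ : Ctx P τ := c₀.of_frame (c := .rep 80 17 (ml ;; sq)) rfl hw
      set τ₁ := ml.den ω τ with hτ₁
      have c₁ : Ctx P τ₁ := cτ.of_keeps rfl
      have e78 : τ₁.reg 78 = τ.reg 78 := Cmd.den_reg ml rfl τ
      have e79 : τ₁.reg 79 = τ.reg 79 := Cmd.den_reg ml rfl τ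
      have hx := den_fma (ω := ω) (ec := 1) (ex := reg 78) (ey := reg 78) (ea := 0) (c := 1)
        (x := t ^ 2 ^ j) (y := t ^ 2 ^ j) (a := (0 : F)) hF c₁ (e78.trans h78)
        (fun v => e78.trans h78) (fun _ _ => hF.zero.symm) (fun _ _ _ => rfl)
      set f := fma 1 (reg 78) (reg 78) 0 with hf
      have f77 : (f.den ω τ₁).reg 77 = τ₁.reg 77 := Cmd.den_reg f rfl τ₁
      have f79 : (f.den ω τ₁).reg 79 = τ₁.reg 79 := Cmd.den_reg f rfl τ₁
      have hdiv : (P.q - 2) / 2 ^ (j + 1) = (P.q - 2) / 2 ^ j / 2 := by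
        rw [pow_succ, Nat.div_div_eq_div_mul]
      set B := (P.q - 2) / 2 ^ j with hB
      have hmod := Nat.div_add_mod B 2
      have res : ∀ A', τ₁.reg 77 = enc (t ^ A') → A' = A + 2 ^ j * (B % 2) →
          ∃ A, (((ml ;; sq).den ω τ).set 80 (j + 1)).reg 77 = enc (t ^ A) ∧
            (((ml ;; sq).den ω τ).set 80 (j + 1)).reg 78 = enc (t ^ 2 ^ (j + 1)) ∧
            (((ml ;; sq).den ω τ).set 80 (j + 1)).reg 79 = (P.q - 2) / 2 ^ (j + 1) ∧
            A + 2 ^ (j + 1) * ((P.q - 2) / 2 ^ (j + 1)) = P.q - 2 := by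
        intro A' h1 h2
        refine ⟨A', f77.trans h1, ?_, ?_, ?_⟩
        · change (f.den ω τ₁).reg 52 = _
          rw [hx]; congr 1; push_cast; ring
        · change (f.den ω τ₁).reg 79 / 2 = _
          rw [f79, e79, h79, hdiv]
        · rw [h2, hdiv, pow_succ, ← hA]
          conv_rhs => rw [← hmod]
          ring
      by_cases hpar : B % 2 = 0
      · have e₁ : τ₁ = τ := by
          rw [hτ₁, hml, Cmd.den, if_neg]
          · rfl
          · simp [h79, hpar]
        exact res A (e₁ ▸ h77) (by rw [hpar]; ring)
      · have hy := den_fma (ω := ω) (ec := 1) (ex := reg 77) (ey := reg 78) (ea := 0) (c := 1)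
          (x := t ^ A) (y := t ^ 2 ^ j) (a := (0 : F)) hF cτ h77
          (fun v => h78) (fun _ _ => hF.zero.symm) (fun _ _ _ => rfl)
        refine res (A + 2 ^ j) ?_ (by rw [show B % 2 = 1 by omega]; ring)
        rw [hτ₁, hml, Cmd.den, if_pos (by simp [h79]; omega)]
        change ((fma 1 (reg 77) (reg 78) 0).den ω τ).reg 52 = _
        rw [hy]; congr 1; push_cast; ring)
  rw [h17] at H
  obtain ⟨A, h77, -, -, hA⟩ := H
  rw [Nat.div_eq_of_lt hlg, mul_zero, add_zero] at hA
  rw [← hA]; exact h77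

theorem den_wordC (hF : FieldSpec P enc) (hP : P.Ok) (hσ : HasData enc P α e σ)
    (hlg : P.q - 2 < 2 ^ P.lg) {z : ℕ → F} (hz : HasVec enc σ 9 P.U z) :
    HasVec enc (wordC.den ω σ) 6 P.ns (wordVal P α z) := by
  have hd2 := hP.d2
  set σ₁ := invC.den ω σ with hσ₁
  have h77 : σ₁.reg 77 = enc (z (P.d + 1) ^ (P.q - 2)) :=
    den_invC hF hσ.ctx hlg (hz _ (by omega))
  have d₁ : HasData enc P α e σ₁ := hσ.den rfl rfl rfl
  have z₁ : σ₁.arr 9 = σ.arr 9 := Cmd.den_arr invC rfl σ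
  have h24 : σ₁.reg 24 = P.d + 1 := d₁.ctx 24 (by omega)
  have H₁ := den_fill (ω := ω) (σ := σ₁) (i := 62) (x := 24) (a := 10)
    (c := fma 1 (reg 77) (cell 9 (reg 62)) 0 ;; .store 10 (reg 62) (reg 52))
    (fun c => enc (z (P.d + 1) ^ (P.q - 2) * z c)) (by
      intro c τ hc h62 hw ha _ l
      rw [h24] at hc
      have cτ : Ctx P τ := d₁.ctx.of_frame (c := .rep 62 24
        (fma 1 (reg 77) (cell 9 (reg 62)) 0 ;; .store 10 (reg 62) (reg 52))) rfl hw
      have hx := den_fma (ω := ω) (ec := 1) (ex := reg 77) (ey := cell 9 (reg 62)) (ea := 0)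
        (c := 1) (x := z (P.d + 1) ^ (P.q - 2)) (y := z c) (a := (0 : F)) hF cτ
        ((hw 77 rfl).trans h77)
        (fun v => by
          have : (cell 9 (reg 62)).eval (τ.set 50 v) = τ.arr 9 (τ.reg 62) := rfl
          rw [this, h62, ha 9 rfl, z₁]
          exact hz c (by omega)) (fun _ _ => hF.zero.symm) (fun _ _ _ => rfl)
      set f := fma 1 (reg 77) (cell 9 (reg 62)) 0 with hf
      have f62 : (f.den ω τ).reg 62 = c := (Cmd.den_reg f rfl τ).trans h62
      have f10 : (f.den ω τ).arr 10 = τ.arr 10 := Cmd.den_arr f rfl τ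
      change ((f.den ω τ).put 10 ((f.den ω τ).reg 62) ((f.den ω τ).reg 52)).arr 10 l = _
      rw [State.put_arr, f62, f10, hx]
      simp only [true_and]
      congr 2; push_cast; ring)
  rw [h24] at H₁
  set σ₂ := (Cmd.rep 62 24 (fma 1 (reg 77) (cell 9 (reg 62)) 0 ;;
    .store 10 (reg 62) (reg 52))).den ω σ₁ with hσ₂
  have d₂ : HasData enc P α e σ₂ := d₁.den rfl rfl rfl
  have h22 : σ₂.reg 22 = P.ns := d₂.ctx 22 (by omega)
  rw [HasVec, ← h22]
  refine den_fill (fun l => enc (wordVal P α z l)) ?_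
  rw [h22]
  intro l τ hl h60 hw ha _ l'
  set L : Cmd := .rep 62 24 (fma 1 (cell 10 (reg 62)) (cell 2 (reg 60 * reg 62)) (reg 61) ;;
    61 ≔ reg 52) with hL
  have dτ : HasData enc P α e τ := d₂.of_frame (c := .rep 60 22
    (61 ≔ 0 ;; L ;; .store 6 (reg 60) (reg 61))) rfl hw (ha 2 rfl) (ha 0 rfl)
  have h24' : (τ.set 61 0).reg 24 = P.d + 1 := dτ.ctx 24 (by omega)
  have hs := den_sum (ω := ω) hF (dτ.ctx.set (x := 61) (by omega) 0) (i := 62) (x := 24)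
    (acc := 61) (ex := cell 10 (reg 62)) (ey := cell 2 (reg 60 * reg 62)) (by omega) (by omega)
    (by omega) (a := (0 : F)) hF.zero.symm (fun c => z (P.d + 1) ^ (P.q - 2) * z c)
    (fun c => α ^ (l * c)) (by
      intro c τ' hc h62 hw' ha'
      rw [h24'] at hc
      have e60 : τ'.reg 60 = l := (hw' 60 rfl).trans h60
      refine ⟨?_, fun v => ?_⟩
      · simp only [Expr.eval_get, Expr.eval_reg, h62, ha', State.set_arr, ha 10 rfl]
        exact H₁ c hc
      · have : (cell 2 (reg 60 * reg 62)).eval (τ'.set 50 v) =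
          τ'.arr 2 (τ'.reg 60 * τ'.reg 62) := rfl
        rw [this, h62, e60, ha']
        exact dτ.pow _ (hP.exp hl (by omega)))
  rw [h24', zero_add] at hs
  have e60 : (L.den ω (τ.set 61 0)).reg 60 = l := (Cmd.den_reg L rfl (τ.set 61 0)).trans h60
  have e6 : (L.den ω (τ.set 61 0)).arr 6 = τ.arr 6 := Cmd.den_arr L rfl (τ.set 61 0)
  change ((L.den ω (τ.set 61 0)).put 6 ((L.den ω (τ.set 61 0)).reg 60)
    ((L.den ω (τ.set 61 0)).reg 61)).arr 6 l' = _
  rw [State.put_arr, e60, e6, hs]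
  simp only [true_and, wordVal]

/-- A loop comparing two sequences. -/
theorem den_cmp {x : ℕ} {ex ey : Expr} (h83 : σ.reg 83 = 0) (f g : ℕ → ℕ)
    (h : ∀ j τ, j < σ.reg x → τ.reg 84 = j →
      (∀ y, (Cmd.rep 84 x (83 ≔ reg 83 + diff ex ey)).wr y = false → τ.reg y = σ.reg y) →
      τ.arr = σ.arr → ex.eval τ = f j ∧ ey.eval τ = g j) :
    ((Cmd.rep 84 x (83 ≔ reg 83 + diff ex ey)).den ω σ).reg 83 = 0 ↔
      ∀ j < σ.reg x, f j = g j := by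
  refine Cmd.den_rep (fun j τ => τ.reg 83 = 0 ↔ ∀ l < j, f l = g l) ?_ ?_
  · simp [State.set_reg, h83]
  · intro j τ hj h84 hw ha hI
    obtain ⟨h1, h2⟩ := h j τ hj h84 hw (funext fun b => ha b rfl)
    simp only [Cmd.den, State.set_reg, Expr.eval_add, Expr.eval_sub, Expr.eval_reg, h1, h2]
    simp only [Nat.reduceEqDiff, if_false, if_true]
    rw [Nat.forall_lt_succ_right, ← hI]
    omega

/-- The number of columns of `c` that occur in the lists. -/
noncomputable def agreeCount (P : Par) (e c : ℕ → F) : ℕ :=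
  {i | i < P.n ∧ ∃ j < P.ℓ, ∀ w < P.s, c (i * P.s + w) = e ((i * P.ℓ + j) * P.s + w)}.ncard

theorem den_agreeC (hF : FieldSpec P enc) (hP : P.Ok) (hσ : HasData enc P α e σ) {c : ℕ → F}
    (hc : HasVec enc σ 6 P.ns c) : (agreeC.den ω σ).reg 81 = agreeCount P e c := by
  set p : ℕ → Prop := fun i => ∃ j < P.ℓ, ∀ w < P.s, c (i * P.s + w) = e ((i * P.ℓ + j) * P.s + w)
    with hp
  have hfin : ∀ j, {i | i < j ∧ p i}.Finite := fun j =>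
    (Set.finite_lt_nat j).subset fun i hi => hi.1
  have h6 : (σ.set 81 0).reg 6 = P.n := hσ.ctx 6 (by omega)
  set C₁ : Cmd := .rep 84 4 (83 ≔ reg 83 + diff (cell 6 (reg 60 * reg 4 + reg 84))
    (cell 0 ((reg 60 * reg 7 + reg 62) * reg 4 + reg 84))) with hC₁
  set C₂ : Cmd := 83 ≔ 0 ;; C₁ ;; .cond (reg 83) .nop (82 ≔ 1) with hC₂
  set C₃ : Cmd := 82 ≔ 0 ;; .rep 62 7 C₂ ;; 81 ≔ reg 81 + reg 82 with hC₃
  have H := Cmd.den_rep (ω := ω) (i := 60) (x := 6) (σ := σ.set 81 0) (c := C₃)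
    (fun j τ => τ.reg 81 = {i | i < j ∧ p i}.ncard) (by simp [State.set_reg]) (by
      intro i τ hi h60 hw ha hI
      rw [h6] at hi
      have dτ : HasData enc P α e τ := (hσ.set (x := 81) (by omega) 0).of_frame
        (c := .rep 60 6 C₃) rfl hw (ha 2 rfl) (ha 0 rfl)
      have h7 : (τ.set 82 0).reg 7 = P.ℓ := dτ.ctx 7 (by omega)
      have H' := Cmd.den_rep (ω := ω) (i := 62) (x := 7) (σ := τ.set 82 0) (c := C₂)
        (fun j τ' => (τ'.reg 82 = 1 ∧ ∃ l < j, ∀ w < P.s,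
            c (i * P.s + w) = e ((i * P.ℓ + l) * P.s + w)) ∨
          (τ'.reg 82 = 0 ∧ ¬ ∃ l < j, ∀ w < P.s,
            c (i * P.s + w) = e ((i * P.ℓ + l) * P.s + w)))
        (Or.inr ⟨rfl, by simp⟩) (by
          intro j τ' hj h62 hw' ha' hI'
          rw [h7] at hj
          have dτ' : HasData enc P α e τ' := (dτ.set (x := 82) (by omega) 0).of_frame
            (c := .rep 62 7 C₂) rfl hw' (ha' 2 rfl) (ha' 0 rfl)
          have h4 : (τ'.set 83 0).reg 4 = P.s := dτ'.ctx 4 (by omega)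
          have e60 : τ'.reg 60 = i := (hw' 60 rfl).trans h60
          have cmp := den_cmp (ω := ω) (σ := τ'.set 83 0) (x := 4)
            (ex := cell 6 (reg 60 * reg 4 + reg 84))
            (ey := cell 0 ((reg 60 * reg 7 + reg 62) * reg 4 + reg 84)) rfl
            (fun w => enc (c (i * P.s + w))) (fun w => enc (e ((i * P.ℓ + j) * P.s + w))) (by
              intro w τ'' hw₁ h84 hw'' ha''
              rw [h4] at hw₁
              have f60 : τ''.reg 60 = i := (hw'' 60 rfl).trans e60
              have f4 : τ''.reg 4 = P.s := (hw'' 4 rfl).trans h4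
              have f7 : τ''.reg 7 = P.ℓ := (hw'' 7 rfl).trans (dτ'.ctx 7 (by omega))
              have f62 : τ''.reg 62 = j := (hw'' 62 rfl).trans h62
              simp only [Expr.eval_get, Expr.eval_add, Expr.eval_mul, Expr.eval_reg, f60, f4, f7,
                f62, h84, ha'', State.set_arr]
              constructor
              · rw [ha' 6 rfl, State.set_arr, ha 6 rfl, State.set_arr]
                refine hc _ ?_
                rw [hP.hns]; exact idx_lt hi hw₁
              · refine dτ'.inp _ (idx_lt ?_ hw₁)
                rw [hP.hK]; exact idx_lt hi hj)
          rw [h4] at cmp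
          have e82 : (C₁.den ω (τ'.set 83 0)).reg 82 = τ'.reg 82 :=
            Cmd.den_reg C₁ rfl (τ'.set 83 0)
          have heq : (∀ w < P.s, enc (c (i * P.s + w)) = enc (e ((i * P.ℓ + j) * P.s + w))) ↔
              ∀ w < P.s, c (i * P.s + w) = e ((i * P.ℓ + j) * P.s + w) :=
            forall₂_congr fun w _ => hF.inj.eq_iff
          rw [heq] at cmp
          by_cases h0 : (C₁.den ω (τ'.set 83 0)).reg 83 = 0
          · have e : C₂.den ω τ' = (C₁.den ω (τ'.set 83 0)).set 82 1 := by
              change (Cmd.cond (reg 83) .nop (82 ≔ 1)).den ω (C₁.den ω (τ'.set 83 0)) = _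
              rw [Cmd.den, if_neg (by simpa using h0)]; rfl
            rw [e]
            exact Or.inl ⟨rfl, j, by omega, cmp.1 h0⟩
          · have e : C₂.den ω τ' = C₁.den ω (τ'.set 83 0) := by
              change (Cmd.cond (reg 83) .nop (82 ≔ 1)).den ω (C₁.den ω (τ'.set 83 0)) = _
              rw [Cmd.den, if_pos (by simpa using h0)]; rfl
            rw [e, State.set_reg, if_neg (by omega), e82]
            refine hI'.imp (fun h => ⟨h.1, ?_⟩) (fun h => ⟨h.1, ?_⟩)
            · obtain ⟨l, hl, h2⟩ := h.2
              exact ⟨l, by omega, h2⟩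
            · rintro ⟨l, hl, h2⟩
              obtain hl | rfl : l < j ∨ l = j := by omega
              · exact h.2 ⟨l, hl, h2⟩
              · exact h0 (cmp.2 h2))
      rw [h7] at H'
      have e81 : ((Cmd.rep 62 7 C₂).den ω (τ.set 82 0)).reg 81 = τ.reg 81 :=
        Cmd.den_reg (.rep 62 7 C₂) rfl (τ.set 82 0)
      change ((Cmd.rep 62 7 C₂).den ω (τ.set 82 0)).reg 81 +
        ((Cmd.rep 62 7 C₂).den ω (τ.set 82 0)).reg 82 = _
      rw [e81, hI]
      rcases H' with ⟨h1, h2⟩ | ⟨h1, h2⟩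
      · have : {l | l < i + 1 ∧ p l} = insert i {l | l < i ∧ p l} := by
          ext l; simp only [Set.mem_ofPred_eq, Set.mem_insert_iff]
          constructor
          · rintro ⟨h3, h4⟩
            obtain h3 | h3 : l < i ∨ l = i := by omega
            · exact Or.inr ⟨h3, h4⟩
            · exact Or.inl h3
          · rintro (rfl | ⟨h3, h4⟩)
            · exact ⟨by omega, h2⟩
            · exact ⟨by omega, h4⟩
        rw [this, Set.ncard_insert_of_notMem (by simp) (hfin i), h1]
      · have : {l | l < i + 1 ∧ p l} = {l | l < i ∧ p l} := by
          ext l; simp only [Set.mem_ofPred_eq]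
          constructor
          · rintro ⟨h3, h4⟩
            obtain h3 | rfl : l < i ∨ l = i := by omega
            · exact ⟨h3, h4⟩
            · exact (h2 h4).elim
          · rintro ⟨h3, h4⟩
            exact ⟨by omega, h4⟩
        rw [this, h1, add_zero])
  rw [h6] at H
  exact H

/-- Codewords, written as a single sequence, that agree with the lists in at least `a` columns. -/
def IsHit (P : Par) (α : F) (e c : ℕ → F) : Prop :=
  (∃ f : ℕ → F, ∀ l < P.ns, c l = ∑ i ∈ range (P.d + 1), f i * α ^ (l * i)) ∧
    P.a ≤ agreeCount P e c

/-- The words `ws b` are stored in array `1`, without repetition; their number is in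
register `91`. -/
structure HasList (enc : F → ℕ) (P : Par) (α : F) (e : ℕ → F) (σ : State) (ws : ℕ → ℕ → F) :
    Prop where
  stored : ∀ b < σ.reg 91, ∀ l < P.ns, σ.arr 1 (b * P.ns + l) = enc (ws b l)
  distinct : ∀ b < σ.reg 91, ∀ b' < σ.reg 91, (∀ l < P.ns, ws b l = ws b' l) → b = b'
  hit : ∀ b < σ.reg 91, IsHit P α e (ws b)

theorem HasList.congr {τ : State} {ws : ℕ → ℕ → F} (h : HasList enc P α e σ ws)
    (h91 : τ.reg 91 = σ.reg 91) (h1 : τ.arr 1 = σ.arr 1) : HasList enc P α e τ ws :=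
  ⟨by rw [h91, h1]; exact h.stored, by rw [h91]; exact h.distinct, by rw [h91]; exact h.hit⟩

theorem den_dupC (hF : FieldSpec P enc) (hσ : Ctx P σ) {c : ℕ → F}
    {ws : ℕ → ℕ → F} (hc : HasVec enc σ 6 P.ns c) (hl : HasList enc P α e σ ws)
    (hN : σ.reg 91 ≤ P.N) :
    (dupC.den ω σ).reg 85 = 0 ↔ ¬ ∃ b < σ.reg 91, ∀ l < P.ns, c l = ws b l := by
  have h18 : (σ.set 85 0).reg 18 = P.N := hσ 18 (by omega)
  set C₁ : Cmd := .rep 84 22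
    (83 ≔ reg 83 + diff (cell 6 (reg 84)) (cell 1 (reg 60 * reg 22 + reg 84))) with hC₁
  set C₂ : Cmd := .cond (notLt (reg 60) (reg 91)) .nop (83 ≔ 0 ;; C₁ ;;
    .cond (reg 83) .nop (85 ≔ 1)) with hC₂
  have H := Cmd.den_rep (ω := ω) (i := 60) (x := 18) (σ := σ.set 85 0) (c := C₂)
    (fun j τ => τ.reg 85 = 0 ↔ ¬ ∃ b < j, b < σ.reg 91 ∧ ∀ l < P.ns, c l = ws b l)
    (by simp [State.set_reg]) (by
      intro b τ hb h60 hw ha hI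
      have cτ : Ctx P τ := (hσ.set (x := 85) (by omega) 0).of_frame (c := .rep 60 18 C₂) rfl hw
      have e91 : τ.reg 91 = σ.reg 91 := hw 91 rfl
      have split : (∃ b' < b + 1, b' < σ.reg 91 ∧ ∀ l < P.ns, c l = ws b' l) ↔
          (∃ b' < b, b' < σ.reg 91 ∧ ∀ l < P.ns, c l = ws b' l) ∨
            (b < σ.reg 91 ∧ ∀ l < P.ns, c l = ws b l) := by
        constructor
        · rintro ⟨b', h1, h2⟩
          obtain h1 | rfl : b' < b ∨ b' = b := by omega
          · exact Or.inl ⟨b', h1, h2⟩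
          · exact Or.inr h2
        · rintro (⟨b', h1, h2⟩ | h)
          · exact ⟨b', by omega, h2⟩
          · exact ⟨b, by omega, h⟩
      rw [split, not_or, ← hI, State.set_reg, if_neg (by omega)]
      have ev : (notLt (reg 60) (reg 91)).eval τ = b + 1 - σ.reg 91 := by
        rw [← h60, ← e91]; rfl
      by_cases hb' : b < σ.reg 91
      · have h22 : (τ.set 83 0).reg 22 = P.ns := cτ 22 (by omega)
        have cmp := den_cmp (ω := ω) (σ := τ.set 83 0) (x := 22)
            (ex := cell 6 (reg 84)) (ey := cell 1 (reg 60 * reg 22 + reg 84)) rfl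
            (fun l => enc (c l)) (fun l => enc (ws b l)) (by
              intro l τ' hl₁ h84 hw' ha'
              rw [h22] at hl₁
              have f60 : τ'.reg 60 = b := (hw' 60 rfl).trans h60
              have f22 : τ'.reg 22 = P.ns := (hw' 22 rfl).trans h22
              simp only [Expr.eval_get, Expr.eval_add, Expr.eval_mul, Expr.eval_reg, f60, f22,
                h84, ha', State.set_arr, ha 6 rfl, ha 1 rfl]
              exact ⟨hc l hl₁, hl.stored b hb' l hl₁⟩)
        rw [h22] at cmp
        have heq : (∀ l < P.ns, enc (c l) = enc (ws b l)) ↔ ∀ l < P.ns, c l = ws b l :=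
          forall₂_congr fun w _ => hF.inj.eq_iff
        rw [heq] at cmp
        have e85 : (C₁.den ω (τ.set 83 0)).reg 85 = τ.reg 85 :=
          Cmd.den_reg C₁ rfl (τ.set 83 0)
        have e₂ : C₂.den ω τ = (Cmd.cond (reg 83) .nop (85 ≔ 1)).den ω
            (C₁.den ω (τ.set 83 0)) := by
          rw [hC₂, Cmd.den, if_neg (by rw [ev]; omega)]; rfl
        rw [e₂, Cmd.den]
        by_cases h0 : (C₁.den ω (τ.set 83 0)).reg 83 = 0
        · rw [if_neg (by simpa using h0)]
          have h1 := cmp.1 h0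
          simp only [Cmd.den, State.set_reg, if_true, hb', true_and, Expr.eval_one, one_ne_zero,
            false_iff, not_and, not_not]
          exact fun _ => h1
        · rw [if_pos (by simpa using h0)]
          have h1 := fun h => h0 (cmp.2 h)
          simp only [Cmd.den, e85, hb', true_and]
          tauto
      · have e₂ : C₂.den ω τ = τ := by
          rw [hC₂, Cmd.den, if_pos (by rw [ev]; omega)]; rfl
        rw [e₂]
        simp [hb'])
  rw [h18] at H
  refine H.trans (not_congr ?_)
  constructor
  · rintro ⟨b, -, h1, h2⟩; exact ⟨b, h1, h2⟩
  · rintro ⟨b, h1, h2⟩; exact ⟨b, by omega, h1, h2⟩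

/-- Whatever nonzero solution of the constraints of the trial with number `x` is found, the word
computed from it is `c`. -/
def Determines (P : Par) (α : F) (e Q : ℕ → F) (x : ℕ) (c : ℕ → F) : Prop :=
  (∃ v, IsSol P.U (P.d + 2) (trialCons P α e Q x) v ∧ ∃ u < P.U, v u ≠ 0) ∧
  ∀ z, IsSol P.U (P.d + 2) (trialCons P α e Q x) z → (∃ u < P.U, z u ≠ 0) →
    ∀ l < P.ns, wordVal P α z l = c l

/-- A trial extends the list by at most one word, and afterwards any word determined by the trial is
on the list. Whatever word a trial produces, it is tested before it is put on the list, so that the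
list never contains a wrong word. -/
theorem den_trialC (hF : FieldSpec P enc) (hP : P.Ok) (hσ : HasData enc P α e σ)
    (hlg : P.q - 2 < 2 ^ P.lg) {Q : ℕ → F} (hQ : HasVec enc σ 8 P.U Q) {ws : ℕ → ℕ → F}
    (hl : HasList enc P α e σ ws) (hN : σ.reg 91 ≤ P.N) :
    (trialC.den ω σ).reg 90 = σ.reg 90 / P.K ^ P.m ∧
    σ.reg 91 ≤ (trialC.den ω σ).reg 91 ∧ (trialC.den ω σ).reg 91 ≤ σ.reg 91 + 1 ∧
    ∃ ws', HasList enc P α e (trialC.den ω σ) ws' ∧ (∀ b < σ.reg 91, ws' b = ws b) ∧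
      ∀ c, IsHit P α e c → Determines P α e Q (σ.reg 90) c →
        ∃ b < (trialC.den ω σ).reg 91, ∀ l < P.ns, c l = ws' b l := by
  obtain ⟨h90, z, hz, hzs, hzn⟩ := den_systemC (ω := ω) hF hP hσ hQ
  set σ₁ := systemC.den ω σ with hσ₁
  have d₁ : HasData enc P α e σ₁ := hσ.den rfl rfl rfl
  have l₁ : HasList enc P α e σ₁ ws :=
    hl.congr (Cmd.den_reg systemC rfl σ) (Cmd.den_arr systemC rfl σ)
  have r₁ : σ₁.reg 91 = σ.reg 91 := Cmd.den_reg systemC rfl σ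
  have w₁ := den_wordC (ω := ω) hF hP d₁ hlg hz
  set σ₂ := wordC.den ω σ₁ with hσ₂
  have d₂ : HasData enc P α e σ₂ := d₁.den rfl rfl rfl
  have l₂ : HasList enc P α e σ₂ ws :=
    l₁.congr (Cmd.den_reg wordC rfl σ₁) (Cmd.den_arr wordC rfl σ₁)
  have r₂ : σ₂.reg 91 = σ.reg 91 := (Cmd.den_reg wordC rfl σ₁).trans r₁
  have x₂ : σ₂.reg 90 = σ₁.reg 90 := Cmd.den_reg wordC rfl σ₁
  have a₂ := den_agreeC (ω := ω) hF hP d₂ w₁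
  set c := wordVal P α z with hc
  set σ₃ := agreeC.den ω σ₂ with hσ₃
  have d₃ : HasData enc P α e σ₃ := d₂.den rfl rfl rfl
  have l₃ : HasList enc P α e σ₃ ws :=
    l₂.congr (Cmd.den_reg agreeC rfl σ₂) (Cmd.den_arr agreeC rfl σ₂)
  have r₃ : σ₃.reg 91 = σ.reg 91 := (Cmd.den_reg agreeC rfl σ₂).trans r₂
  have x₃ : σ₃.reg 90 = σ₁.reg 90 := (Cmd.den_reg agreeC rfl σ₂).trans x₂
  have w₃ : HasVec enc σ₃ 6 P.ns c := fun u hu => by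
    rw [hσ₃, Cmd.den_arr agreeC rfl σ₂]; exact w₁ u hu
  have dup := den_dupC (ω := ω) hF d₃.ctx w₃ l₃ (by omega)
  set σ₄ := dupC.den ω σ₃ with hσ₄
  have d₄ : HasData enc P α e σ₄ := d₃.den rfl rfl rfl
  have l₄ : HasList enc P α e σ₄ ws :=
    l₃.congr (Cmd.den_reg dupC rfl σ₃) (Cmd.den_arr dupC rfl σ₃)
  have r₄ : σ₄.reg 91 = σ.reg 91 := (Cmd.den_reg dupC rfl σ₃).trans r₃
  have x₄ : σ₄.reg 90 = σ.reg 90 / P.K ^ P.m :=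
    ((Cmd.den_reg dupC rfl σ₃).trans x₃).trans h90
  have w₄ : HasVec enc σ₄ 6 P.ns c := fun u hu => by
    rw [hσ₄, Cmd.den_arr dupC rfl σ₃]; exact w₃ u hu
  have a₄ : σ₄.reg 81 = agreeCount P e c := (Cmd.den_reg dupC rfl σ₃).trans a₂
  rw [r₃] at dup
  have hword : ∃ f : ℕ → F, ∀ l < P.ns, c l = ∑ i ∈ range (P.d + 1), f i * α ^ (l * i) :=
    ⟨fun i => z (P.d + 1) ^ (P.q - 2) * z i, fun l _ => rfl⟩
  have hdet : ∀ c₀, IsHit P α e c₀ → Determines P α e Q (σ.reg 90) c₀ →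
      ∀ l < P.ns, c l = c₀ l := fun c₀ _ h₀ => h₀.2 z hzs (hzn h₀.1)
  have hcong : ∀ c₀ : ℕ → F, (∀ l < P.ns, c l = c₀ l) → agreeCount P e c = agreeCount P e c₀ := by
    intro c₀ h
    have : ∀ i < P.n, ∀ w < P.s, c (i * P.s + w) = c₀ (i * P.s + w) := fun i hi w hw =>
      h _ (by rw [hP.hns]; exact idx_lt hi hw)
    simp only [agreeCount]
    congr 1; ext i
    simp only [Set.mem_ofPred_eq]
    refine and_congr_right fun hi => exists_congr fun j => and_congr_right fun _ =>
      forall₂_congr fun w hw => ?_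
    rw [this i hi w hw]
  set ap : Cmd := .rep 84 22 (.store 1 (reg 91 * reg 22 + reg 84) (cell 6 (reg 84))) ;;
    91 ≔ reg 91 + 1 with hap
  have e₅ : trialC.den ω σ = (Cmd.cond (reg 10 - reg 81 + reg 85) .nop ap).den ω σ₄ := rfl
  have ev : (reg 10 - reg 81 + reg 85).eval σ₄ = P.a - agreeCount P e c + σ₄.reg 85 := by
    have h10 : σ₄.reg 10 = P.a := d₄.ctx 10 (by omega)
    rw [← h10, ← a₄]; rfl
  rw [e₅, Cmd.den, ev]
  by_cases hcond : P.a - agreeCount P e c + σ₄.reg 85 = 0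
  · rw [if_neg (by simpa using hcond)]
    have h22 : σ₄.reg 22 = P.ns := d₄.ctx 22 (by omega)
    have hnew := dup.1 (by omega)
    have A := Cmd.den_rep (ω := ω) (i := 84) (x := 22) (σ := σ₄)
      (c := .store 1 (reg 91 * reg 22 + reg 84) (cell 6 (reg 84)))
      (fun j τ => ∀ i, τ.arr 1 i = if σ.reg 91 * P.ns ≤ i ∧ i < σ.reg 91 * P.ns + j then
        enc (c (i - σ.reg 91 * P.ns)) else σ₄.arr 1 i)
      (by intro i; rw [if_neg (by omega)]; rfl) (by
        intro j τ hj h84 hw ha hI i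
        rw [h22] at hj
        simp only [Cmd.den, State.set_arr, State.put_arr, Expr.eval_add, Expr.eval_mul,
          Expr.eval_reg, Expr.eval_get, hw 91 rfl, hw 22 rfl, h84, h22, r₄, ha 6 rfl, true_and, hI,
          w₄ j hj]
        by_cases h1 : i = σ.reg 91 * P.ns + j
        · rw [if_pos h1, if_pos (by omega), h1, Nat.add_sub_cancel_left]
        · rw [if_neg h1]
          by_cases h2 : σ.reg 91 * P.ns ≤ i ∧ i < σ.reg 91 * P.ns + j
          · rw [if_pos h2, if_pos (by omega)]
          · rw [if_neg h2, if_neg (by omega)])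
    rw [h22] at A
    set L : Cmd := .rep 84 22 (.store 1 (reg 91 * reg 22 + reg 84) (cell 6 (reg 84))) with hL
    have L91 : (L.den ω σ₄).reg 91 = σ.reg 91 := (Cmd.den_reg L rfl σ₄).trans r₄
    have L90 : (L.den ω σ₄).reg 90 = σ.reg 90 / P.K ^ P.m := (Cmd.den_reg L rfl σ₄).trans x₄
    have e₆ : ap.den ω σ₄ = (L.den ω σ₄).set 91 (σ.reg 91 + 1) := by
      rw [← L91]; rfl
    have R91 : (ap.den ω σ₄).reg 91 = σ.reg 91 + 1 := by rw [e₆]; rfl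
    refine ⟨by rw [e₆]; exact L90, by omega, by omega,
      fun b => if b = σ.reg 91 then c else ws b, ⟨?_, ?_, ?_⟩, ?_, ?_⟩
    · intro b hb l hl'
      rw [R91] at hb
      rw [e₆, State.set_arr, A]
      by_cases h : b = σ.reg 91
      · rw [if_pos (by subst h; omega), if_pos h, h, Nat.add_sub_cancel_left]
      · have := idx_lt (show b < σ.reg 91 by omega) hl'
        rw [if_neg (by omega), if_neg h]
        exact l₄.stored b (by omega) l hl'
    · intro b hb b' hb' hbb
      rw [R91] at hb hb'
      by_cases h : b = σ.reg 91 <;> by_cases h' : b' = σ.reg 91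
      · omega
      · simp only [if_pos h, if_neg h'] at hbb
        exact (hnew ⟨b', by omega, hbb⟩).elim
      · simp only [if_neg h, if_pos h'] at hbb
        exact (hnew ⟨b, by omega, fun l hl' => (hbb l hl').symm⟩).elim
      · simp only [if_neg h, if_neg h'] at hbb
        exact hl.distinct b (by omega) b' (by omega) hbb
    · intro b hb
      rw [R91] at hb
      by_cases h : b = σ.reg 91
      · simp only [if_pos h]
        exact ⟨hword, by omega⟩
      · simp only [if_neg h]
        exact hl.hit b (by omega)
    · intro b hb
      simp [hb.ne]
    · intro c₀ h1 h2
      exact ⟨σ.reg 91, by omega, fun l hl' => by simp [hdet c₀ h1 h2 l hl']⟩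
  · rw [if_pos hcond]
    refine ⟨x₄, r₄.ge, by simp only [Cmd.den]; omega, ws, l₄, fun _ _ => rfl, ?_⟩
    intro c₀ h1 h2
    have h3 := hdet c₀ h1 h2
    have h4 : P.a ≤ agreeCount P e c := by rw [hcong c₀ h3]; exact h1.2
    have h5 : ∃ b < σ.reg 91, ∀ l < P.ns, c l = ws b l := by
      by_contra hcon
      have := dup.2 hcon
      omega
    obtain ⟨b, hb, hbl⟩ := h5
    exact ⟨b, by simp only [Cmd.den]; omega, fun l hl' => (h3 l hl').symm.trans (hbl l hl')⟩

/-- The number whose binary digits are the first `J` coin flips. -/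
def coinNum (ω : ℕ → Bool) : ℕ → ℕ
  | 0 => 0
  | J + 1 => coinNum ω J + coinNum ω J + (ω J).toNat

/-- The words on the list are always correct; a word is on the list if it is determined by some
trial. -/
theorem den_searchC (hF : FieldSpec P enc) (hP : P.Ok) (hσ : HasData enc P α e σ)
    (hlg : P.q - 2 < 2 ^ P.lg) {Q : ℕ → F} (hQ : HasVec enc σ 8 P.U Q) (hu : σ.used = 0) :
    ∃ ws, HasList enc P α e (searchC.den ω σ) ws ∧
      ∀ c, IsHit P α e c →
        (∃ i < P.N, Determines P α e Q (coinNum ω P.J / P.K ^ (P.m * i)) c) →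
        ∃ b < (searchC.den ω σ).reg 91, ∀ l < P.ns, c l = ws b l := by
  have h19 : (σ.set 90 0).reg 19 = P.J := hσ.ctx 19 (by omega)
  set fl : Cmd := .flip 93 ;; 90 ≔ reg 90 + reg 90 + reg 93 with hfl
  have H₁ := Cmd.den_rep (ω := ω) (i := 92) (x := 19) (σ := σ.set 90 0) (c := fl)
    (fun j τ => τ.reg 90 = coinNum ω j ∧ τ.used = j) ⟨rfl, hu⟩ (by
      rintro j τ - - - - ⟨h1, h2⟩
      refine ⟨?_, ?_⟩
      · change τ.reg 90 + τ.reg 90 + (ω τ.used).toNat = _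
        rw [h1, h2]; rfl
      · change τ.used + 1 = j + 1
        rw [h2])
  rw [h19] at H₁
  set σ₁ := (Cmd.rep 92 19 fl).den ω (σ.set 90 0) with hσ₁
  have d₁ : HasData enc P α e σ₁ := (hσ.set (x := 90) (by omega) 0).den rfl rfl rfl
  have q₁ : σ₁.arr 8 = σ.arr 8 := Cmd.den_arr (.rep 92 19 fl) rfl (σ.set 90 0)
  have h18 : (σ₁.set 91 0).reg 18 = P.N := d₁.ctx 18 (by omega)
  have H₂ := Cmd.den_rep (ω := ω) (i := 94) (x := 18) (σ := σ₁.set 91 0) (c := trialC)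
    (fun j τ => τ.reg 90 = coinNum ω P.J / P.K ^ (P.m * j) ∧ τ.reg 91 ≤ j ∧
      ∃ ws, HasList enc P α e τ ws ∧ ∀ c, IsHit P α e c →
        (∃ i < j, Determines P α e Q (coinNum ω P.J / P.K ^ (P.m * i)) c) →
        ∃ b < τ.reg 91, ∀ l < P.ns, c l = ws b l)
    (by
      refine ⟨?_, le_rfl, fun _ _ => 0, ⟨?_, ?_, ?_⟩, ?_⟩
      · rw [mul_zero, pow_zero, Nat.div_one]; exact H₁.1
      · intro b hb; exact absurd hb (Nat.not_lt_zero b)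
      · intro b hb; exact absurd hb (Nat.not_lt_zero b)
      · intro b hb; exact absurd hb (Nat.not_lt_zero b)
      · rintro c - ⟨i, hi, -⟩; exact absurd hi (Nat.not_lt_zero i)) (by
      rintro j τ hj - hw ha ⟨h90, h91, ws, hl, hfound⟩
      rw [h18] at hj
      have dτ : HasData enc P α e τ := (d₁.set (x := 91) (by omega) 0).of_frame
        (c := .rep 94 18 trialC) rfl hw (ha 2 rfl) (ha 0 rfl)
      obtain ⟨t90, t1, t2, ws', hl', hws, hnew⟩ := den_trialC (ω := ω) hF hP dτ hlg (Q := Q)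
        (fun u hu => by rw [ha 8 rfl, State.set_arr, q₁]; exact hQ u hu) hl (by omega)
      have f91 : ((trialC.den ω τ).set 94 (j + 1)).reg 91 = (trialC.den ω τ).reg 91 := rfl
      refine ⟨?_, ?_, ws', hl'.congr rfl rfl, ?_⟩
      · change (trialC.den ω τ).reg 90 = _
        rw [t90, h90, Nat.div_div_eq_div_mul, ← pow_add, Nat.mul_succ]
      · rw [f91]; omega
      · rintro c hc ⟨i, hi, hdet⟩
        rw [f91]
        obtain hi | rfl : i < j ∨ i = j := by omega
        · obtain ⟨b, hb, hbl⟩ := hfound c hc ⟨i, hi, hdet⟩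
          exact ⟨b, by omega, by rw [hws b hb]; exact hbl⟩
        · exact hnew c hc (by rw [h90]; exact hdet))
  rw [h18] at H₂
  obtain ⟨-, -, ws, h1, h2⟩ := H₂
  exact ⟨ws, h1, h2⟩

/-- Interpolation, together with the table of powers of `α`. -/
theorem den_prepC (hF : FieldSpec P enc) (hP : P.Ok) (hσ : Ctx P σ) (hα : P.α = enc α)
    (hin : ∀ j < P.K * P.s, σ.arr 0 j = enc (e j)) :
    HasData enc P α e (prepC.den ω σ) ∧
    ∃ Q : ℕ → F, HasVec enc (prepC.den ω σ) 8 P.U Q ∧ IsSol P.U P.U (interpCons P α e) Q ∧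
      ((∃ v, IsSol P.U P.U (interpCons P α e) v ∧ ∃ u < P.U, v u ≠ 0) → ∃ u < P.U, Q u ≠ 0) := by
  have d₁ : HasData enc P α e (powC.den ω σ) :=
    ⟨hσ.of_keeps rfl, den_powC hF hσ hα, fun j hj => by
      rw [Cmd.den_arr powC rfl σ]; exact hin j hj⟩
  exact ⟨d₁.den (c := interpC) rfl rfl rfl, den_interpC hF hP d₁⟩

end RAM

/-! ### Interpolation and the space of solutions -/

namespace RAM

open Finset Polynomial

variable {F : Type*} [Field F] {P : Par} {α : F} {e Q : ℕ → F}

theorem sum_range_mul' {M : Type*} [AddCommMonoid M] (m D : ℕ) (f : ℕ → M) :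
    ∑ u ∈ range (m * D), f u = ∑ j ∈ range m, ∑ h ∈ range D, f (j * D + h) := by
  induction m with
  | zero => simp
  | succ m ih => rw [Nat.succ_mul, sum_range_add, ih, sum_range_succ]

/-- The polynomial with coefficients `f 0, …, f (D - 1)`. -/
noncomputable def ofCoeffs (D : ℕ) (f : ℕ → F) : F[X] :=
  ∑ h ∈ range D, C (f h) * X ^ h

theorem coeff_ofCoeffs (D : ℕ) (f : ℕ → F) (n : ℕ) :
    (ofCoeffs D f).coeff n = if n < D then f n else 0 := by
  simp [ofCoeffs, finsetSum_coeff]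

theorem eval_ofCoeffs (D : ℕ) (f : ℕ → F) (x : F) :
    (ofCoeffs D f).eval x = ∑ h ∈ range D, f h * x ^ h := by
  simp [ofCoeffs, eval_finsetSum]

theorem natDegree_ofCoeffs_lt {D : ℕ} (hD : 0 < D) (f : ℕ → F) :
    (ofCoeffs D f).natDegree < D := by
  have : (ofCoeffs D f).natDegree ≤ D - 1 := natDegree_le_iff_coeff_eq_zero.2 fun n hn => by
    rw [coeff_ofCoeffs, if_neg (by omega)]
  omega

theorem ofCoeffs_coeff {p : F[X]} {d : ℕ} (hp : p.natDegree ≤ d) :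
    ofCoeffs (d + 1) p.coeff = p := by
  ext n
  rw [coeff_ofCoeffs]
  split
  · rfl
  · exact (coeff_eq_zero_of_natDegree_lt (by omega)).symm

/-- The homogeneous part `∑ j, A_{j+1}(X) p(α^j X)` of the interpolation identity. -/
noncomputable def homog (P : Par) (α : F) (Q : ℕ → F) : F[X] →ₗ[F] F[X] where
  toFun p := ∑ j ∈ range P.m, ofCoeffs P.D1 (fun h => Q (j * P.D1 + h)) * p.comp (C (α ^ j) * X)
  map_add' p p' := by simp [add_comp, mul_add, sum_add_distrib]
  map_smul' c p := by simp [smul_comp, smul_sum]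

theorem homog_apply (p : F[X]) : homog P α Q p =
    ∑ j ∈ range P.m, ofCoeffs P.D1 (fun h => Q (j * P.D1 + h)) * p.comp (C (α ^ j) * X) := rfl

/-- The inhomogeneous part `A₀`. -/
noncomputable def inhom (P : Par) (Q : ℕ → F) : F[X] :=
  ofCoeffs P.H fun h => Q (P.m * P.D1 + h)

/-- The numerical conditions under which interpolation and decoding work: `hag` says that there are
more zeros than the degree allows, and `hcount` that there are more unknowns than constraints. -/
structure Par.Num (P : Par) (α : F) : Prop where
  ok : P.Ok
  inj : ∀ i < P.ns, ∀ j < P.ns, α ^ i = α ^ j → i = j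
  hd : P.d < P.ns
  hag : P.H ≤ P.a * P.sm
  hcount : P.K * P.sm < P.U
  hg : P.g = P.a * P.s - P.d
  hgpos : 0 < P.g

theorem Par.Num.hHpos (h : P.Num α) : 0 < P.H := by
  have := h.ok.hH; have := h.ok.hD1; omega

theorem Par.Num.hns (h : P.Num α) : P.ns = P.n * P.s := h.ok.hns

/-- A polynomial vanishing at the first `r` points of all columns in `I` is zero, if its degree is
less than `#I * r`. -/
theorem eq_zero_of_columns (h : P.Num α) {p : F[X]} {I : Finset ℕ} {r : ℕ} (hI : ∀ i ∈ I, i < P.n)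
    (hr : r ≤ P.s) (hp : ∀ i ∈ I, ∀ t < r, p.eval (α ^ (i * P.s + t)) = 0)
    (hdeg : p.natDegree < #I * r) : p = 0 := by
  classical
  refine eq_zero_of_natDegree_lt_card_of_eval_eq_zero' p
    ((I ×ˢ range r).image fun it => α ^ (it.1 * P.s + it.2)) ?_ ?_
  · intro x hx
    obtain ⟨⟨i, t⟩, hit, rfl⟩ := mem_image.1 hx
    rw [mem_product, mem_range] at hit
    exact hp i hit.1 t hit.2
  · rw [card_image_of_injOn, card_product, card_range]
    · exact hdeg
    · rintro ⟨i, t⟩ hit ⟨i', t'⟩ hit' heq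
      simp only [coe_product, Set.mem_prod, mem_coe, mem_range] at hit hit'
      have l1 : i * P.s + t < P.ns := by rw [h.hns]; exact idx_lt (hI _ hit.1) (by omega)
      have l2 : i' * P.s + t' < P.ns := by rw [h.hns]; exact idx_lt (hI _ hit'.1) (by omega)
      have := h.inj _ l1 _ l2 heq
      have e1 := idx_div (b := i) (show t < P.s by omega)
      have e2 := idx_mod (b := i) (show t < P.s by omega)
      rw [this, idx_div (by omega)] at e1
      rw [this, idx_mod (by omega)] at e2
      rw [e1, e2]

theorem comp_C_mul_X_natDegree_le (p : F[X]) (c : F) : (p.comp (C c * X)).natDegree ≤ p.natDegree :=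
  natDegree_le_iff_coeff_eq_zero.2 fun n hn => by
    rw [comp_C_mul_X_coeff, coeff_eq_zero_of_natDegree_lt hn, zero_mul]

theorem natDegree_homog_lt (h : P.Num α) {p : F[X]} (hp : p.natDegree ≤ P.d) :
    (homog P α Q p).natDegree < P.H := by
  have hD1 := h.ok.hD1
  have hH := h.ok.hH
  rw [homog_apply]
  refine lt_of_le_of_lt (natDegree_sum_le_of_forall_le (n := P.D1 - 1 + P.d) _ _ fun j _ => ?_)
    (by omega)
  refine natDegree_mul_le.trans (Nat.add_le_add ?_ ((comp_C_mul_X_natDegree_le _ _).trans hp))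
  have := natDegree_ofCoeffs_lt hD1 (fun h => Q (j * P.D1 + h))
  omega

theorem natDegree_inhom_lt (h : P.Num α) (Q : ℕ → F) : (inhom P Q).natDegree < P.H :=
  natDegree_ofCoeffs_lt h.hHpos _

/-- If `p` agrees with the input word `y` in `m` consecutive entries, then the value of the
interpolation identity for `p` at the corresponding point is the left side of a constraint. -/
theorem eval_interp (h : P.Num α) {y t : ℕ} {p : F[X]} (hp : ∀ j < P.m,
    p.eval (α ^ (y / P.ℓ * P.s + t + j)) = e (y * P.s + t + j)) :
    (inhom P Q + homog P α Q p).eval (α ^ (y / P.ℓ * P.s + t)) =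
      dot P.U (interpRow P α e y t) Q := by
  have hD1 := h.ok.hD1
  rw [dot, h.ok.hU, sum_range_add, sum_range_mul', eval_add, add_comm, inhom, eval_ofCoeffs,
    homog_apply, eval_finsetSum]
  congr 1
  · refine sum_congr rfl fun j hj => ?_
    rw [mem_range] at hj
    rw [eval_mul, eval_ofCoeffs, eval_comp, eval_mul, eval_C, eval_X, ← pow_add, add_comm j,
      hp j hj, sum_mul]
    refine sum_congr rfl fun h hh => ?_
    rw [mem_range] at hh
    rw [interpRow, if_pos (idx_lt hj hh), idx_div hh, idx_mod hh, pow_mul]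
    ring
  · refine sum_congr rfl fun h _ => ?_
    rw [interpRow, if_neg (by omega), Nat.add_sub_cancel_left, pow_mul]
    ring

/-- The columns in which the codeword of `p` agrees with the lists. -/
noncomputable def agreeCols (P : Par) (α : F) (e : ℕ → F) (p : F[X]) : Finset ℕ := by
  classical
  exact (range P.n).filter fun i => ∃ j < P.ℓ, ∀ w < P.s,
    p.eval (α ^ (i * P.s + w)) = e ((i * P.ℓ + j) * P.s + w)

theorem mem_agreeCols {p : F[X]} {i : ℕ} : i ∈ agreeCols P α e p ↔
    i < P.n ∧ ∃ j < P.ℓ, ∀ w < P.s,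
      p.eval (α ^ (i * P.s + w)) = e ((i * P.ℓ + j) * P.s + w) := by
  classical
  simp [agreeCols]

/-- The message polynomials of the codewords that are to be found. -/
def IsMsg (P : Par) (α : F) (e : ℕ → F) (p : F[X]) : Prop :=
  p.natDegree ≤ P.d ∧ P.a ≤ #(agreeCols P α e p)

/-- The interpolation identity: the polynomial `A₀ + ∑ j, A_{j+1} p(α^j X)` has too many zeros. -/
theorem IsMsg.interp (h : P.Num α) (hQ : IsSol P.U P.U (interpCons P α e) Q) {p : F[X]}
    (hp : IsMsg P α e p) : inhom P Q + homog P α Q p = 0 := by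
  have hsm := h.ok.hsm
  have hm := h.ok.hm
  have hms := h.ok.hms
  refine eq_zero_of_columns h (I := agreeCols P α e p) (r := P.sm)
    (fun i hi => (mem_agreeCols.1 hi).1) (by omega) ?_ ?_
  · intro i hi t ht
    obtain ⟨hin, j, hj, hij⟩ := mem_agreeCols.1 hi
    have hy : i * P.ℓ + j < P.K := by rw [h.ok.hK]; exact idx_lt hin hj
    have e1 : (i * P.ℓ + j) / P.ℓ = i := idx_div hj
    have := eval_interp (Q := Q) (e := e) (y := i * P.ℓ + j) (t := t) (p := p) h (by
      intro j' hj'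
      rw [e1, add_assoc, hij _ (by omega), ← add_assoc])
    rw [e1] at this
    rw [this]
    exact hQ.2 _ ⟨(i * P.ℓ + j, t), ⟨hy, ht⟩, rfl⟩
  · refine lt_of_lt_of_le (lt_of_le_of_lt (natDegree_add_le _ _)
      (max_lt (natDegree_inhom_lt h Q) (natDegree_homog_lt h hp.1)))
      (h.hag.trans (Nat.mul_le_mul_right _ hp.2))

/-- The space of differences of solutions of the interpolation identity. -/
noncomputable def solSpace (P : Par) (α : F) (Q : ℕ → F) : Submodule F F[X] :=
  degreeLT F (P.d + 1) ⊓ LinearMap.ker (homog P α Q)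

theorem mem_solSpace {p : F[X]} :
    p ∈ solSpace P α Q ↔ p.natDegree ≤ P.d ∧ homog P α Q p = 0 := by
  rw [solSpace, Submodule.mem_inf, LinearMap.mem_ker, mem_degreeLT,
    ← Nat.lt_succ_iff, Nat.succ_eq_add_one]
  refine and_congr_left fun _ => ?_
  by_cases hp : p = 0
  · simp [hp]
  · exact (natDegree_lt_iff_degree_lt hp).symm

theorem coeff_homog (p : F[X]) (h : ℕ) : (homog P α Q p).coeff h =
    ∑ j ∈ range P.m, ∑ c ∈ range (h + 1),
      (if h - c < P.D1 then Q (j * P.D1 + (h - c)) else 0) * (p.coeff c * α ^ (j * c)) := by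
  rw [homog_apply, finsetSum_coeff]
  refine sum_congr rfl fun j _ => ?_
  rw [mul_comm, coeff_mul, Nat.sum_antidiagonal_eq_sum_range_succ
    (fun c b => (p.comp (C (α ^ j) * X)).coeff c * (ofCoeffs P.D1 _).coeff b)]
  refine sum_congr rfl fun c _ => ?_
  rw [coeff_ofCoeffs, comp_C_mul_X_coeff, ← pow_mul, mul_comm]

instance : FiniteDimensional F (solSpace P α Q) :=
  Submodule.finiteDimensional_of_le (S₂ := degreeLT F (P.d + 1)) inf_le_left

/-- The space of differences of solutions has dimension less than `m`. If `v` is the lowest exponent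
occurring in `A₁, …, A_m`, and `B(Z)` is the sum of the `A_{j+1}[v] Z^j`, then the coefficients of a
solution at those `c` with `B(α^c) ≠ 0` are determined by lower ones. -/
theorem finrank_solSpace_lt (h : P.Num α) (hA : ∃ j < P.m, ∃ h < P.D1, Q (j * P.D1 + h) ≠ 0) :
    Module.finrank F (solSpace P α Q) < P.m := by
  classical
  have hex : ∃ v, v < P.D1 ∧ ∃ j < P.m, Q (j * P.D1 + v) ≠ 0 := by
    obtain ⟨j, hj, v, hv, hne⟩ := hA
    exact ⟨v, hv, j, hj, hne⟩
  set v := Nat.find hex with hv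
  obtain ⟨hvD, j₀, hj₀, hne⟩ := Nat.find_spec hex
  rw [← hv] at hvD hne
  have hmin : ∀ a < v, ∀ j < P.m, Q (j * P.D1 + a) = 0 := by
    intro a ha j hj
    by_contra hcon
    exact Nat.find_min hex ha ⟨by omega, j, hj, hcon⟩
  set B := ofCoeffs P.m fun j => Q (j * P.D1 + v) with hB
  have hB0 : B ≠ 0 := by
    intro h0
    have : B.coeff j₀ = 0 := by rw [h0, coeff_zero]
    rw [hB, coeff_ofCoeffs, if_pos hj₀] at this
    exact hne this
  -- `B` has degree less than `m` and the `α ^ c` are distinct, so that `Z` has less than `m`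
  -- elements.
  set Z := (range (P.d + 1)).filter fun c => B.eval (α ^ c) = 0 with hZ
  have hZm : #Z < P.m := by
    by_contra hcon
    refine hB0 (eq_zero_of_natDegree_lt_card_of_eval_eq_zero' B (Z.image fun c => α ^ c) ?_ ?_)
    · intro x hx
      obtain ⟨c, hc, rfl⟩ := mem_image.1 hx
      exact (mem_filter.1 hc).2
    · rw [card_image_of_injOn]
      · exact (natDegree_ofCoeffs_lt h.ok.hm _).trans_le (not_lt.1 hcon)
      · intro c hc c' hc' heq
        have h1 := mem_range.1 (mem_filter.1 hc).1
        have h2 := mem_range.1 (mem_filter.1 hc').1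
        have := h.hd
        exact h.inj _ (by omega) _ (by omega) heq
  refine lt_of_le_of_lt ?_ hZm
  set L : solSpace P α Q →ₗ[F] (Z → F) :=
    { toFun := fun p c => (p : F[X]).coeff c
      map_add' := fun p q => by ext c; simp
      map_smul' := fun a p => by ext c; simp } with hL
  have hinj : Function.Injective L := by
    rw [← LinearMap.ker_eq_bot, LinearMap.ker_eq_bot']
    rintro ⟨p, hp⟩ h0
    obtain ⟨hpd, hph⟩ := mem_solSpace.1 hp
    have hc : ∀ c, p.coeff c = 0 := by
      intro c
      induction c using Nat.strong_induction_on with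
      | _ c ih =>
        by_cases hcd : P.d < c
        · exact coeff_eq_zero_of_natDegree_lt (by omega)
        · by_cases hcZ : c ∈ Z
          · exact congrFun h0 ⟨c, hcZ⟩
          · have h1 : (homog P α Q p).coeff (v + c) = 0 := by rw [hph, coeff_zero]
            rw [coeff_homog] at h1
            -- In the coefficient of `X ^ (v + c)`, terms with lower coefficients of `p` vanish by
            -- induction, and those with higher ones as they involve exponents below `v`.
            have h2 : ∀ j ∈ range P.m, (∑ b ∈ range (v + c + 1),
                (if v + c - b < P.D1 then Q (j * P.D1 + (v + c - b)) else 0) *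
                  (p.coeff b * α ^ (j * b))) = Q (j * P.D1 + v) * (α ^ c) ^ j * p.coeff c := by
              intro j hj
              rw [sum_eq_single c]
              · rw [Nat.add_sub_cancel, if_pos hvD, mul_comm j c, pow_mul]; ring
              · intro b hb hbc
                rw [mem_range] at hb
                obtain hlt | hgt : b < c ∨ c < b := by omega
                · rw [ih b hlt]; ring
                · rw [hmin (v + c - b) (by omega) j (mem_range.1 hj)]; simp
              · intro hcon; exact absurd (mem_range.2 (by omega)) hcon
            rw [sum_congr rfl h2, ← sum_mul, ← eval_ofCoeffs P.m (fun j => Q (j * P.D1 + v))] at h1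
            refine (mul_eq_zero.1 h1).resolve_left fun h3 => hcZ ?_
            exact mem_filter.2 ⟨mem_range.2 (by omega), h3⟩
    exact Subtype.ext (Polynomial.ext hc)
  have := LinearMap.finrank_le_finrank_of_injective hinj
  simpa using this

/-- The inhomogeneous part cannot be the only nonzero one, if the identity has a solution. -/
theorem exists_coeff_ne (h : P.Num α) (hQ : ∃ u < P.U, Q u ≠ 0) {p : F[X]}
    (hp : inhom P Q + homog P α Q p = 0) : ∃ j < P.m, ∃ h < P.D1, Q (j * P.D1 + h) ≠ 0 := by
  by_contra hcon
  push Not at hcon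
  obtain ⟨u, hu, hne⟩ := hQ
  have h0 : homog P α Q p = 0 := by
    rw [homog_apply]
    refine sum_eq_zero fun j hj => ?_
    have : ofCoeffs P.D1 (fun h => Q (j * P.D1 + h)) = 0 := by
      ext n
      rw [coeff_ofCoeffs]
      split
      · rename_i hn; simp [hcon j (mem_range.1 hj) n hn]
      · simp
    rw [this, zero_mul]
  rw [h0, add_zero] at hp
  by_cases hlt : u < P.m * P.D1
  · have h1 := hcon (u / P.D1) ((Nat.div_lt_iff_lt_mul h.ok.hD1).2 hlt) (u % P.D1)
      (Nat.mod_lt _ h.ok.hD1)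
    rw [mul_comm, Nat.div_add_mod] at h1
    exact hne h1
  · have h1 : (inhom P Q).coeff (u - P.m * P.D1) = 0 := by rw [hp, coeff_zero]
    have := h.ok.hU
    rw [inhom, coeff_ofCoeffs, if_pos (by omega), Nat.add_sub_cancel' (by omega)] at h1
    exact hne h1

/-- The interpolation constraints have a nonzero solution, as there are more unknowns than
constraints. -/
theorem exists_interp (h : P.Num α) (e : ℕ → F) :
    ∃ v, IsSol P.U P.U (interpCons P α e) v ∧ ∃ u < P.U, v u ≠ 0 := by
  classical
  set L : (Fin P.U → F) →ₗ[F] (Fin (P.K * P.sm) → F) :=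
    { toFun := fun v i => ∑ u : Fin P.U, interpRow P α e (i / P.sm) (i % P.sm) u * v u
      map_add' := fun v w => by ext i; simp [mul_add, sum_add_distrib]
      map_smul' := fun c v => by
        ext i
        simp only [Pi.smul_apply, smul_eq_mul, RingHom.id_apply, mul_sum]
        exact sum_congr rfl fun u _ => by ring } with hL
  have hker := LinearMap.ker_ne_bot_of_finrank_lt (f := L) (by simpa using h.hcount)
  obtain ⟨v, hv, hv0⟩ := Submodule.exists_mem_ne_zero_of_ne_bot hker
  obtain ⟨u, hu⟩ := Function.ne_iff.1 hv0
  refine ⟨fun u => if hu : u < P.U then v ⟨u, hu⟩ else 0, ⟨fun u h1 h2 => by omega, ?_⟩,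
    u, u.2, by simpa using hu⟩
  rintro w ⟨⟨y, t⟩, ⟨hy, ht⟩, rfl⟩
  have := congrFun (LinearMap.mem_ker.1 hv) ⟨y * P.sm + t, idx_lt hy ht⟩
  simp only [hL, LinearMap.coe_mk, AddHom.coe_mk, idx_div ht, idx_mod ht] at this
  rw [dot, ← Fin.sum_univ_eq_sum_range (fun u => interpRow P α e y t u *
    (if hu : u < P.U then v ⟨u, hu⟩ else 0))]
  simpa using this

theorem sum_range_support {d U : ℕ} (hdU : d + 2 ≤ U) {f : ℕ → F}
    (hf : ∀ u < U, d + 2 ≤ u → f u = 0) :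
    ∑ u ∈ range U, f u = ∑ c ∈ range (d + 1), f c + f (d + 1) := by
  obtain ⟨r, rfl⟩ := Nat.exists_eq_add_of_le hdU
  rw [sum_range_add, sum_range_succ, add_eq_left]
  exact sum_eq_zero fun x hx => hf _ (by rw [mem_range] at hx; omega) (by omega)

/-- The constraints of a trial, in terms of polynomials: `z` stands for the polynomial with the
coefficients `z₀, …, z_d` and the factor `z_{d+1}`. -/
theorem isSol_trialCons_iff (h : P.Num α) {x : ℕ} {z : ℕ → F}
    (hz : ∀ u < P.U, P.d + 2 ≤ u → z u = 0) :
    IsSol P.U (P.d + 2) (trialCons P α e Q x) z ↔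
      z (P.d + 1) • inhom P Q + homog P α Q (ofCoeffs (P.d + 1) z) = 0 ∧
      ∀ i < P.m, ∀ w < P.s,
        (ofCoeffs (P.d + 1) z).eval (α ^ (x / P.K ^ i % P.K / P.ℓ * P.s + w)) =
          z (P.d + 1) * e (x / P.K ^ i % P.K * P.s + w) := by
  have hd2 := h.ok.d2
  have h2 : ∀ k < P.H, dot P.U (identityRow P α Q k) z =
      (z (P.d + 1) • inhom P Q + homog P α Q (ofCoeffs (P.d + 1) z)).coeff k := by
    intro k hk
    rw [dot, sum_range_support hd2 (fun u h1 h2 => by rw [hz u h1 h2, mul_zero]), coeff_add,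
      coeff_smul, inhom, coeff_ofCoeffs, if_pos hk, add_comm, smul_eq_mul, identityRow, if_pos rfl,
      mul_comm, coeff_homog, sum_comm]
    congr 1
    have h3 : ∀ c ∈ range (P.d + 1), identityRow P α Q k c * z c =
        if c ≤ k then ∑ j ∈ range P.m, (if k - c < P.D1 then Q (j * P.D1 + (k - c)) else 0) *
          (z c * α ^ (j * c)) else 0 := by
      intro c hc
      rw [mem_range] at hc
      rw [identityRow, if_neg (by omega)]
      by_cases h4 : c ≤ k
      · by_cases h5 : k - c < P.D1
        · rw [if_pos ⟨by omega, h4, h5⟩, if_pos h4, sum_mul]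
          refine sum_congr rfl fun j _ => ?_
          rw [if_pos h5]; ring
        · rw [if_neg (by tauto), if_pos h4]
          simp [h5]
      · rw [if_neg (by tauto), if_neg h4, zero_mul]
    have h4 : ∀ c ∈ range (k + 1), (∑ j ∈ range P.m,
        (if k - c < P.D1 then Q (j * P.D1 + (k - c)) else 0) *
          ((ofCoeffs (P.d + 1) z).coeff c * α ^ (j * c))) =
        if c < P.d + 1 then ∑ j ∈ range P.m,
          (if k - c < P.D1 then Q (j * P.D1 + (k - c)) else 0) * (z c * α ^ (j * c)) else 0 := by
      intro c _
      rw [coeff_ofCoeffs]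
      split <;> simp
    rw [sum_congr rfl h3, sum_congr rfl h4, ← sum_filter, ← sum_filter]
    congr 1
    ext c
    simp only [mem_filter, mem_range]; omega
  have h3 : ∀ y w, dot P.U (agreeRow P α e y w) z =
      (ofCoeffs (P.d + 1) z).eval (α ^ (y / P.ℓ * P.s + w)) - z (P.d + 1) * e (y * P.s + w) := by
    intro y w
    rw [dot, sum_range_support hd2 (fun u h1 h2 => by rw [hz u h1 h2, mul_zero]), agreeRow,
      if_pos rfl,
      eval_ofCoeffs, sub_eq_add_neg]
    congr 1
    · refine sum_congr rfl fun c hc => ?_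
      rw [mem_range] at hc
      rw [agreeRow, if_neg (by omega), pow_mul]; ring
    · ring
  have hdeg : (z (P.d + 1) • inhom P Q + homog P α Q (ofCoeffs (P.d + 1) z)).natDegree < P.H := by
    refine lt_of_le_of_lt (natDegree_add_le _ _) (max_lt ?_ (natDegree_homog_lt h ?_))
    · exact (natDegree_smul_le _ _).trans_lt (natDegree_inhom_lt h Q)
    · exact Nat.lt_succ_iff.1 (natDegree_ofCoeffs_lt (Nat.succ_pos _) z)
  constructor
  · rintro ⟨-, hW⟩
    refine ⟨?_, fun i hi w hw => ?_⟩
    · ext k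
      rw [coeff_zero]
      by_cases hk : k < P.H
      · rw [← h2 k hk]
        exact hW _ (Or.inl ⟨k, hk, rfl⟩)
      · exact coeff_eq_zero_of_natDegree_lt (by omega)
    · have := hW _ (Or.inr ⟨(i, w), ⟨hi, hw⟩, rfl⟩)
      rw [h3] at this
      exact sub_eq_zero.1 this
  · rintro ⟨h4, h5⟩
    refine ⟨hz, ?_⟩
    rintro w (⟨k, hk, rfl⟩ | ⟨⟨i, w⟩, ⟨hi, hw⟩, rfl⟩)
    · rw [h2 k hk, h4, coeff_zero]
    · rw [h3, h5 i hi w hw, sub_self]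

/-- The polynomials vanishing on the column of the input word `y`. -/
noncomputable def vanish (P : Par) (α : F) (y : ℕ) : Submodule F F[X] where
  carrier := {p | ∀ w < P.s, p.eval (α ^ (y / P.ℓ * P.s + w)) = 0}
  add_mem' := fun {p q} hp hq w hw => by rw [eval_add, hp w hw, hq w hw, add_zero]
  zero_mem' := fun w _ => eval_zero
  smul_mem' := fun c p hp w hw => by rw [eval_smul, hp w hw, smul_zero]

/-- The input words with which the codeword of `p` agrees. -/
noncomputable def agreeWords (P : Par) (α : F) (e : ℕ → F) (p : F[X]) : Finset ℕ := by
  classical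
  exact (range P.K).filter fun y => ∀ w < P.s,
    p.eval (α ^ (y / P.ℓ * P.s + w)) = e (y * P.s + w)

theorem mem_agreeWords {p : F[X]} {y : ℕ} : y ∈ agreeWords P α e p ↔
    y < P.K ∧ ∀ w < P.s, p.eval (α ^ (y / P.ℓ * P.s + w)) = e (y * P.s + w) := by
  classical
  simp [agreeWords]

/-- The trial with the number `x` chooses agreements of `p` only, and no other solution has all of
them. -/
def IsGood (P : Par) (α : F) (e Q : ℕ → F) (p : F[X]) (x : ℕ) : Prop :=
  (∀ i < P.m, x / P.K ^ i % P.K ∈ agreeWords P α e p) ∧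
  ∀ r ∈ solSpace P α Q, (∀ i < P.m, r ∈ vanish P α (x / P.K ^ i % P.K)) → r = 0

/-- A good trial determines the codeword of `p`: if `z` is a nonzero solution with factor `t`, then
its polynomial differs from `t p` by an element of the solution space that vanishes on all chosen
columns, and so is `t p`; in particular `t` is not zero. -/
theorem IsGood.determines (h : P.Num α) (hinv : ∀ t : F, t ≠ 0 → t ^ (P.q - 2) = t⁻¹)
    {p : F[X]} (hp : p.natDegree ≤ P.d) (hpQ : inhom P Q + homog P α Q p = 0) {x : ℕ}
    (hx : IsGood P α e Q p x) : Determines P α e Q x (fun l => p.eval (α ^ l)) := by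
  have hd2 := h.ok.d2
  constructor
  · set v : ℕ → F := fun u => if u = P.d + 1 then 1 else p.coeff u with hv
    have hvp : ofCoeffs (P.d + 1) v = p := by
      rw [← ofCoeffs_coeff hp]
      refine sum_congr rfl fun c hc => ?_
      rw [mem_range] at hc
      rw [hv]; beta_reduce; rw [if_neg (by omega)]
    have hv1 : v (P.d + 1) = 1 := if_pos rfl
    refine ⟨v, (isSol_trialCons_iff h ?_).2 ⟨?_, ?_⟩, P.d + 1, by omega,
      by rw [hv1]; exact one_ne_zero⟩
    · intro u _ hu
      rw [hv]; beta_reduce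
      rw [if_neg (by omega), coeff_eq_zero_of_natDegree_lt (by omega)]
    · rw [hv1, hvp, one_smul]; exact hpQ
    · intro i hi w hw
      rw [hv1, hvp, one_mul]
      exact (mem_agreeWords.1 (hx.1 i hi)).2 w hw
  · intro z hz hne l _
    set t := z (P.d + 1) with ht
    set r := ofCoeffs (P.d + 1) z with hr
    obtain ⟨h1, h2⟩ := (isSol_trialCons_iff h hz.1).1 hz
    have hrd : r.natDegree ≤ P.d := Nat.lt_succ_iff.1 (natDegree_ofCoeffs_lt (Nat.succ_pos _) z)
    have hpQ' : inhom P Q = -homog P α Q p := eq_neg_of_add_eq_zero_left hpQ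
    have h3 : r - t • p = 0 := by
      refine hx.2 _ (mem_solSpace.2 ⟨?_, ?_⟩) ?_
      · exact (natDegree_sub_le _ _).trans (max_le hrd ((natDegree_smul_le _ _).trans hp))
      · rw [map_sub, map_smul, ← h1, hpQ', smul_neg]
        ring
      · intro i hi w hw
        rw [eval_sub, eval_smul, h2 i hi w hw, (mem_agreeWords.1 (hx.1 i hi)).2 w hw, smul_eq_mul,
          sub_self]
    have h4 : r = t • p := sub_eq_zero.1 h3
    have ht0 : t ≠ 0 := by
      intro h0
      rw [h0, zero_smul] at h4
      obtain ⟨u, hu, hzu⟩ := hne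
      refine hzu ?_
      obtain h5 | rfl | h5 : u < P.d + 1 ∨ u = P.d + 1 ∨ P.d + 2 ≤ u := by omega
      · have : r.coeff u = 0 := by rw [h4, coeff_zero]
        rwa [hr, coeff_ofCoeffs, if_pos h5] at this
      · exact h0
      · exact hz.1 u hu h5
    have h5 : wordVal P α z l = t⁻¹ * r.eval (α ^ l) := by
      rw [wordVal, ← ht, hinv t ht0, hr, eval_ofCoeffs, mul_sum]
      refine sum_congr rfl fun c _ => ?_
      rw [pow_mul]; ring
    rw [h5, h4, eval_smul, smul_eq_mul, ← mul_assoc, inv_mul_cancel₀ ht0, one_mul]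

end RAM

/-! ### Counting good trials -/

namespace RAM

open Finset Polynomial

variable {F : Type*} [Field F] {P : Par} {α : F} {e Q : ℕ → F}

/-- The number of tuples of `r` digits in base `K` from `A` that cut a space `V` of dimension at
most `r` down to zero. As long as the space is not zero, at
least `g / s` choices of the next digit lower the dimension. -/
theorem pow_le_card_cut {M : Type*} [AddCommGroup M] [Module F M] {K s g : ℕ} {A : Finset ℕ}
    (W : ℕ → Submodule F M) (hA : ∀ y ∈ A, y < K) (hg : g ≤ s * #A) (r : ℕ) :
    ∀ (V : Submodule F M) [FiniteDimensional F V], Module.finrank F V ≤ r →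
    (∀ h ∈ V, h ≠ 0 → ∃ B ⊆ A, g ≤ s * #B ∧ ∀ y ∈ B, h ∉ W y) →
    ∃ G : Finset ℕ, g ^ r ≤ s ^ r * #G ∧ ∀ x ∈ G, x < K ^ r ∧ (∀ i < r, x / K ^ i % K ∈ A) ∧
      ∀ h ∈ V, (∀ i < r, h ∈ W (x / K ^ i % K)) → h = 0 := by
  classical
  induction r with
  | zero =>
    intro V _ hV _
    have h0 : V = ⊥ := Submodule.finrank_eq_zero.1 (Nat.le_zero.1 hV)
    refine ⟨{0}, by simp, fun x hx => ?_⟩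
    rw [mem_singleton.1 hx]
    exact ⟨by simp, fun i hi => absurd hi (Nat.not_lt_zero i),
      fun h hh _ => (Submodule.mem_bot F).1 (h0 ▸ hh)⟩
  | succ r ih =>
    intro V _ hV hB
    obtain ⟨Y, hYA, hYg, hY⟩ : ∃ Y ⊆ A, g ≤ s * #Y ∧
        ∀ y ∈ Y, Module.finrank F (V ⊓ W y : Submodule F M) ≤ r := by
      by_cases h0 : V = ⊥
      · exact ⟨A, subset_rfl, hg, fun y _ => by rw [h0, bot_inf_eq]; simp⟩
      · obtain ⟨h, hh, hne⟩ := Submodule.exists_mem_ne_zero_of_ne_bot h0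
        obtain ⟨B, hBA, hBg, hBW⟩ := hB h hh hne
        refine ⟨B, hBA, hBg, fun y hy => Nat.lt_succ_iff.1 (lt_of_lt_of_le ?_ hV)⟩
        refine Submodule.finrank_lt_finrank_of_lt (lt_of_le_of_ne inf_le_left fun heq => ?_)
        rw [← heq] at hh
        exact hBW y hy hh.2
    -- `V ⊓ W y` satisfies the hypotheses with `r` in place of `r + 1`.
    have hex : ∀ y, ∃ G : Finset ℕ, y ∈ Y → g ^ r ≤ s ^ r * #G ∧ ∀ x ∈ G, x < K ^ r ∧
        (∀ i < r, x / K ^ i % K ∈ A) ∧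
        ∀ h ∈ V ⊓ W y, (∀ i < r, h ∈ W (x / K ^ i % K)) → h = 0 := by
      intro y
      by_cases hy : y ∈ Y
      · have : FiniteDimensional F (V ⊓ W y : Submodule F M) :=
          Submodule.finiteDimensional_of_le (S₂ := V) inf_le_left
        obtain ⟨G, hG⟩ := ih (V ⊓ W y) (hY y hy) fun h hh => hB h hh.1
        exact ⟨G, fun _ => hG⟩
      · exact ⟨∅, fun h => absurd h hy⟩
    choose G hG using hex
    have hK : ∀ y ∈ Y, y < K := fun y hy => hA y (hYA hy)
    refine ⟨(Y.sigma G).image fun z => z.1 + K * z.2, ?_, ?_⟩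
    · rw [card_image_of_injOn, card_sigma]
      · calc g ^ (r + 1) = g * g ^ r := pow_succ' g r
          _ ≤ s * #Y * g ^ r := Nat.mul_le_mul_right _ hYg
          _ = s * ∑ y ∈ Y, g ^ r := by rw [sum_const, smul_eq_mul, mul_assoc]
          _ ≤ s * ∑ y ∈ Y, s ^ r * #(G y) :=
            Nat.mul_le_mul_left _ (sum_le_sum fun y hy => (hG y hy).1)
          _ = s ^ (r + 1) * ∑ y ∈ Y, #(G y) := by rw [← mul_sum]; ring
      · rintro ⟨y, x⟩ hyx ⟨y', x'⟩ hyx' heq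
        have h1 := hK y (mem_sigma.1 hyx).1
        have h2 := hK y' (mem_sigma.1 hyx').1
        simp only at heq
        have e1 := congrArg (· % K) heq
        have e2 := congrArg (· / K) heq
        have hK0 : 0 < K := by omega
        simp only [Nat.add_mul_mod_self_left, Nat.mod_eq_of_lt h1, Nat.mod_eq_of_lt h2] at e1
        simp only [Nat.add_mul_div_left _ _ hK0, Nat.div_eq_of_lt h1, Nat.div_eq_of_lt h2,
          zero_add] at e2
        rw [e1, e2]
    · intro z hz
      obtain ⟨⟨y, x⟩, hyx, rfl⟩ := mem_image.1 hz
      obtain ⟨hy, hx⟩ := mem_sigma.1 hyx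
      simp only at hy hx ⊢
      have h1 := hK y hy
      have hK0 : 0 < K := by omega
      obtain ⟨hxK, hxA, hxV⟩ := (hG y hy).2 x hx
      have d0 : (y + K * x) / K ^ 0 % K = y := by
        rw [pow_zero, Nat.div_one, Nat.add_mul_mod_self_left, Nat.mod_eq_of_lt h1]
      have d1 : ∀ i, (y + K * x) / K ^ (i + 1) % K = x / K ^ i % K := by
        intro i
        rw [pow_succ', ← Nat.div_div_eq_div_mul, Nat.add_mul_div_left _ _ hK0,
          Nat.div_eq_of_lt h1, zero_add]
      refine ⟨?_, ?_, ?_⟩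
      · rw [pow_succ']; nlinarith
      · rintro (_ | i) hi
        · rw [d0]; exact hYA hy
        · rw [d1]; exact hxA i (by omega)
      · intro h hh hW
        refine hxV h ⟨hh, ?_⟩ fun i hi => ?_
        · have := hW 0 (by omega)
          rwa [d0] at this
        · have := hW (i + 1) (by omega)
          rwa [d1] at this

/-- For a message polynomial `p`, a word in each column in which its codeword agrees with the
lists. -/
theorem exists_agreeWord (h : P.Num α) {p : F[X]} : ∃ y : ℕ → ℕ, ∀ i ∈ agreeCols P α e p,
    y i ∈ agreeWords P α e p ∧ y i / P.ℓ = i := by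
  classical
  have : ∀ i, ∃ y, i ∈ agreeCols P α e p → y ∈ agreeWords P α e p ∧ y / P.ℓ = i := by
    intro i
    by_cases hi : i ∈ agreeCols P α e p
    · obtain ⟨hin, j, hj, hij⟩ := mem_agreeCols.1 hi
      refine ⟨i * P.ℓ + j, fun _ => ⟨mem_agreeWords.2 ⟨?_, ?_⟩, idx_div hj⟩⟩
      · rw [h.ok.hK]; exact idx_lt hin hj
      · rw [idx_div hj]; exact hij
    · exact ⟨0, fun h => absurd h hi⟩
  choose y hy using this
  exact ⟨y, hy⟩

/-- Every message has many good trials. A nonzero element of the solution space vanishes on at most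
`d / s` columns, and so distinguishes at least `g / s` of the agreements of `p`. -/
theorem exists_good (h : P.Num α) (hQ : ∃ u < P.U, Q u ≠ 0) {p : F[X]} (hp : IsMsg P α e p)
    (hpQ : inhom P Q + homog P α Q p = 0) :
    ∃ G : Finset ℕ, P.g ^ P.m ≤ P.s ^ P.m * #G ∧
      ∀ x ∈ G, x < P.K ^ P.m ∧ IsGood P α e Q p x := by
  classical
  obtain ⟨y, hy⟩ := exists_agreeWord (e := e) h (p := p)
  have hyi : Set.InjOn y (agreeCols P α e p) := fun i hi j hj hij => by
    rw [← (hy i hi).2, hij, (hy j hj).2]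
  have hcard : ∀ I ⊆ agreeCols P α e p, #(I.image y) = #I := fun I hI =>
    card_image_of_injOn (hyi.mono (coe_subset.2 hI))
  have hg := h.hg
  refine pow_le_card_cut (vanish P α) (fun y hy => (mem_agreeWords.1 hy).1) ?_ P.m
    (solSpace P α Q) (finrank_solSpace_lt h (exists_coeff_ne h hQ hpQ)).le ?_
  · have h1 : #(agreeCols P α e p) ≤ #(agreeWords P α e p) := by
      rw [← hcard _ subset_rfl]
      exact card_le_card (image_subset_iff.2 fun i hi => (hy i hi).1)
    have h2 := Nat.mul_le_mul_left P.s (hp.2.trans h1)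
    rw [mul_comm P.s P.a] at h2
    omega
  · intro r hr hne
    set I := (agreeCols P α e p).filter fun i => r ∈ vanish P α (y i) with hI
    refine ⟨(agreeCols P α e p \ I).image y,
      image_subset_iff.2 fun i hi => (hy i (mem_sdiff.1 hi).1).1, ?_, ?_⟩
    · have h1 : #I * P.s ≤ P.d := by
        by_contra hcon
        refine hne (eq_zero_of_columns h (I := I) (r := P.s)
          (fun i hi => (mem_agreeCols.1 (mem_filter.1 hi).1).1) le_rfl ?_ ?_)
        · intro i hi t ht
          have := (mem_filter.1 hi).2 t ht
          rwa [(hy i (mem_filter.1 hi).1).2] at this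
        · have := (mem_solSpace.1 hr).1
          omega
      rw [hcard _ sdiff_subset, card_sdiff_of_subset (filter_subset _ _), Nat.mul_sub, ← hI]
      have h2 := Nat.mul_le_mul_left P.s hp.2
      rw [mul_comm P.s P.a] at h2
      rw [mul_comm] at h1
      omega
    · intro z hz
      obtain ⟨i, hi, rfl⟩ := mem_image.1 hz
      rw [mem_sdiff] at hi
      exact fun hcon => hi.2 (mem_filter.2 ⟨hi.1, hcon⟩)

/-- A trial is good for at most one message. -/
theorem IsGood.unique {p p' : F[X]} (hp : p.natDegree ≤ P.d) (hp' : p'.natDegree ≤ P.d)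
    (hpQ : inhom P Q + homog P α Q p = 0) (hpQ' : inhom P Q + homog P α Q p' = 0) {x : ℕ}
    (hx : IsGood P α e Q p x) (hx' : IsGood P α e Q p' x) : p = p' := by
  refine sub_eq_zero.1 (hx.2 _ (mem_solSpace.2 ⟨?_, ?_⟩) fun i hi w hw => ?_)
  · exact (natDegree_sub_le _ _).trans (max_le hp hp')
  · rw [map_sub, sub_eq_zero]
    exact add_left_cancel (hpQ.trans hpQ'.symm)
  · rw [eval_sub, (mem_agreeWords.1 (hx.1 i hi)).2 w hw, (mem_agreeWords.1 (hx'.1 i hi)).2 w hw,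
      sub_self]

/-- The bound on the list size: different messages have different good trials. -/
theorem card_msg_mul_le (h : P.Num α) {T : Finset F[X]} (hT : ∀ p ∈ T, IsMsg P α e p) :
    #T * P.g ^ P.m ≤ (P.K * P.s) ^ P.m := by
  classical
  obtain ⟨Q, hQ, hQ0⟩ := exists_interp h e
  have hpQ : ∀ p ∈ T, inhom P Q + homog P α Q p = 0 := fun p hp => (hT p hp).interp h hQ
  have hex : ∀ p, ∃ G : Finset ℕ, p ∈ T → P.g ^ P.m ≤ P.s ^ P.m * #G ∧
      ∀ x ∈ G, x < P.K ^ P.m ∧ IsGood P α e Q p x := by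
    intro p
    by_cases hp : p ∈ T
    · obtain ⟨G, hG⟩ := exists_good h hQ0 (hT p hp) (hpQ p hp)
      exact ⟨G, fun _ => hG⟩
    · exact ⟨∅, fun h => absurd h hp⟩
  choose G hG using hex
  have hU : #(T.biUnion G) = ∑ p ∈ T, #(G p) := card_biUnion fun p hp p' hp' hne =>
    disjoint_left.2 fun x hx hx' => hne (IsGood.unique (hT p hp).1 (hT p' hp').1 (hpQ p hp)
      (hpQ p' hp') ((hG p hp).2 x hx).2 ((hG p' hp').2 x hx').2)
  have hle : #(T.biUnion G) ≤ P.K ^ P.m := by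
    rw [← card_range (P.K ^ P.m)]
    refine card_le_card fun x hx => ?_
    obtain ⟨p, hp, hx⟩ := mem_biUnion.1 hx
    exact mem_range.2 ((hG p hp).2 x hx).1
  calc #T * P.g ^ P.m = ∑ p ∈ T, P.g ^ P.m := by rw [sum_const, smul_eq_mul]
    _ ≤ ∑ p ∈ T, P.s ^ P.m * #(G p) := sum_le_sum fun p hp => (hG p hp).1
    _ = P.s ^ P.m * #(T.biUnion G) := by rw [← mul_sum, hU]
    _ ≤ P.s ^ P.m * P.K ^ P.m := Nat.mul_le_mul_left _ hle
    _ = (P.K * P.s) ^ P.m := by rw [mul_pow, mul_comm]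

end RAM

/-! ### Coin flips -/

namespace RAM

open Finset MeasureTheory

theorem coinNum_inj {ω ω' : ℕ → Bool} {J : ℕ} (h : coinNum ω J = coinNum ω' J) :
    ∀ i < J, ω i = ω' i := by
  induction J with
  | zero => intro i hi; omega
  | succ J ih =>
    simp only [coinNum] at h
    have h1 := Bool.toNat_lt (ω J)
    have h2 := Bool.toNat_lt (ω' J)
    intro i hi
    obtain hi | rfl : i < J ∨ i = J := by omega
    · exact ih (by omega) i hi
    · have h3 : (ω i).toNat = (ω' i).toNat := by omega
      revert h3
      cases ω i <;> cases ω' i <;> simp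

theorem coinNum_lt (ω : ℕ → Bool) (J : ℕ) : coinNum ω J < 2 ^ J := by
  induction J with
  | zero => simp [coinNum]
  | succ J ih =>
    have h1 := Bool.toNat_lt (ω J)
    rw [coinNum, pow_succ]; omega

instance : IsProbabilityMeasure coins := by unfold coins; infer_instance

/-- The number made up by the coins is uniformly distributed. The upper bound is all that is needed.
-/
theorem coins_coinNum_eq (J z : ℕ) : coins {ω | coinNum ω J = z} ≤ (2⁻¹ : ENNReal) ^ J := by
  obtain h | ⟨ω₀, h₀⟩ := Set.eq_empty_or_nonempty {ω | coinNum ω J = z}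
  · rw [h]; simp
  · refine (measure_mono (t := Set.pi (range J) fun i => {ω₀ i}) fun ω hω i hi => ?_).trans ?_
    · exact coinNum_inj (Eq.trans hω h₀.symm) i (mem_range.1 hi)
    · rw [coins, Measure.infinitePi_pi _ fun i _ => MeasurableSet.singleton _]
      simp

theorem coins_coinNum_mem (J : ℕ) (B : Finset ℕ) :
    coins.real {ω | coinNum ω J ∈ B} ≤ #B * (1 / 2 : ℝ) ^ J := by
  have h1 : {ω | coinNum ω J ∈ B} = ⋃ z ∈ B, {ω | coinNum ω J = z} := by ext; simp
  rw [h1]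
  refine (measureReal_biUnion_finset_le _ _).trans ?_
  rw [← nsmul_eq_mul, ← sum_const]
  refine sum_le_sum fun z _ => ?_
  rw [measureReal_def]
  refine (ENNReal.toReal_mono (by simp) (coins_coinNum_eq J z)).trans ?_
  simp

/-- The number of those `Y` whose last `N` digits in base `M` avoid `G`. -/
theorem card_avoid_le {M : ℕ} (hM : 0 < M) {G : Finset ℕ} (hG : G ⊆ range M) (t N : ℕ) :
    #((range (M ^ N * t)).filter fun Y => ∀ i < N, Y / M ^ i % M ∉ G) ≤ (M - #G) ^ N * t := by
  induction N with
  | zero => simp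
  | succ N ih =>
    have h1 : #(range M \ G) = M - #G := by rw [card_sdiff_of_subset hG, card_range]
    rw [pow_succ' (M - #G), mul_assoc]
    refine le_trans ?_ (Nat.mul_le_mul_left (M - #G) ih)
    rw [← h1, ← card_product]
    refine card_le_card_of_injOn (fun Y => (Y % M, Y / M)) (fun Y hY => ?_) ?_
    · simp only [coe_filter, mem_range, Set.mem_ofPred_eq] at hY
      simp only [coe_product, Set.mem_prod, mem_coe, mem_sdiff, mem_range, mem_filter]
      refine ⟨⟨Nat.mod_lt _ hM, ?_⟩, ?_, fun i hi => ?_⟩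
      · simpa using hY.2 0 (by omega)
      · refine Nat.div_lt_of_lt_mul ?_
        rw [← mul_assoc, ← pow_succ']; exact hY.1
      · rw [Nat.div_div_eq_div_mul, ← pow_succ']
        exact hY.2 (i + 1) (by omega)
    · intro Y _ Y' _ h
      simp only [Prod.mk.injEq] at h
      rw [← Nat.div_add_mod Y M, h.1, h.2, Nat.div_add_mod]

/-- If each `G i` contains at least one in `M₀` numbers below `M`, then `N` digits in base `M` of a
random number are likely to hit all `G i`. -/
theorem coins_avoid_le {ι : Type*} {M M₀ N J κ : ℕ} (hM : 0 < M) (hJ : M ^ N ≤ 2 ^ J)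
    (hN : N = M₀ * (M₀ + κ + 1)) {T : Finset ι} (hT : #T ≤ M₀) (G : ι → Finset ℕ)
    (hGM : ∀ i ∈ T, G i ⊆ range M) (hG : ∀ i ∈ T, M ≤ M₀ * #(G i)) :
    coins.real {ω | ∃ i ∈ T, ∀ k < N, coinNum ω J / M ^ k % M ∉ G i} ≤ (1 / 2 : ℝ) ^ κ := by
  have h1 : {ω | ∃ i ∈ T, ∀ k < N, coinNum ω J / M ^ k % M ∉ G i} =
      ⋃ i ∈ T, {ω | ∀ k < N, coinNum ω J / M ^ k % M ∉ G i} := by ext; simp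
  have hone : ∀ i ∈ T, coins.real {ω | ∀ k < N, coinNum ω J / M ^ k % M ∉ G i} ≤
      2 * Real.exp (-(M₀ + κ + 1 : ℝ)) := by
    intro i hi
    -- The range of the random number is extended to a multiple of `M ^ N`, on which the digits are
    -- independent and uniform. It is at most doubled.
    set t := 2 ^ J / M ^ N + 1 with ht
    have hMN : 0 < M ^ N := pow_pos hM N
    have ht1 : 2 ^ J < M ^ N * t := by
      rw [ht, mul_add_one]; have := Nat.div_add_mod (2 ^ J) (M ^ N)
      have := Nat.mod_lt (2 ^ J) hMN
      omega
    have ht2 : M ^ N * t ≤ 2 * 2 ^ J := by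
      rw [ht, mul_add_one]
      have := Nat.mul_div_le (2 ^ J) (M ^ N)
      omega
    have ht3 : (M ^ N * t : ℝ) ≤ 2 * 2 ^ J := by exact_mod_cast ht2
    have h2 : {ω | ∀ k < N, coinNum ω J / M ^ k % M ∉ G i} ⊆ {ω | coinNum ω J ∈
        (range (M ^ N * t)).filter fun Y => ∀ k < N, Y / M ^ k % M ∉ G i} := by
      intro ω hω
      refine mem_filter.2 ⟨mem_range.2 ((coinNum_lt ω J).trans ht1), hω⟩
    refine (measureReal_mono h2).trans ((coins_coinNum_mem J _).trans ?_)
    have h3 := card_avoid_le hM (hGM i hi) t N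
    have hGc : #(G i) ≤ M := by simpa using card_le_card (hGM i hi)
    have hM' : (0 : ℝ) < M := by exact_mod_cast hM
    have h4 : ((M - #(G i) : ℕ) : ℝ) ≤ M * Real.exp (-(#(G i) / M : ℝ)) := by
      rw [Nat.cast_sub hGc]
      have := Real.add_one_le_exp (-(#(G i) / M : ℝ))
      have := mul_le_mul_of_nonneg_left this hM'.le
      refine le_trans (le_of_eq ?_) this
      field_simp
      ring
    have h5 : (M₀ + κ + 1 : ℝ) ≤ N * (#(G i) / M) := by
      have : (M : ℝ) ≤ M₀ * #(G i) := by exact_mod_cast hG i hi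
      rw [hN, mul_div_assoc', le_div_iff₀ hM']
      push_cast
      have h0 : (0 : ℝ) ≤ M₀ + κ + 1 := by positivity
      nlinarith
    calc (#((range (M ^ N * t)).filter fun Y => ∀ k < N, Y / M ^ k % M ∉ G i) : ℝ) * (1 / 2) ^ J
        ≤ ((M - #(G i) : ℕ) : ℝ) ^ N * t * (1 / 2) ^ J := by
          gcongr; exact_mod_cast h3
      _ ≤ (M * Real.exp (-(#(G i) / M : ℝ))) ^ N * t * (1 / 2) ^ J := by gcongr
      _ = (M ^ N * t : ℝ) * (1 / 2) ^ J * Real.exp (-(N * (#(G i) / M) : ℝ)) := by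
          rw [mul_pow, ← Real.exp_nat_mul]; ring_nf
      _ ≤ (2 * 2 ^ J : ℝ) * (1 / 2) ^ J * Real.exp (-(M₀ + κ + 1 : ℝ)) := by
          exact mul_le_mul (mul_le_mul_of_nonneg_right ht3 (by positivity))
            (Real.exp_le_exp.2 (by linarith)) (by positivity) (by positivity)
      _ = _ := by
          rw [mul_assoc 2, ← mul_pow]; norm_num
  rw [h1]
  refine (measureReal_biUnion_finset_le _ _).trans ((sum_le_sum hone).trans ?_)
  rw [sum_const, nsmul_eq_mul]
  -- In the union bound, the number of messages is offset by the summand `M₀` in the exponent.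
  have h6 : (#T : ℝ) ≤ Real.exp M₀ := by
    have : (#T : ℝ) ≤ M₀ := by exact_mod_cast hT
    have := Real.add_one_le_exp (M₀ : ℝ)
    linarith
  have h7 : Real.exp (-(κ + 1 : ℝ)) ≤ (1 / 2) ^ (κ + 1) := by
    have : Real.exp (-(κ + 1 : ℝ)) = Real.exp (-1) ^ (κ + 1) := by
      rw [← Real.exp_nat_mul]; push_cast; ring_nf
    rw [this]
    gcongr
    have := Real.exp_neg_one_lt_half
    linarith
  calc (#T : ℝ) * (2 * Real.exp (-(M₀ + κ + 1 : ℝ)))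
      ≤ Real.exp M₀ * (2 * Real.exp (-(M₀ + κ + 1 : ℝ))) := by gcongr
    _ = 2 * Real.exp (-(κ + 1 : ℝ)) := by
        rw [show (-(M₀ + κ + 1 : ℝ)) = -M₀ + -(κ + 1) by ring, Real.exp_add, Real.exp_neg]
        field_simp
    _ ≤ 2 * (1 / 2) ^ (κ + 1) := by gcongr
    _ = _ := by rw [pow_succ]; ring

section

open Polynomial

variable {F : Type*} [Field F] {P : Par} {α : F} {e Q : ℕ → F}

/-- Only the last `m` digits of the number of a trial matter. -/
theorem isGood_mod {p : F[X]} {x : ℕ} :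
    IsGood P α e Q p (x % P.K ^ P.m) ↔ IsGood P α e Q p x := by
  have : ∀ i < P.m, x % P.K ^ P.m / P.K ^ i % P.K = x / P.K ^ i % P.K := by
    intro i hi
    obtain ⟨r, hr⟩ : ∃ r, P.m = i + (1 + r) := ⟨P.m - i - 1, by omega⟩
    rw [hr, pow_add, pow_add, pow_one, Nat.mod_mul_right_div_self, Nat.mod_mul_right_mod]
  rw [IsGood, IsGood]
  refine and_congr (forall₂_congr fun i hi => by rw [this i hi])
    (forall₂_congr fun r _ => imp_congr_left (forall₂_congr fun i hi => by rw [this i hi]))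

/-- The conditions on the number of trials and coins. There are enough coins, as `K ≤ 2 ^ K`. -/
structure Par.Rand (P : Par) : Prop where
  hM0 : P.M0 = (P.ℓ * P.ns) ^ P.m / P.g ^ P.m + 1
  hN : P.N = P.M0 * (P.M0 + P.κ + 1)
  hJ : P.J = P.K * P.m * P.N

theorem finite_msg (h : P.Num α) (e : ℕ → F) : {p : F[X] | IsMsg P α e p}.Finite := by
  by_contra hcon
  obtain ⟨T, hT, hc⟩ := Set.Infinite.exists_subset_card_eq hcon ((P.K * P.s) ^ P.m + 1)
  have h1 := card_msg_mul_le h (T := T) fun p hp => hT hp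
  have h2 := Nat.mul_le_mul_left #T (Nat.one_le_pow P.m _ h.hgpos)
  omega

/-- With high probability, every message has a good trial. -/
theorem coins_bad_le (h : P.Num α) (hR : P.Rand) (hQ : IsSol P.U P.U (interpCons P α e) Q)
    (hQ0 : ∃ u < P.U, Q u ≠ 0) :
    coins.real {ω | ∃ p, IsMsg P α e p ∧
      ∀ i < P.N, ¬ IsGood P α e Q p (coinNum ω P.J / P.K ^ (P.m * i))} ≤ (1 / 2 : ℝ) ^ P.κ := by
  classical
  have hgm : 0 < P.g ^ P.m := pow_pos h.hgpos _
  have hs : 0 < P.s := by have := h.ok.hm; have := h.ok.hms; omega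
  have hKs : P.ℓ * P.ns = P.K * P.s := by rw [h.ok.hns, h.ok.hK]; ring
  have hM0 : (P.K * P.s) ^ P.m ≤ P.M0 * P.g ^ P.m := by
    have h1 := Nat.div_add_mod ((P.ℓ * P.ns) ^ P.m) (P.g ^ P.m)
    have h2 := Nat.mod_lt ((P.ℓ * P.ns) ^ P.m) hgm
    rw [hR.hM0, ← hKs, Nat.succ_mul, mul_comm (_ / _)]; omega
  have hex : ∀ p, ∃ G : Finset ℕ, IsMsg P α e p → P.g ^ P.m ≤ P.s ^ P.m * #G ∧
      ∀ x ∈ G, x < P.K ^ P.m ∧ IsGood P α e Q p x := by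
    intro p
    by_cases hp : IsMsg P α e p
    · obtain ⟨G, hG⟩ := exists_good h hQ0 hp (hp.interp h hQ)
      exact ⟨G, fun _ => hG⟩
    · exact ⟨∅, fun h => absurd h hp⟩
  choose G hG using hex
  set T := (finite_msg h e).toFinset with hT
  have hTm : ∀ p ∈ T, IsMsg P α e p := fun p hp => by rw [hT] at hp; simpa using hp
  have hK : 0 < P.K := by rw [h.ok.hK]; exact Nat.mul_pos h.ok.hn h.ok.hℓ
  have key := coins_avoid_le (M := P.K ^ P.m) (J := P.J) (pow_pos hK _) ?_ hR.hN (T := T) ?_ G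
    (fun p hp x hx => mem_range.2 ((hG p (hTm p hp)).2 x hx).1) ?_
  · refine (measureReal_mono ?_).trans key
    rintro ω ⟨p, hp, hbad⟩
    refine ⟨p, by simpa [hT] using hp, fun k hk hmem => hbad k hk ?_⟩
    have := ((hG p hp).2 _ hmem).2
    rwa [isGood_mod, ← pow_mul] at this
  · rw [hR.hJ, ← pow_mul, mul_assoc, pow_mul 2]
    exact Nat.pow_le_pow_left Nat.lt_two_pow_self.le _
  · have h1 := card_msg_mul_le h hTm
    exact Nat.le_of_mul_le_mul_right (h1.trans hM0) hgm
  · intro p hp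
    have h1 := (hG p (hTm p hp)).1
    refine Nat.le_of_mul_le_mul_right (c := P.s ^ P.m) ?_ (pow_pos hs _)
    rw [← mul_pow]
    refine hM0.trans ((Nat.mul_le_mul_left _ h1).trans (le_of_eq ?_))
    ring

end

end RAM

/-! ### The choice of the parameters -/

namespace RAM

/-- The parameters as they are computed from the input. -/
structure Par.Std (P : Par) : Prop where
  ha : P.a = P.n - P.e
  hg : P.g = P.a * P.s - P.d
  hns : P.ns = P.n * P.s
  hK : P.K = P.n * P.ℓ
  hm : P.m = 2 * P.ℓ * P.ns / P.g
  hsm : P.sm = P.s + 1 - P.m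
  hD1 : P.D1 = P.K * P.sm / (P.m + 1) + 1
  hH : P.H = P.D1 + P.d
  hU : P.U = P.m * P.D1 + P.H
  hE : P.E = P.ns * P.U
  hq : P.q = P.p ^ P.k
  hlg : P.lg = P.f.size
  hM0 : P.M0 = (P.ℓ * P.ns) ^ P.m / P.g ^ P.m + 1
  hN : P.N = P.M0 * (P.M0 + P.κ + 1)
  hJ : P.J = P.K * P.m * P.N

theorem exists_par (p k f α s d n ℓ e κ : ℕ) : ∃ P : Par, P.Std ∧ P.p = p ∧ P.k = k ∧ P.f = f ∧
    P.α = α ∧ P.s = s ∧ P.d = d ∧ P.n = n ∧ P.ℓ = ℓ ∧ P.e = e ∧ P.κ = κ := by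
  set a := n - e with ha
  set g := a * s - d with hg
  set ns := n * s with hns
  set K := n * ℓ with hK
  set m := 2 * ℓ * ns / g with hm
  set sm := s + 1 - m with hsm
  set D1 := K * sm / (m + 1) + 1 with hD1
  set H := D1 + d with hH
  set U := m * D1 + H with hU
  set M0 := (ℓ * ns) ^ m / g ^ m + 1 with hM0
  set N := M0 * (M0 + κ + 1) with hN
  exact ⟨⟨p, k, f, α, s, d, n, ℓ, e, κ, a, g, m, D1, U, K, ns * U, f.size, N, K * m * N, sm, H, ns,
    p ^ k, M0⟩, ⟨ha, hg, hns, hK, hm, hsm, hD1, hH, hU, rfl, rfl, rfl, hM0, hN, rfl⟩,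
    rfl, rfl, rfl, rfl, rfl, rfl, rfl, rfl, rfl, rfl⟩

/-- What the hypotheses on `ε` amount to: `g = a s - d` is at least `ε n s`. -/
structure Par.Wide (P : Par) : Prop where
  hn : 0 < P.n
  hℓ : 0 < P.ℓ
  hg : 0 < P.g
  hwide : 16 * P.ℓ * P.n ^ 2 * P.s ≤ P.g ^ 2

variable {P : Par}

theorem Par.Std.g_add_d (h : P.Std) (hw : P.Wide) : P.g + P.d = P.a * P.s := by
  have := hw.hg; have := h.hg; omega

theorem Par.Std.g_le (h : P.Std) (hw : P.Wide) : P.g + P.d ≤ P.ns := by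
  rw [h.g_add_d hw, h.hns]
  exact Nat.mul_le_mul_right _ (by rw [h.ha]; exact Nat.sub_le _ _)

theorem Par.Std.m_mul_g (h : P.Std) : P.m * P.g ≤ 2 * P.ℓ * P.ns := by
  rw [h.hm]; exact Nat.div_mul_le_self _ _

theorem Par.Std.lt_m_mul_g (h : P.Std) (hw : P.Wide) : 2 * P.ℓ * P.ns < (P.m + 1) * P.g := by
  rw [h.hm, add_mul, one_mul, mul_comm (_ / _)]
  have h1 := Nat.div_add_mod (2 * P.ℓ * P.ns) P.g
  have h2 := Nat.mod_lt (2 * P.ℓ * P.ns) hw.hg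
  omega

theorem Par.Std.m_pos (h : P.Std) (hw : P.Wide) : 0 < P.m := by
  rw [h.hm]
  refine Nat.div_pos ?_ hw.hg
  have := h.g_le hw
  have := hw.hℓ
  nlinarith

/-- This makes up for the loss of `m - 1` points per column. It is here that `s` has to be at least
`16 ℓ / ε²`. -/
theorem Par.Std.m_mul_n (h : P.Std) (hw : P.Wide) : 8 * (P.m * P.n) ≤ P.g := by
  refine Nat.le_of_mul_le_mul_right (c := P.g) ?_ hw.hg
  have h1 := Nat.mul_le_mul_left (8 * P.n) h.m_mul_g
  have h2 := hw.hwide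
  rw [h.hns] at h1
  nlinarith

theorem Par.Std.m_le (h : P.Std) (hw : P.Wide) : P.m ≤ P.s := by
  have h1 := h.m_mul_n hw
  have h2 := h.g_le hw
  rw [h.hns] at h2
  have h3 : P.n * P.m ≤ P.n * P.s := by rw [mul_comm P.n P.m]; omega
  exact Nat.le_of_mul_le_mul_left h3 hw.hn

/-- With `r = ⌊n ℓ sm / (m + 1)⌋`, the number of coefficients of `A₀` is `r + 1 + d`, and there are
`a sm` zeros. Since `2 r < g`, and the loss of `m - 1` points per column amounts to at most `g / 8`,
the zeros prevail. -/
theorem Par.Std.num {F : Type*} [Field F] {α : F} (h : P.Std) (hw : P.Wide)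
    (hinj : ∀ i < P.ns, ∀ j < P.ns, α ^ i = α ^ j → i = j) : P.Num α := by
  have hm := h.m_pos hw
  have hms := h.m_le hw
  have hgle := h.g_le hw
  have hgpos := hw.hg
  refine ⟨⟨hw.hn, hm, hms, hw.hℓ, by rw [h.hD1]; exact Nat.succ_pos _, h.hsm, h.hK,
    h.hns, h.hH, h.hU, h.hE⟩,
    hinj, by omega, ?_, ?_, h.hg, hw.hg⟩
  · set r := P.K * P.sm / (P.m + 1) with hr
    have h1 : r * (P.m + 1) ≤ P.K * P.sm := Nat.div_mul_le_self _ _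
    have h2 : P.sm ≤ P.s := by have := h.hsm; omega
    have h3 : 2 * r < P.g := by
      refine Nat.lt_of_mul_lt_mul_right (a := P.m + 1) ?_
      have h4 := h.lt_m_mul_g hw
      have h5 := Nat.mul_le_mul_left P.K h2
      rw [h.hns] at h4
      rw [h.hK] at h1 h5
      nlinarith
    have h4 := h.m_mul_n hw
    have h5 : P.a * (P.m - 1) + 1 ≤ P.m * P.n := by
      obtain ⟨k, hk⟩ : ∃ k, P.m = k + 1 := ⟨P.m - 1, by omega⟩
      have h6 : P.a ≤ P.n := by rw [h.ha]; exact Nat.sub_le _ _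
      have h7 := hw.hn
      rw [hk, Nat.add_sub_cancel]
      nlinarith
    have h6 : P.a * P.sm + P.a * (P.m - 1) = P.g + P.d := by
      rw [h.g_add_d hw, ← Nat.mul_add]
      congr 1
      have := h.hsm; omega
    rw [h.hH, h.hD1, ← hr]
    omega
  · have h1 := Nat.div_add_mod (P.K * P.sm) (P.m + 1)
    have h2 := Nat.mod_lt (P.K * P.sm) (show 0 < P.m + 1 by omega)
    have h3 : (P.m + 1) * P.D1 ≤ P.U := by rw [h.hU, h.hH]; nlinarith
    refine lt_of_lt_of_le ?_ h3
    rw [h.hD1, mul_add_one]; omega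

theorem Par.Std.rand (h : P.Std) : P.Rand := ⟨h.hM0, h.hN, h.hJ⟩

/-- The relation between the parameters of the code and those of the algorithm. -/
theorem Par.Std.wide (h : P.Std) {δ ε : ℝ} (hn : 0 < P.n) (hℓ : 0 < P.ℓ) (hε : 0 < ε)
    (hδ : δ = 1 - (P.d : ℝ) / ((P.s : ℝ) * P.n)) (hs : 16 * (P.ℓ : ℝ) / ε ^ 2 ≤ P.s)
    (hεδ : ε ≤ δ) (he : P.e = ⌊(δ - ε) * P.n⌋₊) : P.Wide ∧ ε * P.ns ≤ P.g := by
  have hn' : (0 : ℝ) < P.n := by exact_mod_cast hn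
  have hℓ' : (1 : ℝ) ≤ P.ℓ := by exact_mod_cast hℓ
  have hs' : 16 * (P.ℓ : ℝ) ≤ P.s * ε ^ 2 := by rwa [div_le_iff₀ (by positivity)] at hs
  have hs0 : (0 : ℝ) < P.s := by
    by_contra hcon
    have : (P.s : ℝ) = 0 := le_antisymm (not_lt.1 hcon) (Nat.cast_nonneg _)
    rw [this] at hs'; linarith
  have he' : (P.e : ℝ) ≤ (δ - ε) * P.n := by
    rw [he]; exact Nat.floor_le (mul_nonneg (by linarith) hn'.le)
  have hδ1 : δ ≤ 1 := by
    rw [hδ]; have : 0 ≤ (P.d : ℝ) / (P.s * P.n) := by positivity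
    linarith
  have hen : P.e ≤ P.n := by
    have : (P.e : ℝ) ≤ P.n := by nlinarith
    exact_mod_cast this
  have ha : (P.a : ℝ) = P.n - P.e := by rw [h.ha, Nat.cast_sub hen]
  have h1 : (P.d : ℝ) + ε * P.ns ≤ P.a * P.s := by
    rw [ha, h.hns]
    have h2 : (P.d : ℝ) = (1 - δ) * (P.s * P.n) := by rw [hδ]; field_simp; ring
    rw [h2]
    push_cast
    nlinarith [mul_le_mul_of_nonneg_right he' hs0.le]
  have hns : (0 : ℝ) < P.ns := by rw [h.hns]; push_cast; positivity
  have hd : P.d ≤ P.a * P.s := by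
    have : (P.d : ℝ) ≤ P.a * P.s := by nlinarith [mul_pos hε hns]
    exact_mod_cast this
  have hg : ε * P.ns ≤ P.g := by
    rw [h.hg, Nat.cast_sub hd]; push_cast; linarith
  refine ⟨⟨hn, hℓ, ?_, ?_⟩, hg⟩
  · have : (0 : ℝ) < P.g := (mul_pos hε hns).trans_le hg
    exact_mod_cast this
  · have h2 : (16 * P.ℓ * P.n ^ 2 * P.s : ℝ) ≤ P.g ^ 2 := by
      calc (16 * P.ℓ * P.n ^ 2 * P.s : ℝ) ≤ P.s * ε ^ 2 * P.n ^ 2 * P.s := by gcongr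
        _ = (ε * P.ns) ^ 2 := by rw [h.hns]; push_cast; ring
        _ ≤ _ := by gcongr
    exact_mod_cast h2

/-- Lists of length `r` with `r g^m ≤ (ℓ n s)^m` are as short as claimed. -/
theorem Par.Std.le_rpow (h : P.Std) (hw : P.Wide) {ε : ℝ} (hε : 0 < ε) (hg : ε * P.ns ≤ P.g)
    {r : ℕ} (hr : r * P.g ^ P.m ≤ (P.ℓ * P.ns) ^ P.m) :
    (r : ℝ) ≤ ((P.ℓ : ℝ) / ε) ^ (4 * (P.ℓ : ℝ) / ε) := by
  have hg0 : (0 : ℝ) < P.g := by exact_mod_cast hw.hg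
  have hns : (P.g : ℝ) ≤ P.ns := by
    have := h.g_le hw
    exact_mod_cast (by omega : P.g ≤ P.ns)
  have hℓ : (1 : ℝ) ≤ P.ℓ := by exact_mod_cast hw.hℓ
  have hε1 : ε ≤ 1 := by
    by_contra hcon
    nlinarith
  have h1 : (P.ℓ * P.ns : ℝ) ≤ P.ℓ / ε * P.g := by
    rw [div_mul_eq_mul_div, le_div_iff₀ hε]; nlinarith
  have h2 : (r : ℝ) * P.g ^ P.m ≤ (P.ℓ / ε) ^ P.m * P.g ^ P.m := by
    rw [← mul_pow]
    calc (r : ℝ) * P.g ^ P.m ≤ (P.ℓ * P.ns : ℝ) ^ P.m := by exact_mod_cast hr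
      _ ≤ _ := by gcongr
  have h3 := le_of_mul_le_mul_right h2 (by positivity)
  refine h3.trans ?_
  rw [← Real.rpow_natCast]
  refine Real.rpow_le_rpow_of_exponent_le ?_ ?_
  · rw [le_div_iff₀ hε]; linarith
  · rw [le_div_iff₀ hε]
    have h4 : (P.m * P.g : ℝ) ≤ 2 * P.ℓ * P.ns := by exact_mod_cast h.m_mul_g
    have h5 : (P.m * ε : ℝ) * P.ns ≤ (2 * P.ℓ) * P.ns := by
      nlinarith [Nat.cast_nonneg (α := ℝ) P.m]
    have h6 := le_of_mul_le_mul_right h5 (by linarith)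
    linarith

theorem Par.Std.M0_le (h : P.Std) (hw : P.Wide) {ε : ℝ} (hε : 0 < ε) (hg : ε * P.ns ≤ P.g) :
    P.M0 ≤ ⌊((P.ℓ : ℝ) / ε) ^ (4 * (P.ℓ : ℝ) / ε)⌋₊ + 1 := by
  rw [h.hM0]
  refine Nat.add_le_add_right (Nat.le_floor ?_) 1
  exact h.le_rpow hw hε hg (Nat.div_mul_le_self _ _)

end RAM

/-! ### Computing the parameters -/

namespace RAM

variable {P : Par} {ω : ℕ → Bool} {σ : State}

/-- The register file after the computation of the parameters that need no loop. Register `36` is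
scratch space. -/
def Par.pre (P : Par) (x : ℕ) : ℕ :=
  [P.p, P.k, P.f, P.α, P.s, P.d, P.n, P.ℓ, P.e, P.κ, P.a, P.g, P.m, P.D1, P.U, P.K, P.E, 0,
    0, 0, P.sm, P.H, P.ns, P.k + 1, P.d + 1, 0, 0, 0, 0, P.k, 0, 0, P.p - 1,
    P.m * P.D1, P.d + 2, 0, P.ℓ * P.ns].getD x 0

/-- The register file in the beginning. -/
def Par.init (P : Par) (x : ℕ) : ℕ :=
  [P.p, P.k, P.f, P.α, P.s, P.d, P.n, P.ℓ, P.e, P.κ].getD x 0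

theorem den_deriveC (h : P.Std) (hσ : ∀ x, σ.reg x = P.init x) :
    ∀ x < 40, (deriveC.den ω σ).reg x = P.pre x := by
  intro x hx
  interval_cases x <;>
  simp only [deriveC, Cmd.den, State.set_reg, Expr.eval_add, Expr.eval_sub, Expr.eval_mul,
    Expr.eval_div, Expr.eval_reg, Expr.eval_one, Expr.eval_two, hσ, Nat.reduceEqDiff,
    if_true, if_false, Par.init, Par.pre, List.getD_cons_zero, List.getD_cons_succ, List.getD_nil,
    ← h.ha, ← h.hg, ← h.hns, ← h.hK, ← h.hm, ← h.hsm, ← h.hD1, ← h.hH, ← h.hU, ← h.hE]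

theorem den_powersC (hσ : ∀ x < 40, σ.reg x = P.pre x) :
    (∀ x < 40, (powersC.den ω σ).reg x = P.pre x) ∧
    (powersC.den ω σ).reg 41 = σ.reg 41 ∧ (powersC.den ω σ).reg 42 = P.p ^ P.k ∧
    (powersC.den ω σ).reg 44 = (P.ℓ * P.ns) ^ P.m ∧ (powersC.den ω σ).reg 45 = P.g ^ P.m := by
  have hk : (σ.set 42 1).reg 29 = P.k := hσ 29 (by omega)
  have H₁ := Cmd.den_rep (ω := ω) (i := 43) (x := 29) (σ := σ.set 42 1)
    (c := 42 ≔ reg 42 * reg 0) (fun j τ => τ.reg 42 = P.p ^ j) (by simp [State.set_reg]) (by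
      intro j τ _ _ hw _ h
      have e0 : τ.reg 0 = P.p := (hw 0 rfl).trans (hσ 0 (by omega))
      simp [Cmd.den, State.set_reg, h, e0, pow_succ])
  rw [hk] at H₁
  set σ₁ := (Cmd.rep 43 29 (42 ≔ reg 42 * reg 0)).den ω (σ.set 42 1) with hσ₁
  have hk₁ : ∀ x < 40, σ₁.reg x = P.pre x := fun x hx => by
    rw [hσ₁, Cmd.den_reg_of_keeps rfl _ hx, State.set_reg, if_neg (by omega), hσ x hx]
  set σ₂ := (σ₁.set 44 1).set 45 1 with hσ₂
  have hk₂ : ∀ x < 40, σ₂.reg x = P.pre x := fun x hx => by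
    rw [hσ₂, State.set_reg, if_neg (by omega), State.set_reg, if_neg (by omega), hk₁ x hx]
  have hm : σ₂.reg 12 = P.m := hk₂ 12 (by omega)
  have H₂ := Cmd.den_rep (ω := ω) (i := 43) (x := 12) (σ := σ₂)
    (c := 44 ≔ reg 44 * reg 36 ;; 45 ≔ reg 45 * reg 11)
    (fun j τ => τ.reg 44 = (P.ℓ * P.ns) ^ j ∧ τ.reg 45 = P.g ^ j)
    (by simp [hσ₂, State.set_reg]) (by
      rintro j τ - - hw - ⟨h1, h2⟩
      have e36 : τ.reg 36 = P.ℓ * P.ns := (hw 36 rfl).trans (hk₂ 36 (by omega))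
      have e11 : τ.reg 11 = P.g := (hw 11 rfl).trans (hk₂ 11 (by omega))
      simp [Cmd.den, State.set_reg, h1, h2, e36, e11, pow_succ])
  rw [hm] at H₂
  set C : Cmd := .rep 43 12 (44 ≔ reg 44 * reg 36 ;; 45 ≔ reg 45 * reg 11) with hC
  have e : powersC.den ω σ = C.den ω σ₂ := rfl
  rw [e]
  refine ⟨fun x hx => ?_, ?_, ?_, H₂.1, H₂.2⟩
  · rw [Cmd.den_reg_of_keeps rfl _ hx, hk₂ x hx]
  · rw [Cmd.den_reg C rfl]
    exact (Cmd.den_reg (.rep 43 29 (42 ≔ reg 42 * reg 0)) rfl (σ.set 42 1) : σ₁.reg 41 = _)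
  · rw [Cmd.den_reg C rfl]; exact H₁

theorem den_budgetC (h : P.Std) (hσ : ∀ x < 40, σ.reg x = P.pre x) (h41 : σ.reg 41 = P.f.size)
    (h42 : σ.reg 42 = P.p ^ P.k) (h44 : σ.reg 44 = (P.ℓ * P.ns) ^ P.m)
    (h45 : σ.reg 45 = P.g ^ P.m) : Ctx P (budgetC.den ω σ) := by
  intro x hx
  have e9 : σ.reg 9 = P.κ := hσ 9 (by omega)
  have e12 : σ.reg 12 = P.m := hσ 12 (by omega)
  have e15 : σ.reg 15 = P.K := hσ 15 (by omega)
  interval_cases x <;>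
  simp only [budgetC, Cmd.den, State.set_reg, Expr.eval_add, Expr.eval_sub, Expr.eval_mul,
    Expr.eval_div, Expr.eval_reg, Expr.eval_one, Expr.eval_two, Expr.eval_zero, Nat.reduceEqDiff,
    if_true, if_false, h41, h42, h44, h45, e9, e12, e15, ← h.hq, ← h.hM0, ← h.hN, ← h.hJ,
    ← h.hlg, Par.glob, List.getD_cons_zero, List.getD_cons_succ, List.getD_nil] <;>
  exact hσ _ (by omega)

/-- The loop counts the bits of register `40`. -/
theorem exec_bitlen_loop (b : ℕ) : ∀ v (σ : State), σ.reg 40 = v →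
    Small σ b → σ.reg 41 + v.size ≤ b → ∃ τ t, t ≤ (v.size + 1) * (6 * b + 20) ∧
      (∀ ω, Exec ω (.loop (reg 40)
        (.seq (.assign 40 (reg 40 / 2)) (.assign 41 (reg 41 + 1)))) σ τ t) ∧
      Small τ b ∧ τ.reg 41 = σ.reg 41 + v.size ∧ (∀ x < 40, τ.reg x = σ.reg x) ∧
      τ.arr = σ.arr ∧ τ.used = σ.used := by
  intro v
  induction v using Nat.strong_induction_on with
  | _ v ih =>
    intro σ hv hb h41
    have c40 : (reg 40).cost σ = 1 + v.size := by rw [← hv]; rfl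
    have hvb : v.size ≤ b := by rw [← hv]; exact hb.1 40
    by_cases h0 : v = 0
    · refine ⟨σ, _, ?_, fun _ => .loop_done (by rw [← h0, ← hv]; rfl), hb, by simp [h0],
        fun _ _ => rfl,
        rfl, rfl⟩
      rw [c40, h0]; simp
    · have hs : v.size = (v / 2).size + 1 := by
        conv_lhs => rw [← Nat.bit_bodd_div2 v, Nat.size_bit (by rwa [Nat.bit_bodd_div2])]
        rw [Nat.div2_val]
      set σ₁ := (σ.set 40 (v / 2)).set 41 (σ.reg 41 + 1) with hσ₁
      have e₁ : ∀ ω, Exec ω (.assign 40 (reg 40 / 2)) σ (σ.set 40 (v / 2))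
          ((reg 40 / 2).cost σ + 1) := by
        intro ω
        have := Exec.assign (ω := ω) 40 (reg 40 / 2) σ
        rw [Expr.eval_div, Expr.eval_reg, Expr.eval_two, hv] at this
        exact this
      have e₂ : ∀ ω, Exec ω (.assign 41 (reg 41 + 1)) (σ.set 40 (v / 2)) σ₁
          ((reg 41 + 1).cost (σ.set 40 (v / 2)) + 1) := fun _ => .assign 41 _ _
      have h41s : (σ.reg 41 + 1).size ≤ b := (size_le_self _).trans (by omega)
      have hb₁ : Small σ₁ b := (hb.set (by omega)).set h41s
      obtain ⟨τ, t, ht, he, hs', r41, rx, ra, ru⟩ := ih (v / 2) (by omega) σ₁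
        (by simp [hσ₁, State.set_reg]) hb₁ (by simp [hσ₁, State.set_reg]; omega)
      refine ⟨τ, _, ?_, fun ω => .loop_step (by rw [Expr.eval_reg, hv]; exact h0)
        (.seq (e₁ ω) (e₂ ω)) (he ω), hs', ?_,
        fun x hx => ?_, ra, ru⟩
      · have c₁ : (reg 40 / 2).cost σ = 1 + v.size + (1 + (2 : ℕ).size) + (1 + (v / 2).size) := by
          rw [← hv]; rfl
        have c₂ : (reg 41 + 1).cost (σ.set 40 (v / 2)) =
          1 + (σ.reg 41).size + (1 + (1 : ℕ).size) + (1 + (σ.reg 41 + 1).size) := rfl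
        have s1 : (1 : ℕ).size ≤ 1 := size_le_self 1
        have s2 : (2 : ℕ).size ≤ 2 := size_le_self 2
        have s3 := hb.1 41
        rw [c40, c₁, c₂, hs]
        rw [hs] at hvb
        have : ((v / 2).size + 1 + 1) * (6 * b + 20) =
          ((v / 2).size + 1) * (6 * b + 20) + (6 * b + 20) := by ring
        omega
      · rw [r41, hs]; simp [hσ₁, State.set_reg]; omega
      · rw [rx x hx]
        simp [hσ₁, State.set_reg, show x ≠ 41 by omega, show x ≠ 40 by omega]

theorem exec_bitlenP {b : ℕ} (hb : Small σ b) : ∃ τ t, t ≤ 100 * (b + 2) ^ 2 ∧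
    (∀ ω, Exec ω bitlenP σ τ t) ∧ Small τ b ∧ τ.reg 41 = (σ.reg 2).size ∧
    (∀ x < 40, τ.reg x = σ.reg x) ∧ τ.arr = σ.arr ∧ τ.used = σ.used := by
  set σ₁ := (σ.set 40 (σ.reg 2)).set 41 0 with hσ₁
  have h2 := hb.1 2
  have hb₁ : Small σ₁ b := (hb.set h2).set (by simp)
  obtain ⟨τ, t, ht, he, hs, r41, rx, ra, ru⟩ := exec_bitlen_loop b (σ.reg 2) σ₁
    (by simp [hσ₁, State.set_reg]) hb₁ (by simp [hσ₁, State.set_reg]; exact h2)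
  have e₁ : ∀ ω, Exec ω (.assign 40 (reg 2)) σ (σ.set 40 (σ.reg 2)) ((reg 2).cost σ + 1) :=
    fun _ => .assign 40 _ _
  have e₂ : ∀ ω, Exec ω (.assign 41 0) (σ.set 40 (σ.reg 2)) σ₁
    ((0 : Expr).cost (σ.set 40 (σ.reg 2)) + 1) := fun _ => .assign 41 _ _
  refine ⟨τ, _, ?_, fun ω => .seq (e₁ ω) (.seq (e₂ ω) (he ω)), hs, ?_, fun x hx => ?_, ra, ru⟩
  · have c₁ : (reg 2).cost σ = 1 + (σ.reg 2).size := rfl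
    have c₂ : (0 : Expr).cost (σ.set 40 (σ.reg 2)) = 1 + (0 : ℕ).size := rfl
    have s0 : (0 : ℕ).size ≤ 0 := size_le_self 0
    rw [c₁, c₂]
    have := Nat.mul_le_mul_right (6 * b + 20) (Nat.succ_le_succ h2)
    simp only [Nat.succ_eq_add_one] at this
    nlinarith
  · rw [r41]; simp [hσ₁, State.set_reg]
  · rw [rx x hx]
    simp [hσ₁, State.set_reg, show x ≠ 41 by omega, show x ≠ 40 by omega]

/-- The whole program; `τ` is the memory once the parameters have been computed. -/
theorem exec_recoverP : ∃ f, PolyBdd f ∧ ∀ (P : Par) (σ : State) (b : ℕ), P.Std →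
    (∀ x, σ.reg x = P.init x) → Small σ b → (∀ x, 4 ≤ x → x < 30 → P.glob x ≤ b) → 0 < P.p →
    ∃ τ, Ctx P τ ∧ τ.arr 0 = σ.arr 0 ∧ τ.used = σ.used ∧ ∀ ω, ∃ t ≤ f b,
      Exec ω recoverP σ ((mainC.den ω τ).set 0 ((mainC.den ω τ).reg 91)) t := by
  obtain ⟨f₁, p₁, h₁⟩ := Cmd.exec_of_straight deriveC_straight
  obtain ⟨f₂, p₂, h₂⟩ := Cmd.exec_of_tame powersC_tame
  obtain ⟨f₃, p₃, h₃⟩ := Cmd.exec_of_straight budgetC_straight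
  obtain ⟨f₄, p₄, h₄⟩ := Cmd.exec_of_tame mainC_tame
  set g₁ : ℕ → ℕ := fun b => f₁ b + b with hg₁
  have q₁ : PolyBdd g₁ := p₁.add .id
  set g₂ : ℕ → ℕ := fun b => g₁ b + f₂ (g₁ b) with hg₂
  have q₂ : PolyBdd g₂ := q₁.add (p₂.comp q₁)
  set g₃ : ℕ → ℕ := fun b => f₃ (g₂ b) + b with hg₃
  have q₃ : PolyBdd g₃ := (p₃.comp q₂).add .id
  refine ⟨fun b => f₁ b + (100 * (g₁ b + 2) ^ 2 + ((g₁ b + 1) * f₂ (g₁ b) + (f₃ (g₂ b) +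
      ((g₃ b + 1) * f₄ (g₃ b) + (g₃ b + f₄ (g₃ b) + 2))))),
    p₁.add (((PolyBdd.const 100).mul ((q₁.add (.const 2)).pow 2)).add
      (((q₁.add (.const 1)).mul (p₂.comp q₁)).add ((p₃.comp q₂).add
        (((q₃.add (.const 1)).mul (p₄.comp q₃)).add ((q₃.add (p₄.comp q₃)).add (.const 2)))))), ?_⟩
  intro P σ b hP hσ hb hglob hp
  set ω₀ : ℕ → Bool := fun _ => false
  set σ₁ := deriveC.den ω₀ σ with hσ₁
  have s₁ : Small σ₁ (g₁ b) := (h₁ ω₀ σ b hb).2.mono (by rw [hg₁]; beta_reduce; omega)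
  have r₁ : ∀ x < 40, σ₁.reg x = P.pre x := den_deriveC hP hσ
  obtain ⟨σ₂, t₂, ht₂, e₂, s₂, r41, r₂, a₂, u₂⟩ := exec_bitlenP s₁
  have r₂' : ∀ x < 40, σ₂.reg x = P.pre x := fun x hx => (r₂ x hx).trans (r₁ x hx)
  have hpre : ∀ x, 4 ≤ x → x < 30 → P.pre x ≤ P.glob x := by
    intro x h1 h2
    interval_cases x <;> first | exact le_rfl | exact Nat.zero_le _
  have G₂ : Params σ₂ (g₁ b) := ⟨fun x _ => s₂.1 x, fun x h1 h2 => by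
    rw [r₂' x (by omega)]
    have := hpre x h1 h2
    have := hglob x h1 h2
    rw [hg₁]; beta_reduce; omega, by rw [r₂' 0 (by omega)]; exact hp⟩
  set σ₃ := powersC.den ω₀ σ₂ with hσ₃
  have s₃ : Small σ₃ (g₂ b) := (h₂ ω₀ σ₂ _ _ s₂ G₂).2
  obtain ⟨r₃, k41, k42, k44, k45⟩ := den_powersC (ω := ω₀) r₂'
  set τ := budgetC.den ω₀ σ₃ with hτ
  have c₄ : Ctx P τ := den_budgetC hP r₃ (by rw [k41, r41, r₁ 2 (by omega)]; rfl) k42 k44 k45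
  have s₄ : Small τ (g₃ b) := (h₃ ω₀ σ₃ _ s₃).2.mono (by rw [hg₃]; beta_reduce; omega)
  have G₄ : Params τ (g₃ b) := ⟨fun x _ => s₄.1 x, fun x h1 h2 => by
    rw [c₄ x (by omega)]
    have := hglob x h1 h2
    rw [hg₃]; beta_reduce; omega, by rw [c₄ 0 (by omega)]; exact hp⟩
  refine ⟨τ, c₄, ?_, ?_, fun ω => ?_⟩
  · rw [hτ, Cmd.den_arr budgetC rfl, hσ₃, Cmd.den_arr powersC rfl, a₂, hσ₁,
      Cmd.den_arr deriveC rfl]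
  · rw [hτ, (Cmd.den_of_not_flips (c := budgetC) rfl ω₀ ω₀ _).2, hσ₃,
      (Cmd.den_of_not_flips (c := powersC) rfl ω₀ ω₀ _).2, u₂, hσ₁,
      (Cmd.den_of_not_flips (c := deriveC) rfl ω₀ ω₀ _).2]
  · obtain ⟨t₁, ht₁, e₁⟩ := (h₁ ω σ b hb).1
    rw [(Cmd.den_of_not_flips (c := deriveC) rfl ω ω₀ σ).1] at e₁
    obtain ⟨t₃, ht₃, e₃⟩ := (h₂ ω σ₂ _ _ s₂ G₂).1
    rw [(Cmd.den_of_not_flips (c := powersC) rfl ω ω₀ σ₂).1] at e₃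
    obtain ⟨t₄, ht₄, e₄⟩ := (h₃ ω σ₃ _ s₃).1
    rw [(Cmd.den_of_not_flips (c := budgetC) rfl ω ω₀ σ₃).1] at e₄
    obtain ⟨⟨t₅, ht₅, e₅⟩, s₅⟩ := h₄ ω τ _ _ s₄ G₄
    refine ⟨_, ?_, .seq e₁ (.seq (e₂ ω) (.seq e₃ (.seq e₄ (.seq e₅ (.assign 0 (reg 91) _)))))⟩
    have c₆ : (reg 91).cost (mainC.den ω τ) = 1 + ((mainC.den ω τ).reg 91).size := rfl
    have := s₅.1 91
    rw [c₆]
    beta_reduce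
    omega

end RAM

/-! ### Codewords and messages -/

namespace RAM

open Finset Polynomial MeasureTheory

variable {F : Type*} [Field F] {P : Par} {α : F} {e : ℕ → F}

theorem isHit_iff {c : ℕ → F} : IsHit P α e c ↔
    ∃ p : F[X], p.natDegree ≤ P.d ∧ (∀ l < P.ns, c l = p.eval (α ^ l)) ∧
      P.a ≤ agreeCount P e c := by
  constructor
  · rintro ⟨⟨f, hf⟩, ha⟩
    refine ⟨ofCoeffs (P.d + 1) f, Nat.lt_succ_iff.1 (natDegree_ofCoeffs_lt (Nat.succ_pos _) f),
      fun l hl => ?_, ha⟩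
    rw [hf l hl, eval_ofCoeffs]
    exact sum_congr rfl fun i _ => by rw [pow_mul]
  · rintro ⟨p, hp, hc, ha⟩
    refine ⟨⟨p.coeff, fun l hl => ?_⟩, ha⟩
    rw [hc l hl, ← ofCoeffs_coeff hp, eval_ofCoeffs]
    refine sum_congr rfl fun i hi => ?_
    rw [ofCoeffs_coeff hp, pow_mul]

theorem agreeCount_eq (hns : P.ns = P.n * P.s) {c : ℕ → F} {p : F[X]}
    (hc : ∀ l < P.ns, c l = p.eval (α ^ l)) : agreeCount P e c = #(agreeCols P α e p) := by
  rw [agreeCount, ← Set.ncard_coe_finset]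
  congr 1
  ext i
  rw [Set.mem_ofPred_eq, mem_coe, mem_agreeCols]
  refine and_congr_right fun hi => exists_congr fun j => and_congr_right fun _ =>
    forall₂_congr fun w hw => ?_
  rw [hc _ (by rw [hns]; exact idx_lt hi hw)]

theorem isMsg_iff_isHit (hns : P.ns = P.n * P.s) {c : ℕ → F} :
    IsHit P α e c ↔ ∃ p, IsMsg P α e p ∧ ∀ l < P.ns, c l = p.eval (α ^ l) := by
  rw [isHit_iff]
  refine exists_congr fun p => ⟨fun ⟨h1, h2, h3⟩ => ⟨⟨h1, ?_⟩, h2⟩, fun ⟨⟨h1, h3⟩, h2⟩ =>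
    ⟨h1, h2, ?_⟩⟩
  · rwa [← agreeCount_eq hns h2]
  · rwa [agreeCount_eq hns h2]

variable (E : Fin P.n → Fin P.ℓ → Fin P.s → F)

/-- The input lists as a single sequence. -/
noncomputable def inputSeq (idx : ℕ) : F :=
  if h : idx / P.s / P.ℓ < P.n ∧ idx / P.s % P.ℓ < P.ℓ ∧ idx % P.s < P.s then
    E ⟨idx / P.s / P.ℓ, h.1⟩ ⟨idx / P.s % P.ℓ, h.2.1⟩ ⟨idx % P.s, h.2.2⟩
  else 0

theorem inputSeq_eq (i : Fin P.n) (j : Fin P.ℓ) (w : Fin P.s) :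
    inputSeq E (((i : ℕ) * P.ℓ + j) * P.s + w) = E i j w := by
  have e1 : (((i : ℕ) * P.ℓ + j) * P.s + w) / P.s = i * P.ℓ + j := idx_div w.2
  have e2 : (((i : ℕ) * P.ℓ + j) * P.s + w) % P.s = w := idx_mod w.2
  have e3 : ((i : ℕ) * P.ℓ + j) / P.ℓ = i := idx_div j.2
  have e4 : ((i : ℕ) * P.ℓ + j) % P.ℓ = j := idx_mod j.2
  rw [inputSeq, dif_pos (by rw [e1, e2, e3, e4]; exact ⟨i.2, j.2, w.2⟩)]
  have key : ∀ a b c (ha : a < P.n) (hb : b < P.ℓ) (hc : c < P.s), a = i → b = j → c = w →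
      E ⟨a, ha⟩ ⟨b, hb⟩ ⟨c, hc⟩ = E i j w := by
    rintro _ _ _ _ _ _ rfl rfl rfl; rfl
  exact key _ _ _ _ _ _ (by rw [e1, e3]) (by rw [e1, e4]) e2

/-- The codeword of `p`. -/
noncomputable def codeword (P : Par) (α : F) (p : F[X]) (i : Fin P.n) (w : Fin P.s) : F :=
  p.eval (α ^ ((i : ℕ) * P.s + w))

/-- Columns with and without agreement. -/
theorem card_disagree (p : F[X]) :
    {i | codeword P α p i ∉ Set.range (E i)}.ncard + #(agreeCols P α (inputSeq E) p) = P.n := by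
  classical
  have h1 : agreeCols P α (inputSeq E) p =
      (univ.filter fun i => codeword P α p i ∈ Set.range (E i)).map Fin.valEmbedding := by
    ext i
    rw [mem_agreeCols]
    simp only [mem_map, mem_filter, mem_univ, true_and, Fin.valEmbedding_apply]
    constructor
    · rintro ⟨hi, j, hj, h⟩
      refine ⟨⟨i, hi⟩, ⟨⟨j, hj⟩, ?_⟩, rfl⟩
      ext w
      have h2 := inputSeq_eq E ⟨i, hi⟩ ⟨j, hj⟩ w
      rw [← h2]
      exact (h w w.2).symm
    · rintro ⟨i, ⟨j, hj⟩, rfl⟩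
      refine ⟨i.2, j, j.2, fun w hw => ?_⟩
      have h2 := inputSeq_eq E i j ⟨w, hw⟩
      simp only at h2
      rw [h2, hj]; rfl
  rw [h1, card_map, Set.ncard_eq_toFinset_card', add_comm]
  have h2 : {i | codeword P α p i ∉ Set.range (E i)}.toFinset =
      univ.filter fun i => ¬ codeword P α p i ∈ Set.range (E i) := by ext; simp
  rw [h2, card_filter_add_card_filter_not, card_univ, Fintype.card_fin]

/-- The words in the output list are the codewords of the message polynomials that agree with
the lists in at least `a` columns. -/
theorem mem_recoveryList_iff (hn : 0 < P.n) {ρ : ℝ} (hρ : 0 ≤ ρ) (he : P.e = ⌊ρ * P.n⌋₊)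
    (ha : P.a = P.n - P.e) {c : Fin P.n → Fin P.s → F} :
    c ∈ recoveryList (FRS α P.s P.n P.d) ρ (fun i => Set.range (E i)) ↔
      ∃ p, IsMsg P α (inputSeq E) p ∧ c = codeword P α p := by
  have key : ∀ p : F[X], listDist (codeword P α p) (fun i => Set.range (E i)) ≤ ρ ↔
      P.a ≤ #(agreeCols P α (inputSeq E) p) := by
    intro p
    have h1 := card_disagree (α := α) E p
    rw [listDist, div_le_iff₀ (by exact_mod_cast hn), ← Nat.le_floor_iff (by positivity), ← he]
    omega
  constructor
  · rintro ⟨⟨p, hp, hc⟩, hd⟩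
    have hcw : c = codeword P α p := by ext i w; exact hc i w
    rw [hcw, key] at hd
    exact ⟨p, ⟨hp, hd⟩, hcw⟩
  · rintro ⟨p, hp, rfl⟩
    exact ⟨⟨p, hp.1, fun i j => rfl⟩, (key p).2 hp.2⟩

/-! ### Correctness of the algorithm -/

/-- If every message has a good trial, the output is correct. -/
theorem isOutputList_of_good {p : ℕ} [Fact p.Prime] [Algebra (ZMod p) F]
    {pb : PowerBasis (ZMod p) F}
    (h : P.Num α) {ρ : ℝ} (hρ : 0 ≤ ρ) (he : P.e = ⌊ρ * P.n⌋₊) (ha : P.a = P.n - P.e) {σ : State}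
    {ws : ℕ → ℕ → F} (hl : HasList (fieldCode pb) P α (inputSeq E) σ ws)
    (hall : ∀ p, IsMsg P α (inputSeq E) p →
      ∃ b < σ.reg 91, ∀ l < P.ns, p.eval (α ^ l) = ws b l) :
    IsOutputList pb (recoveryList (FRS α P.s P.n P.d) ρ fun i => Set.range (E i))
      (σ.set 0 (σ.reg 91)) := by
  have hns := h.hns
  have hs : 0 < P.s := by have := h.ok.hm; have := h.ok.hms; omega
  have hlt : ∀ (i : Fin P.n) (w : Fin P.s), (i : ℕ) * P.s + w < P.ns := fun i w => by
    rw [hns]; exact idx_lt i.2 w.2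
  have hidx : ∀ l < P.ns, ∃ (i : Fin P.n) (w : Fin P.s), l = i * P.s + w := fun l hl => by
    rw [hns, mul_comm] at hl
    exact ⟨⟨l / P.s, Nat.div_lt_of_lt_mul hl⟩, ⟨l % P.s, Nat.mod_lt _ hs⟩,
      (Nat.div_add_mod' l P.s).symm⟩
  refine ⟨fun m i w => ws m (i * P.s + w), ?_, ?_, ?_⟩
  · intro m m' hmm
    refine Fin.ext (hl.distinct m m.2 m' m'.2
      fun l hl' => ?_)
    obtain ⟨i, w, rfl⟩ := hidx l hl'
    exact congrFun (congrFun hmm i) w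
  · ext c
    rw [mem_recoveryList_iff E h.ok.hn hρ he ha]
    constructor
    · rintro ⟨m, rfl⟩
      obtain ⟨p, hp, hc⟩ := (isMsg_iff_isHit hns).1 (hl.hit m m.2)
      refine ⟨p, hp, ?_⟩
      ext i w
      exact hc _ (hlt i w)
    · rintro ⟨p, hp, rfl⟩
      obtain ⟨b, hb, hbl⟩ := hall p hp
      refine ⟨⟨b, hb⟩, ?_⟩
      ext i w
      exact (hbl _ (hlt i w)).symm
  · intro m i w
    have := hl.stored m m.2 _ (hlt i w)
    rw [hns] at this
    rw [State.set_arr, ← this]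
    congr 1
    ring

/-- The output is correct with high probability. -/
theorem coins_output_ge {p : ℕ} [Fact p.Prime] [Algebra (ZMod p) F] {pb : PowerBasis (ZMod p) F}
    (hS : P.Std) (h : P.Num α) (hp : P.p = p) (hk : P.k = pb.dim) (hf : P.f = modulusCode pb)
    (hα : P.α = fieldCode pb α) (hcard : ∀ t : F, t ≠ 0 → t ^ (P.q - 1) = 1)
    {ρ : ℝ} (hρ : 0 ≤ ρ) (he : P.e = ⌊ρ * P.n⌋₊) {τ : State} (hτ : Ctx P τ)
    (hin : ∀ j < P.K * P.s, τ.arr 0 j = fieldCode pb (inputSeq E j)) (hu : τ.used = 0) :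
    1 - (1 / 2 : ℝ) ^ P.κ ≤ coins.real {ω | IsOutputList pb
      (recoveryList (FRS α P.s P.n P.d) ρ fun i => Set.range (E i))
      ((mainC.den ω τ).set 0 ((mainC.den ω τ).reg 91))} := by
  have hp2 : 2 ≤ p := Nat.Prime.two_le Fact.out
  have hq : P.q = p ^ pb.dim := by rw [hS.hq, hp, hk]
  have hF : FieldSpec P (fieldCode pb) := fieldSpec pb hp hk hf hq
  have hq2 : 2 ≤ P.q := by
    rw [hq]; exact hp2.trans (Nat.le_self_pow pb.dim_pos.ne' p)
  have hinv : ∀ t : F, t ≠ 0 → t ^ (P.q - 2) = t⁻¹ := by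
    intro t ht
    refine eq_inv_of_mul_eq_one_left ?_
    rw [← pow_succ, show P.q - 2 + 1 = P.q - 1 by omega, hcard t ht]
  have hlg : P.q - 2 < 2 ^ P.lg := by
    have h1 : P.q ≤ P.f := by rw [hq, hf, modulusCode_eq]; exact Nat.le_add_left _ _
    have h2 := Nat.lt_size_self P.f
    rw [hS.hlg]; omega
  set ω₀ : ℕ → Bool := fun _ => false
  obtain ⟨hdata, Q, hQ, hQs, hQn⟩ := den_prepC (ω := ω₀) hF h.ok hτ hα hin
  have hQ0 := hQn (exists_interp h _)
  have hbad := coins_bad_le h hS.rand hQs hQ0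
  set B : Set (ℕ → Bool) := {ω | ∃ p, IsMsg P α (inputSeq E) p ∧
    ∀ i < P.N, ¬ IsGood P α (inputSeq E) Q p (coinNum ω P.J / P.K ^ (P.m * i))} with hB
  set A : Set (ℕ → Bool) := {ω | IsOutputList pb
      (recoveryList (FRS α P.s P.n P.d) ρ fun i => Set.range (E i))
      ((mainC.den ω τ).set 0 ((mainC.den ω τ).reg 91))} with hA
  -- Interpolation uses no coins, so that `Q` is the same for all outcomes.
  have hcover : (Set.univ : Set (ℕ → Bool)) ⊆ A ∪ B := by
    intro ω _
    by_cases hω : ω ∈ B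
    · exact Or.inr hω
    · left
      have hprep := Cmd.den_of_not_flips (c := prepC) rfl ω ω₀ τ
      have e1 : mainC.den ω τ = searchC.den ω (prepC.den ω₀ τ) := by rw [← hprep.1]; rfl
      have hu' : (prepC.den ω₀ τ).used = 0 := by rw [← hprep.1, hprep.2, hu]
      obtain ⟨ws, hl, hfound⟩ := den_searchC (ω := ω) hF h.ok hdata hlg hQ hu'
      rw [hA, Set.mem_ofPred_eq, e1]
      refine isOutputList_of_good E h hρ he hS.ha hl fun p hp => ?_
      refine hfound _ ((isMsg_iff_isHit h.hns).2 ⟨p, hp, fun _ _ => rfl⟩) ?_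
      rw [hB, Set.mem_ofPred_eq] at hω
      push Not at hω
      obtain ⟨i, hi, hgood⟩ := hω p hp
      exact ⟨i, hi, hgood.determines h hinv hp.1 (hp.interp h hQs)⟩
  have h1 : (1 : ℝ) ≤ coins.real A + coins.real B := by
    calc (1 : ℝ) = coins.real Set.univ := by simp
      _ ≤ coins.real (A ∪ B) := measureReal_mono hcover
      _ ≤ _ := measureReal_union_le _ _
  linarith

end RAM

/-! ### Bounds for the parameters, and the theorem -/

namespace RAM

open Finset Polynomial MeasureTheory

variable {P : Par}

/-- All parameters that bound loops are at most `B ^ 7`, if the input, `M0` and the bit length of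
`f` are at most `B`. -/
theorem Par.Std.glob_le (h : P.Std) (hw : P.Wide) {B : ℕ} (hB : 3 ≤ B) (hk : P.k + 1 ≤ B)
    (hs : P.s ≤ B) (hd : P.d + 1 ≤ B) (hn : P.n ≤ B) (hℓ : P.ℓ ≤ B) (he : P.e ≤ B)
    (hκ : P.κ + 1 ≤ B) (hM : P.M0 ≤ B) (hlg : P.lg ≤ B) :
    ∀ x, 4 ≤ x → x < 30 → P.glob x ≤ B ^ 7 := by
  have hB1 : 1 ≤ B := by omega
  have up : ∀ {v i}, v ≤ B ^ i → i ≤ 7 → v ≤ B ^ 7 := fun h hi =>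
    h.trans (Nat.pow_le_pow_right hB1 hi)
  have up1 : ∀ {v}, v ≤ B → v ≤ B ^ 7 := fun h => h.trans (Nat.le_self_pow (by omega) B)
  have two : ∀ i, 2 * B ^ i ≤ B ^ (i + 1) := fun i => by
    rw [pow_succ']; exact Nat.mul_le_mul_right _ (by omega)
  have hm : P.m ≤ B := (h.m_le hw).trans hs
  have hm0 := h.m_pos hw
  have ha : P.a ≤ B := by rw [h.ha]; omega
  have hns : P.ns ≤ B ^ 2 := by rw [h.hns, sq]; exact Nat.mul_le_mul hn hs
  have hg : P.g ≤ B ^ 2 := by have := h.g_le hw; omega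
  have hK : P.K ≤ B ^ 2 := by rw [h.hK, sq]; exact Nat.mul_le_mul hn hℓ
  have hsm : P.sm ≤ B := by have := h.hsm; omega
  have hD1 : P.D1 ≤ B ^ 3 := by
    rw [h.hD1]
    have h1 : P.K * P.sm ≤ B ^ 3 := by rw [pow_succ]; exact Nat.mul_le_mul hK hsm
    have h2 : P.K * P.sm / (P.m + 1) ≤ P.K * P.sm / 2 := Nat.div_le_div_left (by omega) (by omega)
    have h3 : 2 ≤ B ^ 3 := by have := Nat.le_self_pow (n := 3) (by omega) B; omega
    omega
  have hH : P.H ≤ B ^ 4 := by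
    have h1 : 2 * B ^ 3 ≤ B ^ 4 := two 3
    have h2 := Nat.le_self_pow (n := 3) (by omega) B
    rw [h.hH]; omega
  have hU : P.U ≤ B ^ 5 := by
    have h1 : 2 * B ^ 4 ≤ B ^ 5 := two 4
    have h2 : P.m * P.D1 ≤ B ^ 4 := by rw [pow_succ']; exact Nat.mul_le_mul hm hD1
    rw [h.hU]; omega
  have hE : P.E ≤ B ^ 7 := by
    rw [h.hE, show 7 = 2 + 5 from rfl, pow_add]; exact Nat.mul_le_mul hns hU
  have hN : P.N ≤ B ^ 3 := by
    rw [h.hN, pow_succ']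
    refine Nat.mul_le_mul hM ?_
    have h1 : 2 * B ^ 1 ≤ B ^ 2 := two 1
    rw [pow_one] at h1
    omega
  have hJ : P.J ≤ B ^ 6 := by
    rw [h.hJ, show 6 = 2 + 1 + 3 from rfl, pow_add, pow_add, pow_one]
    exact Nat.mul_le_mul (Nat.mul_le_mul hK hm) hN
  intro x h1 h2
  interval_cases x
  · exact up1 hs
  · exact up1 (by change P.d ≤ B; omega)
  · exact up1 hn
  · exact up1 hℓ
  · exact up1 he
  · exact up1 (by change P.κ ≤ B; omega)
  · exact up1 ha
  · exact up hg (by omega)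
  · exact up1 hm
  · exact up hD1 (by omega)
  · exact up hU (by omega)
  · exact up hK (by omega)
  · exact hE
  · exact up1 hlg
  · exact up hN (by omega)
  · exact up hJ (by omega)
  · exact up1 hsm
  · exact up hH (by omega)
  · exact up hns (by omega)
  · exact up1 hk
  · exact up1 hd
  · exact Nat.zero_le _
  · exact Nat.zero_le _
  · exact Nat.zero_le _
  · exact Nat.zero_le _
  · exact up1 (by change P.k ≤ B; omega)

variable {F : Type*} [Field F] {α : F}

/-- The list size. -/
theorem encard_recoveryList_le (hS : P.Std) (h : P.Num α) (hw : P.Wide)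
    {ε ρ : ℝ} (hε : 0 < ε) (hg : ε * P.ns ≤ P.g) (hρ : 0 ≤ ρ) (he : P.e = ⌊ρ * P.n⌋₊)
    (E : Fin P.n → Fin P.ℓ → Fin P.s → F) :
    (recoveryList (FRS α P.s P.n P.d) ρ fun i => Set.range (E i)).encard ≤
      ⌊((P.ℓ : ℝ) / ε) ^ (4 * (P.ℓ : ℝ) / ε)⌋₊ := by
  have h1 : (recoveryList (FRS α P.s P.n P.d) ρ fun i => Set.range (E i)) =
      codeword P α '' {p | IsMsg P α (inputSeq E) p} := by
    ext c
    rw [mem_recoveryList_iff E hw.hn hρ he hS.ha]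
    exact exists_congr fun p => and_congr_right fun _ => eq_comm
  have hfin := finite_msg h (inputSeq E)
  rw [h1]
  refine (Set.encard_image_le _ _).trans ?_
  rw [hfin.encard_eq_coe_toFinset_card]
  refine Nat.cast_le.2 (Nat.le_floor (hS.le_rpow hw hε hg ?_))
  have := card_msg_mul_le h (T := hfin.toFinset) (e := inputSeq E) fun p hp => by simpa using hp
  rwa [hS.hns, show P.ℓ * (P.n * P.s) = P.K * P.s by rw [hS.hK]; ring]

theorem pow_inj_of_le [Fintype F] (hα : IsPrimitiveRoot α (Fintype.card F - 1)) {s n : ℕ}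
    (hn : 0 < n) (hle : (n : ℝ) ≤ ((Fintype.card F : ℝ) - 1) / s) :
    ∀ i < n * s, ∀ j < n * s, α ^ i = α ^ j → i = j := by
  have hn' : (0 : ℝ) < n := by exact_mod_cast hn
  have hs : 0 < s := by
    rcases Nat.eq_zero_or_pos s with rfl | h
    · simp at hle; omega
    · exact h
  have hs' : (0 : ℝ) < s := by exact_mod_cast hs
  rw [le_div_iff₀ hs'] at hle
  have h1 : n * s + 1 ≤ Fintype.card F := by
    have : (n * s + 1 : ℝ) ≤ Fintype.card F := by linarith
    exact_mod_cast this
  intro i hi j hj hij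
  exact hα.pow_inj (by omega) (by omega) hij

/-- The sizes of the numbers in the initial memory. -/
theorem small_inputState {p : ℕ} [Fact p.Prime] [Algebra (ZMod p) F] (pb : PowerBasis (ZMod p) F)
    (α : F) {s d n ℓ e κ b : ℕ} (E : Fin n → Fin ℓ → Fin s → F)
    (hq : (modulusCode pb).size ≤ b) (hp : p ≤ modulusCode pb) (hpq : p ^ pb.dim ≤ modulusCode pb)
    (hk : pb.dim ≤ b) (hs : s ≤ b) (hd : d ≤ b) (hn : n ≤ b) (hℓ : ℓ ≤ b) (he : e ≤ b)
    (hκ : κ ≤ b) : Small (inputState pb α s d n ℓ e κ E) b := by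
  have hle : ∀ {v}, v ≤ b → v.size ≤ b := fun h => (size_le_self _).trans h
  have hF : ∀ x : F, (fieldCode pb x).size ≤ b := fun x =>
    (Nat.size_le_size ((fieldCode_lt pb x).le.trans hpq)).trans hq
  refine ⟨fun x => ?_, fun a i => ?_⟩
  · simp only [inputState]
    rcases x with _ | _ | _ | _ | _ | _ | _ | _ | _ | _ | x
    · exact (Nat.size_le_size hp).trans hq
    · exact hle hk
    · exact hq
    · exact hF α
    · exact hle hs
    · exact hle hd
    · exact hle hn
    · exact hle hℓ
    · exact hle he
    · exact hle hκ
    · simp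
  · simp only [inputState]
    split
    · exact hF _
    · simp

end RAM

open RAM in
/-- The claim on list recovery. The list size `L` is the integral part of the bound, which is at
least `M0 - 1`, so that the number of trials is polynomial in `L` and `κ`. -/
theorem exists_recovery : ∃ (M : RAM.Prog) (K : ℕ),
      ∀ (F : Type*) [Field F] [Fintype F] (α : F) (s d n ℓ : ℕ) (δ ε : ℝ),
        IsPrimitiveRoot α (Fintype.card F - 1) →
        0 < n → 0 < ℓ → 0 < ε →
        (n : ℝ) ≤ ((Fintype.card F : ℝ) - 1) / s →
        δ = 1 - (d : ℝ) / ((s : ℝ) * n) →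
        16 * (ℓ : ℝ) / ε ^ 2 ≤ s →
        ∃ L : ℕ, (L : ℝ) ≤ ((ℓ : ℝ) / ε) ^ (4 * (ℓ : ℝ) / ε) ∧
          IsListRecoverable (FRS α s n d) (δ - ε) ℓ L ∧
          (ε ≤ δ →
            ∀ (p : ℕ) [Fact p.Prime] [Algebra (ZMod p) F] (pb : PowerBasis (ZMod p) F) (κ : ℕ)
              (E : Fin n → Fin ℓ → Fin s → F), (∀ i, Function.Injective (E i)) →
              RecoversWithin M pb α s d n ℓ (δ - ε) κ E
                (K * (Nat.clog 2 (Fintype.card F) + s + d + n + L + κ) ^ K)) := by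
  obtain ⟨f, hf, hexec⟩ := exec_recoverP
  obtain ⟨C, hC⟩ := hf.comp ((PolyBdd.id.add (.const 3)).pow 7)
  -- The time is at most `C * (T + 1) ^ C`, where `T` is the sum in the theorem; as `1 ≤ T`, this is
  -- at most `C * 2 ^ C * T ^ C`.
  refine ⟨recoverP, C * 2 ^ C, fun F _ _ α s d n ℓ δ ε hα hn hℓ hε hle hδ hs =>
    ⟨⌊((ℓ : ℝ) / ε) ^ (4 * (ℓ : ℝ) / ε)⌋₊, Nat.floor_le (by positivity), ?_, ?_⟩⟩
  · intro S hS
    by_cases hεδ : ε ≤ δ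
    · have hE : ∀ i, ∃ f : Fin ℓ → Fin s → F, Set.range f = S i := by
        intro i
        have hfin : (S i).Finite := Set.finite_of_encard_eq_coe (hS i)
        have hc : hfin.toFinset.card = ℓ := by
          have := hS i
          rw [hfin.encard_eq_coe_toFinset_card] at this
          exact_mod_cast this
        refine ⟨fun j => (hfin.toFinset.equivFinOfCardEq hc).symm j, ?_⟩
        ext c
        constructor
        · rintro ⟨j, rfl⟩
          exact hfin.mem_toFinset.1 ((hfin.toFinset.equivFinOfCardEq hc).symm j).2
        · intro hc'
          exact ⟨hfin.toFinset.equivFinOfCardEq hc ⟨c, hfin.mem_toFinset.2 hc'⟩, by simp⟩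
      choose E hE using hE
      have hSE : S = fun i => Set.range (E i) := funext fun i => (hE i).symm
      obtain ⟨P, hP, -, -, -, -, rfl, rfl, rfl, rfl, he, -⟩ :=
        exists_par 0 0 0 0 s d n ℓ ⌊(δ - ε) * n⌋₊ 0
      obtain ⟨hw, hg⟩ := hP.wide hn hℓ hε hδ hs hεδ he
      have hnum : P.Num α := hP.num hw (by rw [hP.hns]; exact pow_inj_of_le hα hn hle)
      rw [hSE]
      exact encard_recoveryList_le hP hnum hw hε hg (by linarith) he E
    -- The radius is negative, and the list is empty.
    · have h0 : recoveryList (FRS α s n d) (δ - ε) S = ∅ := by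
        rw [Set.eq_empty_iff_forall_notMem]
        rintro c ⟨-, hc⟩
        have : 0 ≤ listDist c S := by unfold listDist; positivity
        linarith
      rw [h0, Set.encard_empty]; exact zero_le
  · intro hεδ p _ _ pb κ E _
    have hcard : Fintype.card F = p ^ pb.dim := by
      have := Module.card_eq_pow_finrank (K := ZMod p) (V := F)
      rwa [ZMod.card, pb.finrank] at this
    obtain ⟨P, hP, hp, hk, hfm, hPα, rfl, rfl, rfl, rfl, he, rfl⟩ :=
      exists_par p pb.dim (modulusCode pb) (fieldCode pb α) s d n ℓ ⌊(δ - ε) * n⌋₊ κ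
    obtain ⟨hw, hg⟩ := hP.wide hn hℓ hε hδ hs hεδ he
    have hnum : P.Num α := hP.num hw (by rw [hP.hns]; exact pow_inj_of_le hα hn hle)
    have hM0 := hP.M0_le hw hε hg
    set L := ⌊((P.ℓ : ℝ) / ε) ^ (4 * (P.ℓ : ℝ) / ε)⌋₊ with hL
    set T := Nat.clog 2 (Fintype.card F) + P.s + P.d + P.n + L + P.κ with hT
    have hp2 : 2 ≤ p := Nat.Prime.two_le Fact.out
    have hqf : p ^ pb.dim ≤ modulusCode pb := by
      rw [modulusCode_eq]; exact Nat.le_add_left _ _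
    have hclog : p ^ pb.dim ≤ 2 ^ Nat.clog 2 (Fintype.card F) := by
      rw [← hcard]; exact Nat.le_pow_clog (by omega) _
    have hsize : (modulusCode pb).size ≤ T + 1 := by
      rw [Nat.size_le]
      have h1 := modulusCode_lt pb
      have h2 : 2 ^ (Nat.clog 2 (Fintype.card F) + 1) ≤ 2 ^ (T + 1) :=
        Nat.pow_le_pow_right (by omega) (by omega)
      rw [pow_succ] at h2
      omega
    have hdim : pb.dim ≤ T := by
      have h1 : 2 ^ pb.dim ≤ 2 ^ Nat.clog 2 (Fintype.card F) :=
        (Nat.pow_le_pow_left hp2 _).trans hclog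
      have := (Nat.pow_le_pow_iff_right (by omega)).1 h1
      omega
    have hδ1 : δ ≤ 1 := by
      rw [hδ]
      have : 0 ≤ (P.d : ℝ) / (P.s * P.n) := by positivity
      linarith
    have heT : P.e ≤ P.n := by
      rw [he]
      refine Nat.floor_le_of_le ?_
      have : (0 : ℝ) ≤ P.n := by positivity
      nlinarith
    have hℓs : P.ℓ ≤ P.s := by
      have h1 : (P.ℓ : ℝ) ≤ P.s := by
        rw [div_le_iff₀ (by positivity)] at hs
        have h2 : (0 : ℝ) ≤ P.s := by positivity
        have h3 : (0 : ℝ) ≤ P.ℓ := by positivity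
        have h4 : ε ^ 2 ≤ 1 := by nlinarith
        nlinarith
      exact_mod_cast h1
    have hTB : T + 3 ≤ (T + 3) ^ 7 := Nat.le_self_pow (by omega) _
    have hsmall : Small (inputState pb α P.s P.d P.n P.ℓ P.e P.κ E) ((T + 3) ^ 7) :=
      small_inputState pb α E (by omega) ((Nat.le_self_pow pb.dim_pos.ne' p).trans hqf) hqf
        (by omega) (by omega) (by omega) (by omega) (by omega) (by omega) (by omega)
    have hglob := hP.glob_le hw (B := T + 3) (by omega) (by omega) (by omega) (by omega) (by omega)
      (by omega) (by omega) (by omega) (by omega) (by rw [hP.hlg, hfm]; omega)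
    obtain ⟨τ, hτ, harr, hused, hrun⟩ := hexec P (inputState pb α P.s P.d P.n P.ℓ P.e P.κ E) _ hP
      (fun x => by rw [Par.init, hp, hk, hfm, hPα]; rfl) hsmall hglob (by omega)
    have htime : f ((T + 3) ^ 7) ≤ C * 2 ^ C * T ^ (C * 2 ^ C) := by
      refine (hC T).trans ?_
      have hT1 : 1 ≤ T := by omega
      calc C * (T + 1) ^ C ≤ C * (2 * T) ^ C := by gcongr; omega
        _ = C * 2 ^ C * T ^ C := by rw [mul_pow]; ring
        _ ≤ C * 2 ^ C * T ^ (C * 2 ^ C) := by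
          exact Nat.mul_le_mul_left _
            (Nat.pow_le_pow_right hT1 (Nat.le_mul_of_pos_right _ (by positivity)))
    unfold RecoversWithin
    rw [← he]
    constructor
    · intro ω
      obtain ⟨t, ht, hex⟩ := hrun ω
      exact ⟨_, t, hex, ht.trans htime⟩
    · have hq1 : ∀ t : F, t ≠ 0 → t ^ (P.q - 1) = 1 := fun t ht => by
        rw [hP.hq, hp, hk, ← hcard]; exact FiniteField.pow_card_sub_one_eq_one t ht
      refine (coins_output_ge E hP hnum hp hk hfm hPα hq1 (by linarith) he hτ ?_ hused).trans
        (MeasureTheory.measureReal_mono fun ω hω => ?_)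
      · intro j _
        rw [harr, inputSeq]
        simp only [inputState, true_and]
        split
        · rfl
        · simpa using (fieldCode_natCast pb (c := 0) (by omega)).symm
      · obtain ⟨t, -, hex⟩ := hrun ω
        exact ⟨_, t, hex, hω⟩

theorem mainTheorem2 :
    -- list recovery: the bound on the list size and the randomized algorithm
    (∃ (M : RAM.Prog) (K : ℕ),
      ∀ (F : Type*) [Field F] [Fintype F] (α : F) (s d n ℓ : ℕ) (δ ε : ℝ),
        IsPrimitiveRoot α (Fintype.card F - 1) →
        0 < n → 0 < ℓ → 0 < ε →
        (n : ℝ) ≤ ((Fintype.card F : ℝ) - 1) / s →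
        δ = 1 - (d : ℝ) / ((s : ℝ) * n) →
        16 * (ℓ : ℝ) / ε ^ 2 ≤ s →
        ∃ L : ℕ, (L : ℝ) ≤ ((ℓ : ℝ) / ε) ^ (4 * (ℓ : ℝ) / ε) ∧
          IsListRecoverable (FRS α s n d) (δ - ε) ℓ L ∧
          (ε ≤ δ →
            ∀ (p : ℕ) [Fact p.Prime] [Algebra (ZMod p) F] (pb : PowerBasis (ZMod p) F) (κ : ℕ)
              (E : Fin n → Fin ℓ → Fin s → F), (∀ i, Function.Injective (E i)) →
              RecoversWithin M pb α s d n ℓ (δ - ε) κ E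
                (K * (Nat.clog 2 (Fintype.card F) + s + d + n + L + κ) ^ K))) ∧
    -- list decoding
    (∀ (F : Type*) [Field F] [Fintype F] (α : F) (s d n : ℕ) (δ ε : ℝ),
        IsPrimitiveRoot α (Fintype.card F - 1) →
        0 < n → 0 < ε →
        (n : ℝ) ≤ ((Fintype.card F : ℝ) - 1) / s →
        δ = 1 - (d : ℝ) / ((s : ℝ) * n) →
        16 / ε ^ 2 ≤ (s : ℝ) →
        ∃ L : ℕ, (L : ℝ) ≤ (1 / ε) ^ (4 / ε) ∧
          IsListDecodable (FRS α s n d) (δ - ε) L) := by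
  refine ⟨exists_recovery, fun F _ _ α s d n δ ε hα hn hε hle hδ hs => ?_⟩
  obtain ⟨M, K, h⟩ := exists_recovery
  obtain ⟨L, hL, hrec, -⟩ := h F α s d n 1 δ ε hα hn one_pos hε hle hδ (by simpa using hs)
  refine ⟨L, by simpa using hL, fun w => ?_⟩
  have h1 := hrec (fun i => {w i}) fun i => by simp
  simpa only [recoveryList, listDist, relDist, Set.mem_singleton_iff] using h1
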